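/- Let $r\ge 0$ be an integer, $\Omega_1=\{0\le t\le s\le 1\}$, $\Omega_2=\{0\le s\le t\le 1\}$, and let $\kappa$ be a real Green's kernel: $\kappa=\kappa_i$ on $\Omega_i$ ($i=1,2$), $\kappa_1(s,s)=\kappa_2(s,s)$ for $s\in[0,1]$, where all partial derivatives $D^{(j,k)}\kappa_i=\partial^{j+k}\kappa_i/\partial s^j\partial t^k$ with $0\le j,k\le 2r+2$ exist in the interior of $\Omega_i$ and extend continuously to $\Omega_i$. Let $(\mathcal Kx)(s)=\int_0^1\kappa(s,t)x(t)\,dt$ on the complex space $L^\infty[0,1]$. For $n\ge1$ put $h=1/n$, $t_j=jh$, and in each $[t_{j-1},t_j]$ ($1\le j\le n$) take the $2r+1$ nodes $\tau_j^i=t_{j-1}+ih/(2r)$, $0\le i\le 2r$, if $r\ge 1$, and the midpoint $\tau_j^0=(t_{j-1}+t_j)/2$ if $r=0$. For $x\in C[0,1]$, $Q_nx$ is on each subinterval the polynomial of degree at most $2r$ that agrees with $x$ at these nodes. $Q_n$ is extended to $L^\infty[0,1]$ by replacing each point evaluation $x\mapsto x(\tau_j^i)$ by any Hahn--Banach extension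 of it to $L^\infty[0,1]$ of norm $1$. Let $$\mathcal K_n^M=Q_n\mathcal K+\mathcal KQ_n-Q_n\mathcal KQ_n .$$ Let $\lambda\neq0$ be a simple eigenvalue of $\mathcal K$: for a positively oriented circle $\Gamma$ in the resolvent set of $\mathcal K$ that encloses $\lambda$ and no other point of the spectrum, the spectral projection $E=-\frac1{2\pi i}\int_\Gamma(\mathcal K-zI)^{-1}dz$ has rank one. Then, for all sufficiently large $n$, $\Gamma$ lies in the resolvent set of $\mathcal K_n^M$ and encloses exactly one point $\lambda_n^M$ of its spectrum; the spectral projection $E_n^M=-\frac1{2\pi i}\int_\Gamma(\mathcal K_n^M-zI)^{-1}dz$ has rank one, and its range is the eigenspace of $\mathcal K_n^M$ for $\lambda_n^M$; and $\lambda_n^M\to\lambda$. Moreover there is a constant $C$ independent of $n$ such that for all sufficiently large $n$, for every $\varphi_n^M\in\mathcal R(E_n^M)$ with $\|\varphi_n^M\|_\infty=1$, and with the iterated eigenvector $\widetilde\varphi_n^M=\frac1{\lambda_n^M}\mathcal K\varphi_n^M$, $$\|\varphi_n^M-E\varphi_n^M\|_\infty\le\begin{cases}Ch^{2r+2}&r\ge1\\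 Ch^3&r=0,\end{cases}\qquad \|\widetilde\varphi_n^M-E\widetilde\varphi_n^M\|_\infty\le\begin{cases}Ch^{2r+3}&r\ge1\\ Ch^4&r=0,\end{cases}$$ $$|\lambda-\lambda_n^M|\le\begin{cases}Ch^{2r+3}&r\ge1\\ Ch^4&r=0.\end{cases}$$ -/

import Mathlib

open MeasureTheory Set
open scoped ENNReal

/-- The complex Banach space `L^∞[0,1]`. -/
abbrev LInf : Type := Lp ℂ ∞ ((volume : Measure ℝ).restrict (Icc (0 : ℝ) 1))

/-- The closed triangle `0 ≤ t ≤ s ≤ 1`. -/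
def lowerTriangle : Set (ℝ × ℝ) := {p | 0 ≤ p.2 ∧ p.2 ≤ p.1 ∧ p.1 ≤ 1}

/-- The closed triangle `0 ≤ s ≤ t ≤ 1`. -/
def upperTriangle : Set (ℝ × ℝ) := {p | 0 ≤ p.1 ∧ p.1 ≤ p.2 ∧ p.2 ≤ 1}

/-- All partial derivatives `∂^(j+k) f / ∂s^j ∂t^k` with `0 ≤ j, k ≤ m` exist in the interior of `Ω`
and extend continuously to `Ω`; `D j k` is that extension. -/
def HasContPartials (m : ℕ) (Ω : Set (ℝ × ℝ)) (f : ℝ → ℝ → ℝ) : Prop :=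
  ∃ D : ℕ → ℕ → ℝ → ℝ → ℝ,
    (∀ s t, (s, t) ∈ Ω → D 0 0 s t = f s t) ∧
    (∀ j k, j ≤ m → k ≤ m → ContinuousOn (fun p : ℝ × ℝ => D j k p.1 p.2) Ω) ∧
    (∀ j k, j < m → k ≤ m → ∀ s t, (s, t) ∈ interior Ω →
      HasDerivAt (fun u => D j k u t) (D (j + 1) k s t) s) ∧
    (∀ j k, j ≤ m → k < m → ∀ s t, (s, t) ∈ interior Ω →
      HasDerivAt (fun u => D j k s u) (D j (k + 1) s t) t)

/-- A real kernel of Green's function type, smooth enough for piecewise polynomials of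
degree `2 r`: one smooth function on each closed triangle, the two agreeing on the diagonal. -/
structure GreenKernel (r : ℕ) where
  κ₁ : ℝ → ℝ → ℝ
  κ₂ : ℝ → ℝ → ℝ
  smooth₁ : HasContPartials (2 * r + 2) lowerTriangle κ₁
  smooth₂ : HasContPartials (2 * r + 2) upperTriangle κ₂
  diag : ∀ s ∈ Icc (0 : ℝ) 1, κ₁ s s = κ₂ s s

/-- The kernel `κ`, equal to `κ₁` for `t ≤ s` and to `κ₂` for `s ≤ t`. -/
noncomputable def GreenKernel.kernel {r : ℕ} (G : GreenKernel r) (s t : ℝ) : ℝ :=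
  if t ≤ s then G.κ₁ s t else G.κ₂ s t

lemma HasContPartials.continuousOn {m : ℕ} {Ω : Set (ℝ × ℝ)} {f : ℝ → ℝ → ℝ}
    (hf : HasContPartials m Ω f) : ContinuousOn (fun p : ℝ × ℝ => f p.1 p.2) Ω := by
  obtain ⟨D, h0, hc, -⟩ := hf
  exact (hc 0 0 (Nat.zero_le _) (Nat.zero_le _)).congr fun p hp => (h0 p.1 p.2 hp).symm

lemma isClosed_lowerTriangle : IsClosed lowerTriangle :=
  (isClosed_le continuous_const continuous_snd).inter
    ((isClosed_le continuous_snd continuous_fst).inter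
      (isClosed_le continuous_fst continuous_const))

lemma isClosed_upperTriangle : IsClosed upperTriangle :=
  (isClosed_le continuous_const continuous_fst).inter
    ((isClosed_le continuous_fst continuous_snd).inter
      (isClosed_le continuous_snd continuous_const))

lemma GreenKernel.continuousOn_kernel {r : ℕ} (G : GreenKernel r) :
    ContinuousOn (fun p : ℝ × ℝ => G.kernel p.1 p.2) (Icc 0 1 ×ˢ Icc 0 1) := by
  have h1 : ContinuousOn (fun p : ℝ × ℝ => G.kernel p.1 p.2) lowerTriangle :=
    G.smooth₁.continuousOn.congr fun p hp => by
      simp [GreenKernel.kernel, hp.2.1]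
  have h2 : ContinuousOn (fun p : ℝ × ℝ => G.kernel p.1 p.2) upperTriangle :=
    G.smooth₂.continuousOn.congr fun p hp => by
      obtain ⟨a, b, c⟩ := hp
      rcases b.eq_or_lt with h | h
      · have := G.diag p.1 ⟨a, b.trans c⟩
        simp only [GreenKernel.kernel, ← h, le_refl, if_true, this]
      · simp [GreenKernel.kernel, not_le.2 h]
  refine (h1.union_of_isClosed h2 isClosed_lowerTriangle isClosed_upperTriangle).mono ?_
  rintro ⟨s, t⟩ ⟨⟨hs0, hs1⟩, ⟨ht0, ht1⟩⟩
  rcases le_total t s with h | h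
  · exact Or.inl ⟨ht0, h, hs1⟩
  · exact Or.inr ⟨hs0, h, ht1⟩

lemma LInf.integrable (x : LInf) :
    Integrable (x : ℝ → ℂ) ((volume : Measure ℝ).restrict (Icc (0 : ℝ) 1)) :=
  (Lp.memLp x).integrable le_top

lemma LInf.ae_norm_le (x : LInf) :
    ∀ᵐ t ∂((volume : Measure ℝ).restrict (Icc (0 : ℝ) 1)), ‖x t‖ ≤ ‖x‖ := by
  have := ae_le_eLpNormEssSup (f := (x : ℝ → ℂ))
    (μ := (volume : Measure ℝ).restrict (Icc (0 : ℝ) 1))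
  filter_upwards [this] with t ht
  have hfin : eLpNorm (x : ℝ → ℂ) ∞ ((volume : Measure ℝ).restrict (Icc (0 : ℝ) 1)) ≠ ∞ :=
    (Lp.memLp x).2.ne
  rw [Lp.norm_def]
  rw [← eLpNorm_exponent_top] at ht
  have := ENNReal.toReal_mono hfin ht
  simpa using this

lemma exists_kernel_bound {κ : ℝ → ℝ → ℝ}
    (hκ : ContinuousOn (fun p : ℝ × ℝ => κ p.1 p.2) (Icc 0 1 ×ˢ Icc 0 1)) :
    ∃ M : ℝ, 0 ≤ M ∧ ∀ s ∈ Icc (0 : ℝ) 1, ∀ t ∈ Icc (0 : ℝ) 1, |κ s t| ≤ M := by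
  obtain ⟨M, hM⟩ := (isCompact_Icc.prod isCompact_Icc).exists_bound_of_continuousOn hκ
  refine ⟨max M 0, le_max_right _ _, fun s hs t ht => ?_⟩
  exact (hM (s, t) ⟨hs, ht⟩).trans (le_max_left _ _)

lemma kernel_section_continuousOn {κ : ℝ → ℝ → ℝ}
    (hκ : ContinuousOn (fun p : ℝ × ℝ => κ p.1 p.2) (Icc 0 1 ×ˢ Icc 0 1)) {s : ℝ} (hs : s ∈ Icc (0 : ℝ) 1) :
    ContinuousOn (fun t => (κ s t : ℂ)) (Icc 0 1) :=
  Complex.continuous_ofReal.comp_continuousOn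
    (hκ.comp (f := fun t : ℝ => ((s, t) : ℝ × ℝ)) (by fun_prop) fun _ ht => ⟨hs, ht⟩)

lemma kernel_integrable {κ : ℝ → ℝ → ℝ}
    (hκ : ContinuousOn (fun p : ℝ × ℝ => κ p.1 p.2) (Icc 0 1 ×ˢ Icc 0 1)) (x : LInf) {s : ℝ} (hs : s ∈ Icc (0 : ℝ) 1) :
    Integrable (fun t => (κ s t : ℂ) * x t)
      ((volume : Measure ℝ).restrict (Icc (0 : ℝ) 1)) := by
  obtain ⟨M, -, hM⟩ := exists_kernel_bound hκ
  refine (LInf.integrable x).bdd_mul (c := M)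
    ((kernel_section_continuousOn hκ hs).aestronglyMeasurable measurableSet_Icc) ?_
  filter_upwards [ae_restrict_mem measurableSet_Icc] with t ht
  simpa using hM s hs t ht

lemma integral_continuousOn {κ : ℝ → ℝ → ℝ}
    (hκ : ContinuousOn (fun p : ℝ × ℝ => κ p.1 p.2) (Icc 0 1 ×ˢ Icc 0 1)) (x : LInf) :
    ContinuousOn (fun s => ∫ t in Icc (0 : ℝ) 1, (κ s t : ℂ) * x t) (Icc 0 1) := by
  obtain ⟨M, -, hM⟩ := exists_kernel_bound hκ
  refine continuousOn_of_dominated (bound := fun t => M * ‖x t‖)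
    (fun s hs => (kernel_integrable hκ x hs).aestronglyMeasurable) (fun s hs => ?_)
    ((LInf.integrable x).norm.const_mul M) ?_
  · filter_upwards [ae_restrict_mem measurableSet_Icc] with t ht
    rw [norm_mul]
    gcongr
    simpa using hM s hs t ht
  · filter_upwards [ae_restrict_mem measurableSet_Icc] with t ht
    refine ContinuousOn.mul ?_ continuousOn_const
    exact Complex.continuous_ofReal.comp_continuousOn
      (hκ.comp (f := fun s : ℝ => ((s, t) : ℝ × ℝ)) (by fun_prop) fun _ hs => ⟨hs, ht⟩)

lemma integral_memLp {κ : ℝ → ℝ → ℝ}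
    (hκ : ContinuousOn (fun p : ℝ × ℝ => κ p.1 p.2) (Icc 0 1 ×ˢ Icc 0 1)) (x : LInf) :
    MemLp (fun s => ∫ t in Icc (0 : ℝ) 1, (κ s t : ℂ) * x t) ∞
      ((volume : Measure ℝ).restrict (Icc (0 : ℝ) 1)) := by
  obtain ⟨B, hB⟩ := isCompact_Icc.exists_bound_of_continuousOn (integral_continuousOn hκ x)
  refine memLp_top_of_bound
    ((integral_continuousOn hκ x).aestronglyMeasurable measurableSet_Icc) B ?_
  filter_upwards [ae_restrict_mem measurableSet_Icc] with s hs using hB s hs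

/-- The integral operator `(K x)(s) = ∫₀¹ κ(s,t) x(t) dt` on `L^∞[0,1]`. -/
noncomputable def integralOp {κ : ℝ → ℝ → ℝ}
    (hκ : ContinuousOn (fun p : ℝ × ℝ => κ p.1 p.2) (Icc 0 1 ×ˢ Icc 0 1)) :
    LInf →L[ℂ] LInf :=
  LinearMap.mkContinuousOfExistsBound
    { toFun := fun x => (integral_memLp hκ x).toLp _
      map_add' := fun x y => by
        rw [← MemLp.toLp_add, MemLp.toLp_eq_toLp_iff]
        filter_upwards [ae_restrict_mem measurableSet_Icc] with s hs
        rw [Pi.add_apply, ← integral_add (kernel_integrable hκ x hs) (kernel_integrable hκ y hs)]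
        refine integral_congr_ae ?_
        filter_upwards [Lp.coeFn_add x y] with t ht
        rw [ht, Pi.add_apply, mul_add]
      map_smul' := fun a x => by
        rw [RingHom.id_apply, ← MemLp.toLp_const_smul, MemLp.toLp_eq_toLp_iff]
        filter_upwards with s
        rw [Pi.smul_apply, smul_eq_mul, ← integral_const_mul]
        refine integral_congr_ae ?_
        filter_upwards [Lp.coeFn_smul a x] with t ht
        rw [ht, Pi.smul_apply, smul_eq_mul]
        ring }
    (by
      obtain ⟨M, hM0, hM⟩ := exists_kernel_bound hκ
      refine ⟨M, fun x => ?_⟩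
      refine Lp.norm_le_of_ae_bound (C := M * ‖x‖) (by positivity) ?_ |>.trans (by simp)
      filter_upwards [(integral_memLp hκ x).coeFn_toLp, ae_restrict_mem measurableSet_Icc]
        with s h1 hs
      refine (congrArg norm h1).trans_le ?_
      refine (norm_integral_le_of_norm_le_const (C := M * ‖x‖) ?_).trans (by simp)
      filter_upwards [LInf.ae_norm_le x, ae_restrict_mem measurableSet_Icc] with t ht ht'
      rw [norm_mul]
      have : ‖(κ s t : ℂ)‖ ≤ M := by simpa using hM s hs t ht'
      gcongr)

/-- The integral operator `K` of a Green's kernel. -/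
noncomputable def GreenKernel.op {r : ℕ} (G : GreenKernel r) : LInf →L[ℂ] LInf :=
  integralOp G.continuousOn_kernel

/-- The `i`-th (`0 ≤ i ≤ 2r`) of the `2r+1` equally spaced nodes in `[j/n, (j+1)/n]`;
the midpoint if `r = 0`. -/
noncomputable def node (r n j i : ℕ) : ℝ :=
  if r = 0 then ((j : ℝ) + 1 / 2) / n else ((j : ℝ) + (i : ℝ) / (2 * r)) / n

/-- The Lagrange basis polynomial of the `i`-th node in `(j/n, (j+1)/n]`, extended by zero. -/
noncomputable def basisFun (r n j i : ℕ) (t : ℝ) : ℂ :=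
  (Ioc ((j : ℝ) / n) (((j : ℝ) + 1) / n)).indicator
    (fun t => (((Lagrange.basis (Finset.range (2 * r + 1)) (node r n j) i).eval t : ℝ) : ℂ)) t

lemma basisFun_memLp (r n j i : ℕ) :
    MemLp (basisFun r n j i) ∞ ((volume : Measure ℝ).restrict (Icc (0 : ℝ) 1)) := by
  have hc : Continuous fun t : ℝ =>
      (((Lagrange.basis (Finset.range (2 * r + 1)) (node r n j) i).eval t : ℝ) : ℂ) :=
    Complex.continuous_ofReal.comp (Polynomial.continuous _)
  obtain ⟨B, hB⟩ := (isCompact_Icc (a := (0 : ℝ)) (b := 1)).exists_bound_of_continuousOn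
    hc.continuousOn
  refine memLp_top_of_bound
    (hc.aestronglyMeasurable.indicator measurableSet_Ioc) B ?_
  filter_upwards [ae_restrict_mem measurableSet_Icc] with t ht
  exact (norm_indicator_le_norm_self _ _).trans (hB t ht)

/-- `ℓ` is a norm-preserving (Hahn-Banach) extension to `L^∞[0,1]` of the functional `x ↦ x(τ)`
on `C[0,1]`. -/
def ExtendsEvaluation (τ : ℝ) (ℓ : LInf →L[ℂ] ℂ) : Prop :=
  ‖ℓ‖ ≤ 1 ∧
  ∀ (x : LInf) (f : ℝ → ℂ), ContinuousOn f (Icc 0 1) →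
    (x : ℝ → ℂ) =ᵐ[(volume : Measure ℝ).restrict (Icc (0 : ℝ) 1)] f → ℓ x = f τ

/-- The interpolatory operator `Q_n` on `L^∞[0,1]`: on each subinterval `Q_n x` is the polynomial
of degree at most `2r` whose value at the `i`-th node is `ev j i x`, which is the value of `x`
there if `x` is continuous. -/
noncomputable def interpOp (r n : ℕ) (ev : Fin n → Fin (2 * r + 1) → LInf →L[ℂ] ℂ) :
    LInf →L[ℂ] LInf :=
  ∑ j : Fin n, ∑ i : Fin (2 * r + 1),
    (ev j i).smulRight ((basisFun_memLp r n j i).toLp (basisFun r n j i))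

/-- The modified operator `K_n^M = Q K + K Q - Q K Q`. -/
noncomputable def modifiedOp (K Q : LInf →L[ℂ] LInf) : LInf →L[ℂ] LInf :=
  Q ∘L K + K ∘L Q - Q ∘L K ∘L Q

/-- The circle `|z - c| = R` lies in the resolvent set of `T`, and `lam`, a point of the spectrum,
is the only one that it encloses. -/
def Isolates (T : LInf →L[ℂ] LInf) (lam c : ℂ) (R : ℝ) : Prop :=
  lam ∈ Metric.ball c R ∧ spectrum ℂ T ∩ Metric.closedBall c R = {lam}

/-- The spectral projection `(2πi)⁻¹ ∮ (z - T)⁻¹ dz = -(2πi)⁻¹ ∮ (T - z)⁻¹ dz` over the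
positively oriented circle `|z - c| = R`. -/
noncomputable def spectralProj (T : LInf →L[ℂ] LInf) (c : ℂ) (R : ℝ) : LInf →L[ℂ] LInf :=
  (2 * (Real.pi : ℂ) * Complex.I)⁻¹ • ∮ z in C(c, R), resolvent T z

/-! Write `K` for the integral operator, `Q` for the interpolation operator and `D = K - K_n^M`.
Everything rests on the factorization `D = (I - Q) K (I - Q)` (`sub_modifiedOp_apply`).

Spectral side. `K` maps bounded functions to Lipschitz ones, so `‖D‖ = O(h)`
(`norm_sub_modifiedOp_le`), and for large `n` the Riesz projections over the circle are close and
have the same rank. If `φ` is a unit eigenvector of `K - D` for `μ`, its defect `y = φ - E φ`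
satisfies `y = S ((λ - μ) y - (I - E) D φ)` with the reduced resolvent `S`. The term with `y` is
absorbed because `λ - μ = O(‖D‖)`, and since `E φ` is a multiple of a fixed exact eigenvector `u`,
this gives `y = O(‖D u‖)`. Applying `K` to the same equation, and using `(λ - μ) E φ = E D φ = λ⁻¹ E
K D φ`, bounds both the iterated defect and the eigenvalue error by `‖K D u‖ + ‖D‖ ‖D u‖`
(`eigenvector_perturbation`, `simple_eigenvalue_perturbation`). Only `D u` and `K D u` remain to be
estimated.

Approximation side. Bootstrapping the eigenvalue equation makes `u` of class `C^(2r+2)`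
(`contDiffOn_of_green_eigen`), so on each cell `u - Q u` is a constant times the nodal polynomial up
to `O(h^(2r+2))` (`exists_interp_error`). The nodal polynomial is odd about the midpoint of the
cell, so integration against a smooth kernel gains a power of `h`; only the one cell where the
kernel has its kink needs separate care. Hence `K (u - Q u)` oscillates by `O(h^(2r+3))` on a cell
(`osc_integral_nearNodal`), and `D u = O(h^(2r+3))`. For `r ≥ 1` this suffices, with `‖K D u‖ ≤ ‖K‖
‖D u‖`. For `r = 0` one more order is needed in `K D u`: second differences of `K (u - Q u)` about a
midpoint are `O(h^4)` (`second_difference_integral_nearNodal`), and symmetrizing the outer integral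
turns this into `K D u = O(h^4)` (`norm_integral_mul_sub_midpoint_le`). -/

/-! ### Riesz projections and Cauchy transforms of the resolvent in a Banach algebra -/

section Riesz

variable {A : Type*} [NormedRing A] [NormedAlgebra ℂ A]

lemma ContinuousLinearMap.map_circleIntegral {E F : Type*} [NormedAddCommGroup E]
    [NormedSpace ℂ E] [CompleteSpace E] [NormedAddCommGroup F] [NormedSpace ℂ F] [CompleteSpace F]
    (L : E →L[ℂ] F) {f : ℂ → E} {c : ℂ} {R : ℝ} (hf : CircleIntegrable f c R) :
    L (∮ z in C(c, R), f z) = ∮ z in C(c, R), L (f z) := by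
  simp only [circleIntegral]
  rw [← L.intervalIntegral_comp_comm hf.out]
  simp

/-- The Riesz projection of `a` for the circle `|z - c| = R`. -/
noncomputable def rieszProj (a : A) (c : ℂ) (R : ℝ) : A :=
  (2 * (Real.pi : ℂ) * Complex.I)⁻¹ • ∮ z in C(c, R), resolvent a z

/-- The Cauchy transform of the resolvent of `a` over the circle `|z - c| = R`. -/
noncomputable def resolventCauchy (a : A) (c : ℂ) (R : ℝ) (w : ℂ) : A :=
  (2 * (Real.pi : ℂ) * Complex.I)⁻¹ • ∮ z in C(c, R), (z - w)⁻¹ • resolvent a z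

lemma continuousOn_resolvent [CompleteSpace A] (a : A) : ContinuousOn (resolvent a) (resolventSet ℂ a) :=
  fun _ hz => (spectrum.hasDerivAt_resolvent_const_left hz).continuousAt.continuousWithinAt

lemma sub_mul_resolvent {a : A} {z : ℂ} (hz : z ∈ resolventSet ℂ a) :
    (algebraMap ℂ A z - a) * resolvent a z = 1 := by
  rw [resolvent]
  exact Ring.mul_inverse_cancel _ hz

lemma resolvent_mul_sub {a : A} {z : ℂ} (hz : z ∈ resolventSet ℂ a) :
    resolvent a z * (algebraMap ℂ A z - a) = 1 := by
  rw [resolvent]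
  exact Ring.inverse_mul_cancel _ hz

lemma Commute.resolvent_right {a b : A} (h : Commute b a) {z : ℂ} (hz : z ∈ resolventSet ℂ a) :
    Commute b (resolvent a z) := by
  have h1 : Commute b (algebraMap ℂ A z - a) := (Algebra.commute_algebraMap_right z b).sub_right h
  calc b * resolvent a z
      = resolvent a z * (algebraMap ℂ A z - a) * (b * resolvent a z) := by
        rw [resolvent_mul_sub hz, one_mul]
    _ = resolvent a z * (b * (algebraMap ℂ A z - a)) * resolvent a z := by
        rw [h1.eq]; simp only [mul_assoc]
    _ = resolvent a z * b := by
        rw [mul_assoc, mul_assoc, sub_mul_resolvent hz, mul_one]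

variable [CompleteSpace A] {a b : A} {c : ℂ} {R : ℝ}

lemma circleIntegrable_resolvent (hR : 0 ≤ R) (hΓ : Metric.sphere c R ⊆ resolventSet ℂ a) :
    CircleIntegrable (resolvent a) c R :=
  ((continuousOn_resolvent a).mono hΓ).circleIntegrable hR

lemma circleIntegrable_cauchy_resolvent (hΓ : Metric.sphere c R ⊆ resolventSet ℂ a) {w : ℂ}
    (hw : w ∈ Metric.ball c R) :
    CircleIntegrable (fun z => (z - w)⁻¹ • resolvent a z) c R := by
  have hR : 0 < R := dist_nonneg.trans_lt hw
  refine ContinuousOn.circleIntegrable hR.le (ContinuousOn.smul (ContinuousOn.inv₀ (by fun_prop) ?_)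
    ((continuousOn_resolvent a).mono hΓ))
  rintro z hz h0
  rw [sub_eq_zero] at h0
  rw [Metric.mem_sphere] at hz
  rw [Metric.mem_ball] at hw
  exact absurd hz (h0 ▸ hw.ne)

lemma commute_circleIntegral {f : ℂ → A} (hR : 0 ≤ R) (hf : CircleIntegrable f c R)
    (h : ∀ z ∈ Metric.sphere c R, Commute b (f z)) : Commute b (∮ z in C(c, R), f z) := by
  have h1 := (ContinuousLinearMap.mul ℂ A b).map_circleIntegral hf
  have h2 := ((ContinuousLinearMap.mul ℂ A).flip b).map_circleIntegral hf
  simp only [ContinuousLinearMap.mul_apply', ContinuousLinearMap.flip_apply] at h1 h2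
  rw [Commute, SemiconjBy, h1, h2]
  exact circleIntegral.integral_congr hR fun z hz => (h z hz).eq

lemma Commute.rieszProj_right (hR : 0 ≤ R) (hΓ : Metric.sphere c R ⊆ resolventSet ℂ a)
    (h : Commute b a) : Commute b (rieszProj a c R) :=
  (commute_circleIntegral hR (circleIntegrable_resolvent hR hΓ)
    fun _ hz => h.resolvent_right (hΓ hz)).smul_right _

lemma Commute.resolventCauchy_right (hΓ : Metric.sphere c R ⊆ resolventSet ℂ a) {w : ℂ}
    (hw : w ∈ Metric.ball c R) (h : Commute b a) : Commute b (resolventCauchy a c R w) :=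
  (commute_circleIntegral (dist_nonneg.trans_lt hw).le (circleIntegrable_cauchy_resolvent hΓ hw)
    fun _ hz => (h.resolvent_right (hΓ hz)).smul_right _).smul_right _

lemma two_pi_I_inv_mul_integral {w : ℂ} (hw : w ∈ Metric.ball c R) :
    (2 * (Real.pi : ℂ) * Complex.I)⁻¹ • (∮ z in C(c, R), (z - w)⁻¹) = 1 := by
  rw [circleIntegral.integral_sub_inv_of_mem_ball hw, smul_eq_mul]
  exact inv_mul_cancel₀ Complex.two_pi_I_ne_zero

/-- Since `w - a = (z - a) - (z - w)`, the integrand becomes `(z - w)⁻¹ - resolvent a z`; the first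
term integrates to `1`, the second to the Riesz projection. At an isolated eigenvalue `w` the Cauchy
transform thus acts as the reduced resolvent. -/
lemma sub_mul_resolventCauchy (hΓ : Metric.sphere c R ⊆ resolventSet ℂ a) {w : ℂ}
    (hw : w ∈ Metric.ball c R) :
    (algebraMap ℂ A w - a) * resolventCauchy a c R w = 1 - rieszProj a c R := by
  have hR : 0 < R := dist_nonneg.trans_lt hw
  have h1 := (ContinuousLinearMap.mul ℂ A (algebraMap ℂ A w - a)).map_circleIntegral
    (circleIntegrable_cauchy_resolvent hΓ hw)
  simp only [ContinuousLinearMap.mul_apply'] at h1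
  have hne : ∀ z ∈ Metric.sphere c R, z - w ≠ 0 := fun z hz h0 => by
    rw [sub_eq_zero] at h0
    rw [Metric.mem_sphere] at hz
    rw [Metric.mem_ball] at hw
    exact absurd hz (h0 ▸ hw.ne)
  have h2 : ∀ z ∈ Metric.sphere c R,
      (algebraMap ℂ A w - a) * ((z - w)⁻¹ • resolvent a z)
        = (z - w)⁻¹ • (1 : A) - resolvent a z := by
    intro z hz
    have h3 : (algebraMap ℂ A w - a) * resolvent a z = 1 - (z - w) • resolvent a z := by
      have : algebraMap ℂ A w - a = (algebraMap ℂ A z - a) - algebraMap ℂ A (z - w) := by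
        rw [map_sub]; abel
      rw [this, sub_mul, sub_mul_resolvent (hΓ hz), Algebra.smul_def]
    rw [mul_smul_comm, h3, smul_sub, smul_smul, inv_mul_cancel₀ (hne z hz), one_smul]
  rw [resolventCauchy, mul_smul_comm, h1, circleIntegral.integral_congr hR.le h2,
    circleIntegral.integral_sub, smul_sub, circleIntegral.integral_smul_const, ← smul_assoc,
    two_pi_I_inv_mul_integral hw, one_smul, rieszProj]
  · refine ContinuousOn.circleIntegrable hR.le (ContinuousOn.smul
      (ContinuousOn.inv₀ (by fun_prop) hne) continuousOn_const)
  · exact circleIntegrable_resolvent hR.le hΓ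

lemma resolventCauchy_mul_sub (hΓ : Metric.sphere c R ⊆ resolventSet ℂ a) {w : ℂ}
    (hw : w ∈ Metric.ball c R) :
    resolventCauchy a c R w * (algebraMap ℂ A w - a) = 1 - rieszProj a c R := by
  rw [← sub_mul_resolventCauchy hΓ hw]
  refine (Commute.resolventCauchy_right hΓ hw ?_).eq.symm
  exact (Algebra.commute_algebraMap_left w a).sub_left (Commute.refl a)

/-- The spectrum inside the circle is compact, so the circle can be shrunk to radius `r` without
changing `P`. On the smaller circle `P * resolvent a z = resolvent a z - resolventCauchy a c R z`,
and the last term is holomorphic in the large disc, so integrating it over the small circle gives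
zero. -/
lemma rieszProj_idem (hR : 0 < R) (hΓ : Metric.sphere c R ⊆ resolventSet ℂ a) :
    rieszProj a c R * rieszProj a c R = rieszProj a c R := by
  obtain ⟨r, ⟨hr0, hrR⟩, hr⟩ : ∃ r ∈ Ioo 0 R, spectrum ℂ a ∩ Metric.closedBall c R ⊆
      Metric.ball c r := by
    refine exists_pos_lt_subset_ball hR
      ((spectrum.isClosed a).inter Metric.isClosed_closedBall) fun z ⟨hz, hz'⟩ => ?_
    rcases (Metric.mem_closedBall.1 hz').lt_or_eq with h | h
    · exact h
    · exact absurd (hΓ h) hz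
  have hres : ∀ z ∈ Metric.closedBall c R \ Metric.ball c r, z ∈ resolventSet ℂ a :=
    fun z hz => by_contra fun h => hz.2 (hr ⟨h, hz.1⟩)
  have hsph : Metric.sphere c r ⊆ Metric.closedBall c R \ Metric.ball c r := fun z hz => by
    rw [Metric.mem_sphere] at hz
    simp [hz, hrR.le]
  have hin : rieszProj a c R = rieszProj a c r := by
    rw [rieszProj, rieszProj,
      Complex.circleIntegral_eq_of_differentiable_on_annulus_off_countable hr0 hrR.le
        countable_empty ((continuousOn_resolvent a).mono hres) fun z hz => ?_]
    refine (spectrum.hasDerivAt_resolvent_const_left (hres z ⟨?_, ?_⟩)).differentiableAt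
    · exact Metric.ball_subset_closedBall hz.1.1
    · exact fun h => hz.1.2 (Metric.ball_subset_closedBall h)
  have hΓr : Metric.sphere c r ⊆ resolventSet ℂ a := fun z hz => hres z (hsph hz)
  have hS : ∀ z ∈ Metric.sphere c r,
      rieszProj a c R * resolvent a z = resolvent a z - resolventCauchy a c R z := by
    intro z hz
    have hzR : z ∈ Metric.ball c R := by
      rw [Metric.mem_sphere] at hz; rw [Metric.mem_ball, hz]; exact hrR
    have := congrArg (· * resolvent a z) (resolventCauchy_mul_sub hΓ hzR)
    simp only [mul_assoc, sub_mul_resolvent (hΓr hz), mul_one, sub_mul, one_mul] at this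
    rw [this]; abel
  have hps := hasFPowerSeriesOn_cauchy_integral (R := ⟨R, hR.le⟩)
    (circleIntegrable_resolvent hR.le hΓ) hR
  have hdiff : DifferentiableOn ℂ (resolventCauchy a c R) (Metric.ball c R) := by
    have := hps.differentiableOn
    erw [Metric.eball_coe] at this
    exact this
  have hsub : Metric.closedBall c r ⊆ Metric.ball c R := Metric.closedBall_subset_ball hrR
  have hcont : ContinuousOn (resolventCauchy a c R) (Metric.closedBall c r) :=
    hdiff.continuousOn.mono hsub
  have hzero : (∮ z in C(c, r), resolventCauchy a c R z) = 0 :=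
    Complex.circleIntegral_eq_zero_of_differentiable_on_off_countable hr0.le countable_empty
      hcont fun z hz => (hdiff z (hsub (Metric.ball_subset_closedBall hz.1))).differentiableAt
        (Metric.isOpen_ball.mem_nhds (hsub (Metric.ball_subset_closedBall hz.1)))
  have h1 := (ContinuousLinearMap.mul ℂ A (rieszProj a c R)).map_circleIntegral
    (circleIntegrable_resolvent hr0.le hΓr)
  simp only [ContinuousLinearMap.mul_apply'] at h1
  calc rieszProj a c R * rieszProj a c R = rieszProj a c R * rieszProj a c r := by rw [← hin]
    _ = rieszProj a c r := by
      rw [rieszProj.eq_1 a c r, mul_smul_comm, h1, circleIntegral.integral_congr hr0.le hS,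
        circleIntegral.integral_sub (circleIntegrable_resolvent hr0.le hΓr)
          ((hcont.mono Metric.sphere_subset_closedBall).circleIntegrable hr0.le), hzero, sub_zero]
    _ = rieszProj a c R := hin.symm

/-- Quantitative stability of the resolvent and of the Riesz projection. -/
lemma rieszProj_stability (hR : 0 < R) (hΓ : Metric.sphere c R ⊆ resolventSet ℂ a) :
    ∃ δ > 0, ∃ M : ℝ, 0 ≤ M ∧ ∀ b : A, ‖a - b‖ ≤ δ → Metric.sphere c R ⊆ resolventSet ℂ b ∧
      ‖rieszProj b c R - rieszProj a c R‖ ≤ M * ‖a - b‖ := by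
  obtain ⟨M₀, hM₀⟩ := (isCompact_sphere c R).exists_bound_of_continuousOn
    ((continuousOn_resolvent a).mono hΓ)
  set M := max M₀ 1
  have hM1 : 1 ≤ M := le_max_right _ _
  have hM : ∀ z ∈ Metric.sphere c R, ‖resolvent a z‖ ≤ M :=
    fun z hz => (hM₀ z hz).trans (le_max_left _ _)
  have hMpos : 0 < M := by linarith
  -- With this `δ` the resolvent identity gives `‖resolvent b z‖ ≤ M + ‖resolvent b z‖ / 2`, hence
  -- the bound `2 * M`; the factor `R` is the length of the circle divided by `2π`.
  refine ⟨1 / (2 * M), by positivity, R * (2 * M * M), by positivity, fun b hb => ?_⟩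
  -- The Neumann series argument divides by the norm of a unit, which vanishes in the zero ring.
  rcases subsingleton_or_nontrivial A with hA | hA
  · refine ⟨?_, ?_⟩
    · rw [spectrum.resolventSet_of_subsingleton]; exact subset_univ _
    · rw [Subsingleton.elim (rieszProj b c R - rieszProj a c R) 0, norm_zero]; positivity
  have hΓb : Metric.sphere c R ⊆ resolventSet ℂ b := by
    intro z hz
    have hu : IsUnit (algebraMap ℂ A z - a) := hΓ hz
    obtain ⟨u, hu⟩ := hu
    have hinv : ((u⁻¹ : Aˣ) : A) = resolvent a z := by
      rw [resolvent, ← hu, Ring.inverse_unit]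
    have hpos : 0 < ‖((u⁻¹ : Aˣ) : A)‖ := norm_pos_iff.2 u⁻¹.ne_zero
    have : ‖(algebraMap ℂ A z - b) - (u : A)‖ < ‖((u⁻¹ : Aˣ) : A)‖⁻¹ := by
      rw [hu, sub_sub_sub_cancel_left]
      refine hb.trans_lt ?_
      rw [hinv] at hpos ⊢
      calc 1 / (2 * M) < 1 / M := by
            apply one_div_lt_one_div_of_lt hMpos; linarith
        _ = M⁻¹ := one_div M
        _ ≤ _ := inv_anti₀ hpos (hM z hz)
    exact ⟨u.ofNearby _ this, rfl⟩
  refine ⟨hΓb, ?_⟩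
  have hd : ∀ z ∈ Metric.sphere c R,
      resolvent b z - resolvent a z = resolvent b z * (b - a) * resolvent a z := by
    intro z hz
    calc resolvent b z - resolvent a z
        = resolvent b z * ((algebraMap ℂ A z - a) * resolvent a z)
          - resolvent b z * (algebraMap ℂ A z - b) * resolvent a z := by
          rw [sub_mul_resolvent (hΓ hz), resolvent_mul_sub (hΓb hz), mul_one, one_mul]
      _ = _ := by noncomm_ring
  have hbound : ∀ z ∈ Metric.sphere c R, ‖resolvent b z‖ ≤ 2 * M := by
    intro z hz
    have h1 : ‖resolvent b z‖ ≤ ‖resolvent a z‖ + ‖resolvent b z * (b - a) * resolvent a z‖ := by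
      rw [← hd z hz]
      exact norm_le_norm_add_norm_sub' _ _ 
    have h2 : ‖resolvent b z * (b - a) * resolvent a z‖ ≤ ‖resolvent b z‖ * (1 / (2 * M)) * M := by
      refine (norm_mul_le _ _).trans ?_
      have h3 := (norm_mul_le (resolvent b z) (b - a))
      rw [norm_sub_rev b a] at h3
      have h4 : ‖resolvent b z * (b - a)‖ ≤ ‖resolvent b z‖ * (1 / (2 * M)) := h3.trans (by gcongr)
      have := hM z hz
      gcongr
    have h3 : ‖resolvent b z‖ * (1 / (2 * M)) * M = ‖resolvent b z‖ / 2 := by field_simp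
    linarith [hM z hz]
  rw [rieszProj, rieszProj, ← smul_sub, ← circleIntegral.integral_sub
    (circleIntegrable_resolvent hR.le hΓb) (circleIntegrable_resolvent hR.le hΓ)]
  refine (circleIntegral.norm_two_pi_i_inv_smul_integral_le_of_norm_le_const hR.le
    (C := 2 * M * M * ‖a - b‖) fun z hz => ?_).trans_eq (by ring)
  rw [hd z hz]
  refine (norm_mul_le _ _).trans ?_
  have h3 := (norm_mul_le (resolvent b z) (b - a))
  rw [norm_sub_rev b a] at h3
  calc _ ≤ (2 * M * ‖a - b‖) * M := by
        refine mul_le_mul (h3.trans ?_) (hM z hz) (norm_nonneg _) (by positivity)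
        have := hbound z hz
        gcongr
    _ = _ := by ring

end Riesz

/-! ### Perturbation of a simple eigenvalue -/

section SpectralPerturbation

variable {X : Type*} [NormedAddCommGroup X] [NormedSpace ℂ X]
  {T : X →L[ℂ] X} {c : ℂ} {R : ℝ}

lemma mem_spectrum_of_eigenvector {μ : ℂ} {u : X} (hu : u ≠ 0) (h : T u = μ • u) :
    μ ∈ spectrum ℂ T := by
  intro hunit
  have h1 := DFunLike.congr_fun (resolvent_mul_sub (a := T) (z := μ) hunit) u
  simp [Algebra.algebraMap_eq_smul_one, h] at h1
  exact hu h1.symm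

/-- The coefficient `σ * l` of `x` on the right is at most `2 * σ * (1 + p) * d ≤ 1 / 2`, so that
term moves to the left at the cost of a factor `2`. -/
lemma absorb {x z σ p d l : ℝ} (hx : 0 ≤ x) (hσ : 0 ≤ σ) (hd : 0 ≤ d)
    (hl : l ≤ 2 * (p * d)) (h : x ≤ σ * (l * x + (1 + p) * z))
    (hsmall : 2 * σ * (1 + p) * d ≤ 1 / 2) : x ≤ 2 * σ * (1 + p) * z := by
  have h1 : σ * (l * x) ≤ σ * (2 * (p * d) * x) := by gcongr
  have h2 : 2 * σ * p * d * x ≤ 2 * σ * (1 + p) * d * x := by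
    gcongr; linarith
  have h3 : 2 * σ * (1 + p) * d * x ≤ 1 / 2 * x := by gcongr
  linarith

/-- Error estimates for an eigenvector of `T - D` that is close to the range of the spectral
projection `P` of `T` for the simple eigenvalue `lam`, `S` being the reduced resolvent. -/
lemma eigenvector_perturbation {T D P S : X →L[ℂ] X} {lam μ : ℂ} {u φ : X} (hlam : lam ≠ 0)
    (hu0 : u ≠ 0) (hPP : ∀ x, P (P x) = P x) (hPT : ∀ x, P (T x) = T (P x))
    (hST : ∀ x, S (T x) = T (S x)) (hSP : ∀ x, S (P x) = P (S x))
    (hTP : ∀ x, T (P x) = lam • P x) (hSl : ∀ x, S (lam • x - T x) = x - P x)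
    (hP : ∀ x, ∃ α : ℂ, P x = α • u) (hTφ : T φ = μ • φ + D φ) (hφ1 : ‖φ‖ = 1)
    (hφP : ‖φ - P φ‖ ≤ 1 / 2) (hsmall : 2 * ‖S‖ * (1 + ‖P‖) * ‖D‖ ≤ 1 / 2) :
    ‖φ - P φ‖ ≤ 4 * ‖S‖ * (1 + ‖P‖) * (‖P‖ / ‖u‖) * ‖D u‖ ∧
    ‖T (φ - P φ)‖ ≤ 2 * ‖S‖ * (1 + ‖P‖) * ‖T (D φ)‖ ∧
    ‖T (D φ)‖ ≤ ‖P‖ / ‖u‖ * ‖T (D u)‖ +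
      ‖T‖ * (4 * ‖S‖ * (1 + ‖P‖) * (‖P‖ / ‖u‖)) * (‖D‖ * ‖D u‖) ∧
    ‖lam - μ‖ ≤ 2 * (‖P‖ * ‖D‖) ∧ ‖lam - μ‖ ≤ 2 * (‖lam‖⁻¹ * (‖P‖ * ‖T (D φ)‖)) := by
  have hPφ : 1 / 2 ≤ ‖P φ‖ := by
    have := norm_le_norm_add_norm_sub' φ (P φ)
    linarith
  have hPφ' : ‖P φ‖ ≤ ‖P‖ := by simpa [hφ1] using P.le_opNorm φ
  have hev : (lam - μ) • P φ = P (D φ) := by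
    have := congrArg P hTφ
    rw [hPT, hTP, map_add, map_smul] at this
    rw [sub_smul, this]; abel
  -- On the range of `P` the operator `T` acts as `lam`, so a factor `T` can be inserted in front of
  -- `D φ`; this is the source of the higher order of the eigenvalue error.
  have hev2 : (lam - μ) • P φ = lam⁻¹ • P (T (D φ)) := by
    rw [hPT, hTP, inv_smul_smul₀ hlam, hev]
  have hev_bound : ∀ b, ‖(lam - μ) • P φ‖ ≤ b → ‖lam - μ‖ ≤ 2 * b := fun b hb => by
    rw [norm_smul] at hb
    have := mul_le_mul_of_nonneg_left hPφ (norm_nonneg (lam - μ))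
    linarith
  have hDφ : ‖D φ‖ ≤ ‖D‖ := by simpa [hφ1] using D.le_opNorm φ
  have hcr : ‖lam - μ‖ ≤ 2 * (‖P‖ * ‖D‖) := hev_bound _ <| by
    rw [hev]; exact (P.le_opNorm _).trans (by gcongr)
  obtain ⟨y, hy⟩ : ∃ y, y = φ - P φ := ⟨_, rfl⟩
  rw [← hy]
  have hyP : y - P y = y := by rw [hy, map_sub, hPP]; simp
  have hyS : y = S ((lam - μ) • φ - D φ) := by
    rw [hy, ← hSl φ, hTφ, sub_smul]
    congr 1; abel
  -- Applying `I - P`, which commutes with `S`, replaces `φ` by the small vector `y` in the term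
  -- with `lam - μ`.
  have hyS2 : y = S ((lam - μ) • y - (D φ - P (D φ))) := by
    have h3 : y - P y = S (((lam - μ) • φ - D φ) - P ((lam - μ) • φ - D φ)) := by
      rw [map_sub S, hSP, ← hyS]
    rw [hyP] at h3
    refine h3.trans (congrArg S ?_)
    rw [hy, smul_sub, map_sub, map_smul]
    abel
  have hTyS : T y = S ((lam - μ) • T y - (T (D φ) - P (T (D φ)))) := by
    refine (congrArg T hyS2).trans ?_
    rw [← hST, map_sub T, map_sub T, map_smul T, hPT]
  have hone : ∀ x, ‖x - P x‖ ≤ (1 + ‖P‖) * ‖x‖ := fun x =>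
    (norm_sub_le _ _).trans (by linarith [P.le_opNorm x])
  have habs : ∀ x z, x = S ((lam - μ) • x - (z - P z)) →
      ‖x‖ ≤ 2 * ‖S‖ * (1 + ‖P‖) * ‖z‖ := by
    intro x z hxz
    refine absorb (norm_nonneg _) (norm_nonneg _) (norm_nonneg D) hcr ?_ hsmall
    refine (congrArg norm hxz).trans_le ((S.le_opNorm _).trans ?_)
    refine mul_le_mul_of_nonneg_left ?_ (norm_nonneg _)
    exact (norm_sub_le _ _).trans (add_le_add (norm_smul_le _ _) (hone z))
  have hyb := habs y (D φ) hyS2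
  have hTyb := habs (T y) (T (D φ)) hTyS
  obtain ⟨α, hα⟩ := hP φ
  have hαq : ‖α‖ ≤ ‖P‖ / ‖u‖ := by
    rw [hα, norm_smul] at hPφ'
    rwa [le_div_iff₀ (norm_pos_iff.2 hu0)]
  -- `D` is only small of first order on general vectors; splitting `φ = α • u + y` puts the main
  -- part on the exact eigenvector.
  have hsplit : D φ = α • D u + D y := by
    rw [hy, hα, map_sub, map_smul]; abel
  have hDy : ‖D φ‖ ≤ ‖P‖ / ‖u‖ * ‖D u‖ + ‖D‖ * ‖y‖ := by
    rw [hsplit]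
    refine (norm_add_le _ _).trans (add_le_add ?_ (D.le_opNorm y))
    rw [norm_smul]; gcongr
  have hyfin : ‖y‖ ≤ 4 * ‖S‖ * (1 + ‖P‖) * (‖P‖ / ‖u‖) * ‖D u‖ := by
    have h3 : 2 * ‖S‖ * (1 + ‖P‖) * ‖D φ‖ ≤
        2 * ‖S‖ * (1 + ‖P‖) * (‖P‖ / ‖u‖ * ‖D u‖ + ‖D‖ * ‖y‖) := by gcongr
    have h4 : 2 * ‖S‖ * (1 + ‖P‖) * ‖D‖ * ‖y‖ ≤ 1 / 2 * ‖y‖ := by gcongr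
    linarith
  refine ⟨hyfin, hTyb, ?_, hcr, hev_bound _ ?_⟩
  · rw [hsplit, map_add, map_smul]
    refine (norm_add_le _ _).trans (add_le_add ?_ ?_)
    · rw [norm_smul]; gcongr
    · calc ‖T (D y)‖ ≤ ‖T‖ * (‖D‖ * (4 * ‖S‖ * (1 + ‖P‖) * (‖P‖ / ‖u‖) * ‖D u‖)) := by
            refine (T.le_opNorm _).trans ?_
            gcongr
            exact (D.le_opNorm y).trans (by gcongr)
        _ = _ := by ring
  · rw [hev2, norm_smul, norm_inv]
    gcongr
    exact P.le_opNorm _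

variable [CompleteSpace X]

lemma rieszProj_apply_of_mem_range (hR : 0 < R) (hΓ : Metric.sphere c R ⊆ resolventSet ℂ T)
    {x : X} (hx : x ∈ (rieszProj T c R).range) : rieszProj T c R x = x := by
  obtain ⟨y, rfl⟩ := hx
  exact DFunLike.congr_fun (rieszProj_idem hR hΓ) y

lemma rieszProj_comm_apply (hR : 0 < R) (hΓ : Metric.sphere c R ⊆ resolventSet ℂ T) (x : X) :
    rieszProj T c R (T x) = T (rieszProj T c R x) :=
  (DFunLike.congr_fun (Commute.rieszProj_right hR.le hΓ (Commute.refl T)).eq x).symm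

/-- If the Riesz projection has rank one, the circle encloses exactly one spectral value, whose
eigenspace is the range of the projection. -/
lemma spectrum_of_finrank_rieszProj (hR : 0 < R) (hΓ : Metric.sphere c R ⊆ resolventSet ℂ T)
    (h1 : Module.finrank ℂ (rieszProj T c R).range = 1) :
    ∃ μ ∈ Metric.ball c R, spectrum ℂ T ∩ Metric.closedBall c R = {μ} ∧
      (rieszProj T c R).range = Module.End.eigenspace (T : X →ₗ[ℂ] X) μ ∧
      ∃ u : X, u ≠ 0 ∧ T u = μ • u ∧ rieszProj T c R u = u ∧
        ∀ x, ∃ α : ℂ, rieszProj T c R x = α • u := by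
  obtain ⟨⟨u, hu⟩, hu0, hspan⟩ := finrank_eq_one_iff'.1 h1
  replace hu0 : u ≠ 0 := fun h => hu0 (Subtype.ext h)
  have hP : ∀ x, ∃ α : ℂ, rieszProj T c R x = α • u := fun x => by
    obtain ⟨α, hα⟩ := hspan ⟨rieszProj T c R x, ⟨x, rfl⟩⟩
    exact ⟨α, (congrArg Subtype.val hα).symm⟩
  have hPu := rieszProj_apply_of_mem_range hR hΓ hu
  -- `T` commutes with the projection, so it preserves the line spanned by `u`.
  obtain ⟨μ, hμ⟩ := hP (T u)
  rw [rieszProj_comm_apply hR hΓ, hPu] at hμ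
  have hspec := mem_spectrum_of_eigenvector hu0 hμ
  -- If `μ` were outside, `resolvent T z u = (z - μ)⁻¹ • u` on the circle would extend
  -- holomorphically to the disc, and `P u` would vanish.
  have hball : μ ∈ Metric.ball c R := by
    by_contra hμR
    have hμ' : μ ∉ Metric.closedBall c R := fun h => by
      rcases (Metric.mem_closedBall.1 h).lt_or_eq with h | h
      · exact hμR h
      · exact hspec (hΓ h)
    have hne : ∀ z ∈ Metric.closedBall c R, z - μ ≠ 0 := fun z hz h0 =>
      hμ' (sub_eq_zero.1 h0 ▸ hz)
    have h2 := (ContinuousLinearMap.apply ℂ X u).map_circleIntegral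
      (circleIntegrable_resolvent hR.le hΓ)
    have h3 : ∀ z ∈ Metric.sphere c R, ContinuousLinearMap.apply ℂ X u (resolvent T z)
        = (z - μ)⁻¹ • u := by
      intro z hz
      have h4 := DFunLike.congr_fun (resolvent_mul_sub (hΓ hz)) u
      simp only [Algebra.algebraMap_eq_smul_one] at h4
      rw [eq_inv_smul_iff₀ (hne z (Metric.sphere_subset_closedBall hz))]
      simpa [sub_smul, hμ] using h4
    have h5 : (∮ z in C(c, R), (z - μ)⁻¹ • u) = 0 := by
      refine Complex.circleIntegral_eq_zero_of_differentiable_on_off_countable hR.le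
        countable_empty ((ContinuousOn.inv₀ (by fun_prop) hne).smul continuousOn_const) ?_
      intro z hz
      exact ((differentiableAt_id.sub_const μ).inv
        (hne z (Metric.ball_subset_closedBall hz.1))).smul_const u
    rw [circleIntegral.integral_congr hR.le h3, h5, ContinuousLinearMap.apply_apply] at h2
    exact hu0 (by rw [← hPu, rieszProj, smul_apply, h2, smul_zero])
  refine ⟨μ, hball, ?_, ?_, u, hu0, hμ, hPu, hP⟩
  · refine Subset.antisymm (fun w ⟨hw, hwR⟩ => ?_) ?_
    · by_contra hne
      rcases (Metric.mem_closedBall.1 hwR).lt_or_eq with h | h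
      · have hsub : w - μ ≠ 0 := sub_ne_zero.2 hne
        have hTP : (algebraMap ℂ (X →L[ℂ] X) w - T) * rieszProj T c R
            = (w - μ) • rieszProj T c R := by
          ext x
          obtain ⟨α, hα⟩ := hP x
          simp only [Algebra.algebraMap_eq_smul_one, mul_apply_eq_comp, sub_apply, smul_apply, hα]
          simp [hμ, sub_smul, smul_comm α]
        have hcomm : Commute (algebraMap ℂ (X →L[ℂ] X) w - T) T :=
          (Algebra.commute_algebraMap_left w T).sub_left (Commute.refl T)
        -- The inverse of `w - T` is explicit: the Cauchy transform inverts it modulo `P`, and on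
        -- the range of `P` it is multiplication by `w - μ`.
        have hinv : (algebraMap ℂ (X →L[ℂ] X) w - T) *
            (resolventCauchy T c R w + (w - μ)⁻¹ • rieszProj T c R) = 1 := by
          rw [mul_add, sub_mul_resolventCauchy hΓ h, mul_smul_comm, hTP, smul_smul,
            inv_mul_cancel₀ hsub, one_smul, sub_add_cancel]
        refine hw (spectrum.mem_resolventSet_of_left_right_inverse hinv
          (?_ : (resolventCauchy T c R w + (w - μ)⁻¹ • rieszProj T c R) * _ = 1))
        rw [← hinv]
        exact ((Commute.resolventCauchy_right hΓ h hcomm).add_right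
          ((Commute.rieszProj_right hR.le hΓ hcomm).smul_right _)).eq.symm
      · exact hw (hΓ h)
    · rintro w rfl
      exact ⟨hspec, Metric.ball_subset_closedBall hball⟩
  · ext x
    rw [Module.End.mem_eigenspace_iff]
    constructor
    · intro hx
      obtain ⟨α, hα⟩ := hP x
      rw [rieszProj_apply_of_mem_range hR hΓ hx] at hα
      simp [hα, hμ, smul_comm α]
    · intro hx
      -- For an eigenvector the left side `S ((μ - T) x)` is zero, so `x = P x`; this also rules out
      -- other eigenvectors for `μ`.
      have h2 := DFunLike.congr_fun (resolventCauchy_mul_sub hΓ hball) x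
      have hx' : T x = μ • x := hx
      simp [Algebra.algebraMap_eq_smul_one, hx'] at h2
      exact ⟨x, (sub_eq_zero.1 h2.symm).symm⟩

/-- Closeness makes `P` injective on the range of `P'`, which therefore embeds in a line; and `P' u
≠ 0`, since `P' u` lies within less than `‖u‖` of `P u = u`. -/
lemma finrank_rieszProj_of_close {T' : X →L[ℂ] X} (hR : 0 < R)
    (hΓ : Metric.sphere c R ⊆ resolventSet ℂ T) (hΓ' : Metric.sphere c R ⊆ resolventSet ℂ T')
    (h1 : Module.finrank ℂ (rieszProj T c R).range = 1)
    (hclose : ‖rieszProj T' c R - rieszProj T c R‖ < 1) :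
    Module.finrank ℂ (rieszProj T' c R).range = 1 := by
  obtain ⟨μ, -, -, -, u, hu0, -, hPu, hP⟩ := spectrum_of_finrank_rieszProj hR hΓ h1
  set P := rieszProj T c R
  set P' := rieszProj T' c R
  have hlt : ∀ x, x ≠ 0 → ‖P' x - P x‖ < ‖x‖ := fun x hx => by
    have := (P' - P).le_opNorm x
    have hx' := norm_pos_iff.2 hx
    rw [sub_apply] at this
    nlinarith
  have hinj : ∀ x ∈ P'.range, P x = 0 → x = 0 := fun x hx hx0 => by
    by_contra hne
    have := hlt x hne
    rw [rieszProj_apply_of_mem_range hR hΓ' hx, hx0, sub_zero] at this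
    exact this.false
  have hv0 : P' u ≠ 0 := fun h => by
    have := hlt u hu0
    rw [h, hPu, zero_sub, norm_neg] at this
    exact this.false
  refine finrank_eq_one_iff'.2 ⟨⟨P' u, ⟨u, rfl⟩⟩, fun h => hv0 (congrArg Subtype.val h), ?_⟩
  rintro ⟨w, hw⟩
  obtain ⟨b, hb⟩ := hP (P' u)
  obtain ⟨α, hα⟩ := hP w
  have hb0 : b ≠ 0 := fun h => hv0 (hinj _ ⟨u, rfl⟩ (by rw [hb, h, zero_smul]))
  refine ⟨α / b, Subtype.ext ?_⟩
  refine (sub_eq_zero.1 (hinj _ (sub_mem hw (P'.range.smul_mem (α / b) ⟨u, rfl⟩)) ?_)).symm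
  simp only [map_sub, map_smul]
  erw [hα, hb]
  rw [smul_smul, div_mul_cancel₀ _ hb0, sub_self]

/-- Perturbation of a simple eigenvalue, with error bounds in terms of an exact eigenvector. -/
theorem simple_eigenvalue_perturbation {lam : ℂ} (hlam : lam ≠ 0)
    (hball : lam ∈ Metric.ball c R) (hiso : spectrum ℂ T ∩ Metric.closedBall c R = {lam})
    (h1 : Module.finrank ℂ (rieszProj T c R).range = 1) :
    ∃ u : X, T u = lam • u ∧ ∃ δ > 0, ∃ C : ℝ, 0 ≤ C ∧ ∀ T' : X →L[ℂ] X, ‖T - T'‖ ≤ δ →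
      ∃ μ ∈ Metric.ball c R, spectrum ℂ T' ∩ Metric.closedBall c R = {μ} ∧
        Module.finrank ℂ (rieszProj T' c R).range = 1 ∧
        (rieszProj T' c R).range = Module.End.eigenspace (T' : X →ₗ[ℂ] X) μ ∧
        ‖lam - μ‖ ≤ C * (‖T ((T - T') u)‖ + ‖T - T'‖ * ‖(T - T') u‖) ∧
        ∀ φ ∈ (rieszProj T' c R).range, ‖φ‖ = 1 →
          ‖φ - rieszProj T c R φ‖ ≤ C * ‖(T - T') u‖ ∧
          ‖μ⁻¹ • T φ - rieszProj T c R (μ⁻¹ • T φ)‖ ≤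
            C * (‖T ((T - T') u)‖ + ‖T - T'‖ * ‖(T - T') u‖) := by
  have hR : 0 < R := dist_nonneg.trans_lt hball
  have hΓ : Metric.sphere c R ⊆ resolventSet ℂ T := fun z hz => by
    by_contra h
    have : z ∈ ({lam} : Set ℂ) := hiso ▸ ⟨h, Metric.sphere_subset_closedBall hz⟩
    rw [mem_singleton_iff.1 this, Metric.mem_sphere] at hz
    exact (Metric.mem_ball.1 hball).ne hz
  obtain ⟨lam', -, hiso', -, u, hu0, hTu, hPu, hP⟩ := spectrum_of_finrank_rieszProj hR hΓ h1
  obtain rfl : lam' = lam := singleton_injective (hiso'.symm.trans hiso)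
  obtain ⟨δ₀, hδ₀, M, hM, hstab⟩ := rieszProj_stability hR hΓ
  set P := rieszProj T c R with hPdef
  set S := resolventCauchy T c R lam'
  set p := ‖P‖
  set σ := ‖S‖
  have hu0' := norm_pos_iff.2 hu0
  have hl := norm_pos_iff.2 hlam
  set q := p / ‖u‖
  -- `B` dominates all coefficients that, multiplied by `‖D‖`, must be at most `1 / 2`: for the
  -- projections to be close, for the absorption, and for `‖μ‖ ≥ ‖lam'‖ / 2`.
  set B := M + 2 * p + 2 * σ * (1 + p) + 2 * p / ‖lam'‖ + 1 with hB
  have hp0 : 0 ≤ p := norm_nonneg _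
  have hσ0 : 0 ≤ σ := norm_nonneg _
  have hq0 : 0 ≤ q := by positivity
  have hBpos : 0 < B := by positivity
  set C₁ := 2 * σ * (1 + p)
  have hC₁ : 0 ≤ C₁ := by positivity
  set C₂ := q + ‖T‖ * (2 * C₁ * q)
  have hC₂ : 0 ≤ C₂ := by positivity
  refine ⟨u, hTu, min δ₀ (1 / (2 * B)), lt_min hδ₀ (by positivity),
    2 * C₁ * q + 2 * (p * C₂) / ‖lam'‖ + 2 * (C₁ * C₂) / ‖lam'‖, by positivity, fun T' hT' => ?_⟩
  obtain ⟨hΓ', hPP⟩ := hstab T' (hT'.trans (min_le_left _ _))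
  set D := T - T' with hD
  set d := ‖D‖
  have hd0 : 0 ≤ d := norm_nonneg _
  have hdB : B * d ≤ 1 / 2 := by
    have := hT'.trans (min_le_right _ _)
    rw [le_div_iff₀ (by positivity)] at this
    linarith
  have hsmall : ∀ y, 0 ≤ y → y ≤ B → y * d ≤ 1 / 2 :=
    fun y _ hy => (mul_le_mul_of_nonneg_right hy hd0).trans hdB
  have hx1 : 0 ≤ 2 * p / ‖lam'‖ := by positivity
  have hMd := hsmall M hM (by rw [hB]; linarith)
  have hC₁d := hsmall C₁ hC₁ (by rw [hB]; linarith)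
  have hpd := hsmall (2 * p / ‖lam'‖) hx1 (by rw [hB]; linarith)
  have h1' := finrank_rieszProj_of_close hR hΓ hΓ' h1 (by rw [← hPdef]; linarith)
  obtain ⟨μ, hμball, hμiso, hμeig, u', hu', hTu', hPu', hP'⟩ :=
    spectrum_of_finrank_rieszProj hR hΓ' h1'
  have hPP1 : ∀ x, P (P x) = P x := fun x => DFunLike.congr_fun (rieszProj_idem hR hΓ) x
  have hPT : ∀ x, P (T x) = T (P x) := rieszProj_comm_apply hR hΓ
  have hST : ∀ x, S (T x) = T (S x) := fun x =>
    (DFunLike.congr_fun (Commute.resolventCauchy_right hΓ hball (Commute.refl T)).eq x).symm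
  have hSP : ∀ x, S (P x) = P (S x) := fun x => by
    have := Commute.rieszProj_right hR.le hΓ
      (Commute.resolventCauchy_right hΓ hball (Commute.refl T)).symm
    exact DFunLike.congr_fun this.eq x
  have hTP : ∀ x, T (P x) = lam' • P x := fun x => by
    obtain ⟨α, hα⟩ := hP x
    rw [hα, map_smul, hTu, smul_comm]
  have hSl : ∀ x, S (lam' • x - T x) = x - P x := fun x => by
    have := DFunLike.congr_fun (resolventCauchy_mul_sub hΓ hball) x
    simpa [Algebra.algebraMap_eq_smul_one] using this
  set e := ‖T (D u)‖ + d * ‖D u‖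
  have he0 : 0 ≤ e := by positivity
  have key : ∀ φ ∈ (rieszProj T' c R).range, ‖φ‖ = 1 →
      ‖φ - P φ‖ ≤ 2 * C₁ * q * ‖D u‖ ∧ ‖T (φ - P φ)‖ ≤ C₁ * C₂ * e ∧
      ‖lam' - μ‖ ≤ 2 * p * d ∧ ‖lam' - μ‖ ≤ 2 * (p * C₂) / ‖lam'‖ * e := by
    intro φ hφ hφ1
    have hT'φ : T' φ = μ • φ := by
      rw [hμeig] at hφ
      exact Module.End.mem_eigenspace_iff.1 hφ
    have hTφ : T φ = μ • φ + D φ := by rw [hD, sub_apply, hT'φ]; abel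
    have hy1 : ‖φ - P φ‖ ≤ 1 / 2 := by
      have := (rieszProj T' c R - P).le_opNorm φ
      rw [sub_apply, rieszProj_apply_of_mem_range hR hΓ' hφ, hφ1, mul_one] at this
      linarith
    obtain ⟨k1, k2, k3, k4, k5⟩ := eigenvector_perturbation hlam hu0 hPP1 hPT hST hSP hTP hSl hP
      hTφ hφ1 hy1 hC₁d
    have hTD : ‖T (D φ)‖ ≤ C₂ * e := by
      refine k3.trans ?_
      calc q * ‖T (D u)‖ + ‖T‖ * (4 * σ * (1 + p) * q) * (d * ‖D u‖)
          = q * ‖T (D u)‖ + ‖T‖ * (2 * C₁ * q) * (d * ‖D u‖) := by simp only [C₁]; ring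
        _ ≤ q * e + ‖T‖ * (2 * C₁ * q) * e := by
            gcongr
            · exact le_add_of_nonneg_right (by positivity)
            · exact le_add_of_nonneg_left (by positivity)
        _ = C₂ * e := by simp only [C₂]; ring
    refine ⟨k1.trans_eq (by simp only [C₁]; ring), k2.trans ?_, k4.trans_eq (by ring), ?_⟩
    · rw [mul_assoc C₁]
      exact mul_le_mul_of_nonneg_left hTD hC₁
    · calc _ ≤ 2 * (‖lam'‖⁻¹ * (p * (C₂ * e))) := by
            refine k5.trans ?_
            gcongr
        _ = _ := by field_simp
  -- The eigenvalue estimate needs some unit eigenvector of `T'`; the normalized generator of the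
  -- range serves.
  have hu'0 := norm_pos_iff.2 hu'
  have hφ' : ((‖u'‖⁻¹ : ℝ) : ℂ) • u' ∈ (rieszProj T' c R).range :=
    Submodule.smul_mem _ _ ⟨u', hPu'⟩
  obtain ⟨-, -, hcr, hev⟩ := key _ hφ' (by
    rw [norm_smul, Complex.norm_real, norm_inv, norm_norm, inv_mul_cancel₀ hu'0.ne'])
  have hr1 : 0 ≤ 2 * C₁ * q := by positivity
  have hr2 : 0 ≤ 2 * (p * C₂) / ‖lam'‖ := by positivity
  have hr3 : 0 ≤ 2 * (C₁ * C₂) / ‖lam'‖ := by positivity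
  have hμ : ‖lam'‖ / 2 ≤ ‖μ‖ := by
    have h3 := norm_le_norm_add_norm_sub' lam' μ
    have h4 : 2 * p * d ≤ ‖lam'‖ / 2 := by
      calc 2 * p * d = ‖lam'‖ * (2 * p / ‖lam'‖ * d) := by field_simp
        _ ≤ ‖lam'‖ * (1 / 2) := by gcongr
        _ = _ := by ring
    linarith
  have hμ0 : 0 < ‖μ‖ := by linarith
  refine ⟨μ, hμball, hμiso, h1', hμeig, ?_, fun φ hφ hφ1 => ?_⟩
  · refine hev.trans ?_
    gcongr; linarith
  · obtain ⟨hy, hTy, -⟩ := key φ hφ hφ1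
    refine ⟨hy.trans (by gcongr; linarith), ?_⟩
    rw [map_smul, ← smul_sub, hPT, ← map_sub, norm_smul, norm_inv]
    calc ‖μ‖⁻¹ * ‖T (φ - P φ)‖ ≤ (‖lam'‖ / 2)⁻¹ * (C₁ * C₂ * e) := by gcongr
      _ = 2 * (C₁ * C₂) / ‖lam'‖ * e := by field_simp
      _ ≤ _ := by gcongr; linarith

end SpectralPerturbation

/-! ### Functions with continuous partial derivatives on a closed convex planar set -/

section Partials

/-- `D j k`, `j, k ≤ m`, are continuous on `Ω` and are the partial derivatives of `D 0 0` in the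
interior of `Ω`. -/
structure PartialFamily (m : ℕ) (Ω : Set (ℝ × ℝ)) (D : ℕ → ℕ → ℝ → ℝ → ℝ) : Prop where
  cont : ∀ j k, j ≤ m → k ≤ m → ContinuousOn (fun p : ℝ × ℝ => D j k p.1 p.2) Ω
  deriv_fst : ∀ j k, j < m → k ≤ m → ∀ s t, (s, t) ∈ interior Ω →
    HasDerivAt (fun u => D j k u t) (D (j + 1) k s t) s
  deriv_snd : ∀ j k, j ≤ m → k < m → ∀ s t, (s, t) ∈ interior Ω →
    HasDerivAt (fun u => D j k s u) (D j (k + 1) s t) t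

/-- The gradient of `D j k`. -/
noncomputable def partialGrad (D : ℕ → ℕ → ℝ → ℝ → ℝ) (j k : ℕ) (p : ℝ × ℝ) : ℝ × ℝ →L[ℝ] ℝ :=
  D (j + 1) k p.1 p.2 • ContinuousLinearMap.fst ℝ ℝ ℝ +
    D j (k + 1) p.1 p.2 • ContinuousLinearMap.snd ℝ ℝ ℝ

lemma partialGrad_apply (D : ℕ → ℕ → ℝ → ℝ → ℝ) (j k : ℕ) (p q : ℝ × ℝ) :
    partialGrad D j k p q = D (j + 1) k p.1 p.2 * q.1 + D j (k + 1) p.1 p.2 * q.2 := rfl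

lemma norm_partialGrad_sub_le (D : ℕ → ℕ → ℝ → ℝ → ℝ) (j k : ℕ) (p q : ℝ × ℝ) :
    ‖partialGrad D j k p - partialGrad D j k q‖ ≤
      |D (j + 1) k p.1 p.2 - D (j + 1) k q.1 q.2| +
        |D j (k + 1) p.1 p.2 - D j (k + 1) q.1 q.2| := by
  refine ContinuousLinearMap.opNorm_le_bound _ (by positivity) fun x => ?_
  rw [sub_apply, partialGrad_apply, partialGrad_apply, Real.norm_eq_abs]
  have h1 : |x.1| ≤ ‖x‖ := norm_fst_le x
  have h2 : |x.2| ≤ ‖x‖ := norm_snd_le x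
  rw [show ∀ a b c d : ℝ, a * x.1 + b * x.2 - (c * x.1 + d * x.2)
    = (a - c) * x.1 + (b - d) * x.2 by intros; ring]
  refine (abs_add_le _ _).trans ?_
  rw [abs_mul, abs_mul, add_mul]
  gcongr

variable {m : ℕ} {Ω : Set (ℝ × ℝ)} {D : ℕ → ℕ → ℝ → ℝ → ℝ}

lemma PartialFamily.hasFDerivAt (hD : PartialFamily m Ω D) {j k : ℕ} (hj : j < m) (hk : k < m)
    {p : ℝ × ℝ} (hp : p ∈ interior Ω) :
    HasFDerivAt (fun q : ℝ × ℝ => D j k q.1 q.2) (partialGrad D j k p) p := by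
  have hev : ∀ᶠ v in nhds p, v ∈ interior Ω := isOpen_interior.mem_nhds hp
  have hc : ∀ j k, j ≤ m → k ≤ m → ContinuousAt (fun p : ℝ × ℝ => D j k p.1 p.2) p :=
    fun j k hj hk => (hD.cont j k hj hk).continuousAt (mem_interior_iff_mem_nhds.1 hp)
  have := hasStrictFDerivAt_uncurry_coprod (𝕜 := ℝ) (u := p) (f := D j k)
    (f₁ := fun x y => ContinuousLinearMap.toSpanSingleton ℝ (D (j + 1) k x y))
    (f₂ := fun x y => ContinuousLinearMap.toSpanSingleton ℝ (D j (k + 1) x y))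
    (hev.mono fun v hv => (hD.deriv_fst j k hj hk.le v.1 v.2 hv).hasFDerivAt)
    (hev.mono fun v hv => (hD.deriv_snd j k hj.le hk v.1 v.2 hv).hasFDerivAt)
    ((ContinuousLinearMap.toSpanSingletonCLE (𝕜 := ℝ) (E := ℝ)).continuous.continuousAt.comp
      (hc (j + 1) k hj hk.le))
    ((ContinuousLinearMap.toSpanSingletonCLE (𝕜 := ℝ) (E := ℝ)).continuous.continuousAt.comp
      (hc j (k + 1) hj.le hk))
  refine this.hasFDerivAt.congr_fderiv ?_
  ext <;> simp [partialGrad, Function.HasUncurry.uncurry]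

/-- A closed convex set with nonempty interior is the closure of that interior, and the gradient has
a continuous extension; by the mean value inequality that extension is the derivative at boundary
points too. This makes one-sided calculus on the diagonal available. -/
lemma PartialFamily.hasFDerivWithinAt (hD : PartialFamily m Ω D) (hcv : Convex ℝ Ω)
    (hcl : IsClosed Ω) (hne : (interior Ω).Nonempty) {j k : ℕ} (hj : j < m) (hk : k < m)
    {p : ℝ × ℝ} (hp : p ∈ Ω) :
    HasFDerivWithinAt (fun q : ℝ × ℝ => D j k q.1 q.2) (partialGrad D j k p) Ω p := by
  have hcl' : closure (interior Ω) = Ω := by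
    rw [hcv.closure_interior_eq_closure_of_nonempty_interior hne, hcl.closure_eq]
  have := hasFDerivWithinAt_closure_of_tendsto_fderiv (s := interior Ω) (x := p)
    (f := fun q : ℝ × ℝ => D j k q.1 q.2) (f' := partialGrad D j k p)
    (fun q hq => (hD.hasFDerivAt hj hk hq).differentiableAt.differentiableWithinAt)
    hcv.interior isOpen_interior
    (fun y hy => (hD.cont j k hj.le hk.le y (hcl' ▸ hy)).mono interior_subset) ?_
  · rwa [hcl'] at this
  · have h1 : ContinuousOn (partialGrad D j k) Ω :=
      ((hD.cont (j + 1) k hj hk.le).smul continuousOn_const).add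
        ((hD.cont j (k + 1) hj.le hk).smul continuousOn_const)
    refine ((h1 p hp).mono interior_subset).congr' ?_
    filter_upwards [self_mem_nhdsWithin] with q hq
    exact (hD.hasFDerivAt hj hk hq).fderiv.symm

lemma PartialFamily.exists_lipschitz (hD : PartialFamily m Ω D) (hcv : Convex ℝ Ω)
    (hcp : IsCompact Ω) (hne : (interior Ω).Nonempty) {j k : ℕ} (hj : j < m) (hk : k < m) :
    ∃ L : ℝ, 0 ≤ L ∧ ∀ p ∈ Ω, ∀ q ∈ Ω, |D j k p.1 p.2 - D j k q.1 q.2| ≤ L * ‖p - q‖ := by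
  have h1 : ContinuousOn (partialGrad D j k) Ω :=
    ((hD.cont (j + 1) k hj hk.le).smul continuousOn_const).add
      ((hD.cont j (k + 1) hj.le hk).smul continuousOn_const)
  obtain ⟨L, hL⟩ := hcp.exists_bound_of_continuousOn h1
  refine ⟨max L 0, le_max_right _ _, fun p hp q hq => ?_⟩
  exact hcv.norm_image_sub_le_of_norm_hasFDerivWithin_le
    (fun x hx => hD.hasFDerivWithinAt hcv hcp.isClosed hne hj hk hx)
    (fun x hx => (hL x hx).trans (le_max_left _ _)) hq hp

/-- The mean value inequality is applied on the intersection of `Ω` with the ball about `p` of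
radius `‖q - p‖`, where the gradient differs from its value at `p` by at most a multiple of that
radius. -/
lemma PartialFamily.exists_taylor (hD : PartialFamily m Ω D) (hcv : Convex ℝ Ω)
    (hcp : IsCompact Ω) (hne : (interior Ω).Nonempty) (hm : 2 ≤ m) :
    ∃ L : ℝ, 0 ≤ L ∧ ∀ p ∈ Ω, ∀ q ∈ Ω,
      |D 0 0 q.1 q.2 - D 0 0 p.1 p.2 - (D 1 0 p.1 p.2 * (q.1 - p.1) +
        D 0 1 p.1 p.2 * (q.2 - p.2))| ≤ L * ‖q - p‖ ^ 2 := by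
  obtain ⟨L₁, h1, hL₁⟩ := hD.exists_lipschitz hcv hcp hne (j := 1) (k := 0) (by omega) (by omega)
  obtain ⟨L₂, h2, hL₂⟩ := hD.exists_lipschitz hcv hcp hne (j := 0) (k := 1) (by omega) (by omega)
  refine ⟨L₁ + L₂, by positivity, fun p hp q hq => ?_⟩
  have := (hcv.inter (convex_closedBall p ‖q - p‖)).norm_image_sub_le_of_norm_hasFDerivWithin_le'
    (f := fun q : ℝ × ℝ => D 0 0 q.1 q.2) (f' := partialGrad D 0 0) (φ := partialGrad D 0 0 p)
    (x := p) (y := q) (C := (L₁ + L₂) * ‖q - p‖)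
    (fun x hx => (hD.hasFDerivWithinAt hcv hcp.isClosed hne (by omega) (by omega) hx.1).mono
      inter_subset_left) (fun x hx => ?_)
    ⟨hp, Metric.mem_closedBall_self (norm_nonneg _)⟩ ⟨hq, by simp [dist_eq_norm]⟩
  · rw [partialGrad_apply, Real.norm_eq_abs] at this
    refine this.trans_eq (by ring)
  · refine (norm_partialGrad_sub_le _ _ _ _ _).trans ?_
    have h3 : ‖x - p‖ ≤ ‖q - p‖ := by simpa [dist_eq_norm] using hx.2
    calc _ ≤ L₁ * ‖x - p‖ + L₂ * ‖x - p‖ := add_le_add (hL₁ x hx.1 p hp) (hL₂ x hx.1 p hp)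
      _ = (L₁ + L₂) * ‖x - p‖ := by ring
      _ ≤ _ := by gcongr

lemma PartialFamily.deriv_fst_section (hD : PartialFamily m Ω D) (hcv : Convex ℝ Ω)
    (hcl : IsClosed Ω) (hne : (interior Ω).Nonempty) {j k : ℕ} (hj : j < m) (hk : k < m)
    {I : Set ℝ} {s t : ℝ} (hs : (s, t) ∈ Ω) (hI : ∀ x ∈ I, (x, t) ∈ Ω) :
    HasDerivWithinAt (fun x => D j k x t) (D (j + 1) k s t) I s := by
  have := (hD.hasFDerivWithinAt hcv hcl hne hj hk hs).comp_hasDerivWithinAt s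
    (f := fun x : ℝ => (x, t)) ((hasDerivWithinAt_id s I).prodMk (hasDerivWithinAt_const s I t)) hI
  simpa [partialGrad_apply, Function.comp_def] using this

lemma PartialFamily.deriv_snd_section (hD : PartialFamily m Ω D) (hcv : Convex ℝ Ω)
    (hcl : IsClosed Ω) (hne : (interior Ω).Nonempty) {j k : ℕ} (hj : j < m) (hk : k < m)
    {I : Set ℝ} {s t : ℝ} (hs : (s, t) ∈ Ω) (hI : ∀ x ∈ I, (s, x) ∈ Ω) :
    HasDerivWithinAt (fun x => D j k s x) (D j (k + 1) s t) I t := by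
  have := (hD.hasFDerivWithinAt hcv hcl hne hj hk hs).comp_hasDerivWithinAt t
    (f := fun x : ℝ => (s, x)) ((hasDerivWithinAt_const t I s).prodMk (hasDerivWithinAt_id t I)) hI
  simpa [partialGrad_apply, Function.comp_def] using this

lemma PartialFamily.deriv_diag (hD : PartialFamily m Ω D) (hcv : Convex ℝ Ω)
    (hcl : IsClosed Ω) (hne : (interior Ω).Nonempty) {j k : ℕ} (hj : j < m) (hk : k < m)
    {I : Set ℝ} {s : ℝ} (hs : (s, s) ∈ Ω) (hI : ∀ x ∈ I, (x, x) ∈ Ω) :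
    HasDerivWithinAt (fun x => D j k x x) (D (j + 1) k s s + D j (k + 1) s s) I s := by
  have := (hD.hasFDerivWithinAt hcv hcl hne hj hk hs).comp_hasDerivWithinAt s
    (f := fun x : ℝ => (x, x)) ((hasDerivWithinAt_id s I).prodMk (hasDerivWithinAt_id s I)) hI
  simpa [partialGrad_apply, Function.comp_def] using this

/-- Mixed second differences on a rectangle contained in `Ω`. -/
lemma PartialFamily.mixed_difference (hD : PartialFamily m Ω D) (hcv : Convex ℝ Ω)
    (hcl : IsClosed Ω) (hne : (interior Ω).Nonempty) {j k : ℕ} (hj : j < m) (hk : k < m) {L : ℝ}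
    (hL : ∀ p ∈ Ω, ∀ q ∈ Ω,
      |D j (k + 1) p.1 p.2 - D j (k + 1) q.1 q.2| ≤ L * ‖p - q‖)
    {I J : Set ℝ} (hJ : Convex ℝ J) (hIJ : I ×ˢ J ⊆ Ω) {s s' t t' : ℝ} (hs : s ∈ I) (hs' : s' ∈ I)
    (ht : t ∈ J) (ht' : t' ∈ J) :
    |(D j k s t - D j k s' t) - (D j k s t' - D j k s' t')| ≤ L * |s - s'| * |t - t'| := by
  -- The difference in the first variable is a function of the second, whose derivative is `O(|s -
  -- s'|)`.
  refine hJ.norm_image_sub_le_of_norm_hasDerivWithin_le (f := fun x => D j k s x - D j k s' x)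
    (f' := fun x => D j (k + 1) s x - D j (k + 1) s' x) (fun x hx => ?_) (fun x hx => ?_) ht' ht
  · exact (hD.deriv_snd_section hcv hcl hne hj hk (hIJ ⟨hs, hx⟩) fun y hy => hIJ ⟨hs, hy⟩).sub
      (hD.deriv_snd_section hcv hcl hne hj hk (hIJ ⟨hs', hx⟩) fun y hy => hIJ ⟨hs', hy⟩)
  · refine (hL (s, x) (hIJ ⟨hs, hx⟩) (s', x) (hIJ ⟨hs', hx⟩)).trans_eq ?_
    simp [Prod.norm_def]

end Partials

/-! ### Convexity, compactness and interior of the two triangles -/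

section Triangles

lemma convex_lowerTriangle : Convex ℝ lowerTriangle := by
  rintro ⟨a, b⟩ ⟨h1, h2, h3⟩ ⟨c, d⟩ ⟨h4, h5, h6⟩ α β hα hβ hαβ
  simp only [lowerTriangle, mem_ofPred_eq, Prod.smul_mk, Prod.mk_add_mk, smul_eq_mul] at *
  exact ⟨by positivity, by gcongr, by nlinarith⟩

lemma convex_upperTriangle : Convex ℝ upperTriangle := by
  rintro ⟨a, b⟩ ⟨h1, h2, h3⟩ ⟨c, d⟩ ⟨h4, h5, h6⟩ α β hα hβ hαβ
  simp only [upperTriangle, mem_ofPred_eq, Prod.smul_mk, Prod.mk_add_mk, smul_eq_mul] at *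
  exact ⟨by positivity, by gcongr, by nlinarith⟩

lemma isCompact_lowerTriangle : IsCompact lowerTriangle :=
  (isCompact_Icc.prod isCompact_Icc : IsCompact (Icc (0 : ℝ) 1 ×ˢ Icc (0 : ℝ) 1)).of_isClosed_subset
    isClosed_lowerTriangle fun _ ⟨h1, h2, h3⟩ => ⟨⟨h1.trans h2, h3⟩, ⟨h1, h2.trans h3⟩⟩

lemma isCompact_upperTriangle : IsCompact upperTriangle :=
  (isCompact_Icc.prod isCompact_Icc : IsCompact (Icc (0 : ℝ) 1 ×ˢ Icc (0 : ℝ) 1)).of_isClosed_subset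
    isClosed_upperTriangle fun _ ⟨h1, h2, h3⟩ => ⟨⟨h1, h2.trans h3⟩, ⟨h1.trans h2, h3⟩⟩

lemma interior_lowerTriangle_nonempty : (interior lowerTriangle).Nonempty := by
  refine ⟨(3 / 4, 1 / 4), mem_interior.2 ⟨Ioo (1 / 2) 1 ×ˢ Ioo 0 (1 / 2), ?_,
    isOpen_Ioo.prod isOpen_Ioo, by norm_num⟩⟩
  rintro ⟨s, t⟩ ⟨⟨h1, h2⟩, h3, h4⟩
  exact ⟨h3.le, (h4.trans h1).le, h2.le⟩

lemma interior_upperTriangle_nonempty : (interior upperTriangle).Nonempty := by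
  refine ⟨(1 / 4, 3 / 4), mem_interior.2 ⟨Ioo 0 (1 / 2) ×ˢ Ioo (1 / 2) 1, ?_,
    isOpen_Ioo.prod isOpen_Ioo, by norm_num⟩⟩
  rintro ⟨s, t⟩ ⟨⟨h1, h2⟩, h3, h4⟩
  exact ⟨h1.le, (h2.trans h3).le, h4.le⟩

end Triangles

/-! ### Bounds for differences of the kernel, and its expansion at the diagonal -/

section KernelBounds

/-- The linear terms of the expansions at `m + τ` and `m - τ` cancel. Only the oscillation of `f'`
enters, so no second derivative at boundary points is required. -/
lemma second_difference_le {f f' : ℝ → ℝ} {m τ B : ℝ} (hτ : 0 ≤ τ)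
    (hf : ∀ x ∈ Icc (m - τ) (m + τ), HasDerivWithinAt f (f' x) (Icc (m - τ) (m + τ)) x)
    (hB : ∀ x ∈ Icc (m - τ) (m + τ), |f' x - f' m| ≤ B) :
    |f (m + τ) + f (m - τ) - 2 * f m| ≤ 2 * B * τ := by
  have hm : m ∈ Icc (m - τ) (m + τ) := ⟨by linarith, by linarith⟩
  have key : ∀ y ∈ Icc (m - τ) (m + τ), |f y - f m - f' m * (y - m)| ≤ B * |y - m| := by
    intro y hy
    have := (convex_Icc (m - τ) (m + τ)).norm_image_sub_le_of_norm_hasDerivWithin_le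
      (f := fun x => f x - f' m * x) (f' := fun x => f' x - f' m * 1) (C := B)
      (fun x hx => (hf x hx).sub ((hasDerivWithinAt_id x _).const_mul _))
      (fun x hx => by simpa using hB x hx) hm hy
    simp only [Real.norm_eq_abs] at this
    refine le_trans (le_of_eq ?_) this
    congr 1; ring
  have h1 := key (m + τ) ⟨by linarith, le_rfl⟩
  have h2 := key (m - τ) ⟨le_rfl, by linarith⟩
  rw [show m + τ - m = τ by ring, abs_of_nonneg hτ] at h1
  rw [show m - τ - m = -τ by ring, abs_neg, abs_of_nonneg hτ] at h2
  rw [abs_le] at *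
  constructor <;> linarith [h1.1, h1.2, h2.1, h2.2]

/-- The bounds on the kernel of order `0` and `1`, and on its differences of higher order, that
enter into the error analysis. -/
structure PartialBounds (Ω : Set (ℝ × ℝ)) (D : ℕ → ℕ → ℝ → ℝ → ℝ) (L : ℝ) : Prop where
  nonneg : 0 ≤ L
  bound : ∀ p ∈ Ω, |D 0 0 p.1 p.2| ≤ L
  lip : ∀ p ∈ Ω, ∀ q ∈ Ω, |D 0 0 p.1 p.2 - D 0 0 q.1 q.2| ≤ L * ‖p - q‖
  mixed : ∀ {I J : Set ℝ}, Convex ℝ J → I ×ˢ J ⊆ Ω → ∀ {s s' t t' : ℝ}, s ∈ I → s' ∈ I →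
    t ∈ J → t' ∈ J →
    |(D 0 0 s t - D 0 0 s' t) - (D 0 0 s t' - D 0 0 s' t')| ≤ L * |s - s'| * |t - t'|
  second : ∀ {m τ : ℝ} {J : Set ℝ}, 0 ≤ τ → Icc (m - τ) (m + τ) ×ˢ J ⊆ Ω → ∀ {t}, t ∈ J →
    |D 0 0 (m + τ) t + D 0 0 (m - τ) t - 2 * D 0 0 m t| ≤ L * τ ^ 2
  second_mixed : ∀ {m τ : ℝ} {J : Set ℝ}, 0 ≤ τ → Convex ℝ J → Icc (m - τ) (m + τ) ×ˢ J ⊆ Ω →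
    ∀ {t t'}, t ∈ J → t' ∈ J →
    |(D 0 0 (m + τ) t + D 0 0 (m - τ) t - 2 * D 0 0 m t) -
      (D 0 0 (m + τ) t' + D 0 0 (m - τ) t' - 2 * D 0 0 m t')| ≤ L * τ ^ 2 * |t - t'|
  taylor : ∀ p ∈ Ω, ∀ q ∈ Ω,
    |D 0 0 q.1 q.2 - D 0 0 p.1 p.2 - (D 1 0 p.1 p.2 * (q.1 - p.1) +
      D 0 1 p.1 p.2 * (q.2 - p.2))| ≤ L * ‖q - p‖ ^ 2

variable {m : ℕ} {Ω : Set (ℝ × ℝ)} {D : ℕ → ℕ → ℝ → ℝ → ℝ}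

lemma PartialBounds.mono {L L' : ℝ} (h : PartialBounds Ω D L) (hL : L ≤ L') :
    PartialBounds Ω D L' where
  nonneg := h.nonneg.trans hL
  bound p hp := (h.bound p hp).trans hL
  lip p hp q hq := (h.lip p hp q hq).trans (by gcongr)
  mixed hJ hIJ _ _ _ _ h1 h2 h3 h4 := (h.mixed hJ hIJ h1 h2 h3 h4).trans (by gcongr)
  second hτ hJ _ ht := (h.second hτ hJ ht).trans (by gcongr)
  second_mixed hτ hJ hIJ _ _ ht ht' := (h.second_mixed hτ hJ hIJ ht ht').trans (by gcongr)
  taylor p hp q hq := (h.taylor p hp q hq).trans (by gcongr)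

lemma PartialFamily.exists_partialBounds (hD : PartialFamily m Ω D) (hcv : Convex ℝ Ω)
    (hcp : IsCompact Ω) (hne : (interior Ω).Nonempty) (hm : 2 ≤ m) :
    ∃ L, PartialBounds Ω D L := by
  have hcl := hcp.isClosed
  obtain ⟨B, hB⟩ := hcp.exists_bound_of_continuousOn (hD.cont 0 0 (by omega) (by omega))
  obtain ⟨L, h0, hL⟩ := hD.exists_lipschitz hcv hcp hne (j := 0) (k := 0) (by omega) (by omega)
  obtain ⟨L₁, h1, hL₁⟩ := hD.exists_lipschitz hcv hcp hne (j := 1) (k := 0) (by omega) (by omega)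
  obtain ⟨L₂, h2, hL₂⟩ := hD.exists_lipschitz hcv hcp hne (j := 0) (k := 1) (by omega) (by omega)
  obtain ⟨L₃, h3, hL₃⟩ := hD.exists_lipschitz hcv hcp hne (j := 1) (k := 1) (by omega) (by omega)
  obtain ⟨L₄, h4, hL₄⟩ := hD.exists_taylor hcv hcp hne hm
  set M := max B 0 + L + 2 * L₁ + L₂ + 2 * L₃ + L₄ with hM
  have hB0 := le_max_right B 0
  have hB1 := le_max_left B 0
  have hsec : ∀ {m τ : ℝ} {J : Set ℝ} {t : ℝ}, Icc (m - τ) (m + τ) ×ˢ J ⊆ Ω → t ∈ J →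
      ∀ x ∈ Icc (m - τ) (m + τ),
      HasDerivWithinAt (fun x => D 0 0 x t) (D 1 0 x t) (Icc (m - τ) (m + τ)) x := by
    intro m τ J t hIJ ht x hx
    exact hD.deriv_fst_section hcv hcl hne (by omega) (by omega) (hIJ ⟨hx, ht⟩)
      fun y hy => hIJ ⟨hy, ht⟩
  have habs : ∀ {m τ x : ℝ}, x ∈ Icc (m - τ) (m + τ) → |x - m| ≤ τ := by
    intro m τ x hx
    rw [abs_le]; constructor <;> linarith [hx.1, hx.2]
  refine ⟨M, ⟨by positivity, fun p hp => (hB p hp).trans (by linarith), fun p hp q hq => (hL p hp q hq).trans ?_,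
    fun hJ hIJ _ _ _ _ hs hs' ht ht' =>
      (hD.mixed_difference hcv hcl hne (by omega) (by omega) hL₂ hJ hIJ hs hs' ht ht').trans ?_,
    fun {m τ J} hτ hIJ t ht => ?_, fun {m τ J} hτ hJ hIJ t t' ht ht' => ?_,
    fun p hp q hq => (hL₄ p hp q hq).trans ?_⟩⟩
  · gcongr; linarith
  · gcongr; linarith
  · have hm : m ∈ Icc (m - τ) (m + τ) := ⟨by linarith, by linarith⟩
    refine (second_difference_le hτ (hsec hIJ ht) (B := L₁ * τ) fun x hx => ?_).trans ?_
    · refine (hL₁ (x, t) (hIJ ⟨hx, ht⟩) (m, t) (hIJ ⟨hm, ht⟩)).trans ?_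
      gcongr
      simpa [Prod.norm_def, hτ] using habs hx
    · rw [show 2 * (L₁ * τ) * τ = 2 * L₁ * τ ^ 2 by ring]
      gcongr; linarith
  · have hm : m ∈ Icc (m - τ) (m + τ) := ⟨by linarith, by linarith⟩
    have := second_difference_le (f := fun x => D 0 0 x t - D 0 0 x t') hτ
      (f' := fun x => D 1 0 x t - D 1 0 x t')
      (fun x hx => (hsec hIJ ht x hx).sub (hsec hIJ ht' x hx)) (B := L₃ * τ * |t - t'|)
      fun x hx => ?_
    · rw [show ∀ a b c a' b' c' : ℝ, (a + b - 2 * c) - (a' + b' - 2 * c')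
        = (a - a') + (b - b') - 2 * (c - c') by intros; ring]
      refine this.trans ?_
      rw [show 2 * (L₃ * τ * |t - t'|) * τ = 2 * L₃ * τ ^ 2 * |t - t'| by ring]
      gcongr; linarith
    · rw [show ∀ a b c d : ℝ, a - b - (c - d) = a - c - (b - d) by intros; ring]
      refine (hD.mixed_difference hcv hcl hne (by omega) (by omega) hL₃ hJ hIJ hx hm
        ht ht').trans ?_
      gcongr
      exact habs hx
  · gcongr; linarith

/-- Bounds on a continuous kernel on `[0,1]²` that is smooth off the diagonal. -/
structure KernelBounds (k : ℝ → ℝ → ℝ) (L : ℝ) : Prop where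
  nonneg : 0 ≤ L
  bound : ∀ s ∈ Icc (0 : ℝ) 1, ∀ t ∈ Icc (0 : ℝ) 1, |k s t| ≤ L
  lip_fst : ∀ s ∈ Icc (0 : ℝ) 1, ∀ s' ∈ Icc (0 : ℝ) 1, ∀ t ∈ Icc (0 : ℝ) 1,
    |k s t - k s' t| ≤ L * |s - s'|
  lip_snd : ∀ s ∈ Icc (0 : ℝ) 1, ∀ t ∈ Icc (0 : ℝ) 1, ∀ t' ∈ Icc (0 : ℝ) 1,
    |k s t - k s t'| ≤ L * |t - t'|
  mixed : ∀ {a b c d : ℝ}, 0 ≤ a → b ≤ 1 → 0 ≤ c → d ≤ 1 → b ≤ c ∨ d ≤ a →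
    ∀ s ∈ Icc a b, ∀ s' ∈ Icc a b, ∀ t ∈ Icc c d, ∀ t' ∈ Icc c d,
    |(k s t - k s' t) - (k s t' - k s' t')| ≤ L * |s - s'| * |t - t'|
  second : ∀ {m τ c d : ℝ}, 0 ≤ τ → 0 ≤ m - τ → m + τ ≤ 1 → 0 ≤ c → d ≤ 1 →
    m + τ ≤ c ∨ d ≤ m - τ → ∀ t ∈ Icc c d, |k (m + τ) t + k (m - τ) t - 2 * k m t| ≤ L * τ ^ 2
  second_mixed : ∀ {m τ c d : ℝ}, 0 ≤ τ → 0 ≤ m - τ → m + τ ≤ 1 → 0 ≤ c → d ≤ 1 →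
    m + τ ≤ c ∨ d ≤ m - τ → ∀ t ∈ Icc c d, ∀ t' ∈ Icc c d,
    |(k (m + τ) t + k (m - τ) t - 2 * k m t) - (k (m + τ) t' + k (m - τ) t' - 2 * k m t')|
      ≤ L * τ ^ 2 * |t - t'|
  taylor : ∀ x ∈ Icc (0 : ℝ) 1, ∃ α β γ δ : ℝ, ∀ s ∈ Icc (0 : ℝ) 1,
    ∀ t ∈ Icc (0 : ℝ) 1, ∀ h : ℝ, |s - x| ≤ h → |t - x| ≤ h →
    |k s t - (α + β * (s - x) + γ * (t - x) + δ * max (s - t) 0)| ≤ L * h ^ 2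

lemma rect_subset_upperTriangle {a b c d : ℝ} (ha : 0 ≤ a) (hd : d ≤ 1) (h : b ≤ c) :
    Icc a b ×ˢ Icc c d ⊆ upperTriangle :=
  fun _ ⟨⟨h1, h2⟩, h3, h4⟩ => ⟨ha.trans h1, h2.trans (h.trans h3), h4.trans hd⟩

lemma rect_subset_lowerTriangle {a b c d : ℝ} (hc : 0 ≤ c) (hb : b ≤ 1) (h : d ≤ a) :
    Icc a b ×ˢ Icc c d ⊆ lowerTriangle :=
  fun _ ⟨⟨h1, h2⟩, h3, h4⟩ => ⟨hc.trans h3, h4.trans (h.trans h1), h2.trans hb⟩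

lemma le_or_le_mem_triangle {s t : ℝ} (hs : s ∈ Icc (0 : ℝ) 1) (ht : t ∈ Icc (0 : ℝ) 1) :
    (t ≤ s ∧ (s, t) ∈ lowerTriangle) ∨ (s ≤ t ∧ (s, t) ∈ upperTriangle) := by
  rcases le_total t s with h | h
  · exact Or.inl ⟨h, ht.1, h, hs.2⟩
  · exact Or.inr ⟨h, hs.1, h, ht.2⟩

/-- Lipschitz bounds cross the diagonal by passing through a diagonal point. Higher differences are
asserted only on rectangles inside one triangle; near the diagonal they are replaced by an expansion
with an explicit kink `max (s - t) 0`. -/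
lemma exists_kernelBounds {k : ℝ → ℝ → ℝ} {D E : ℕ → ℕ → ℝ → ℝ → ℝ} (hm : 2 ≤ m)
    (hD : PartialFamily m lowerTriangle D) (hE : PartialFamily m upperTriangle E)
    (hkD : ∀ s t, (s, t) ∈ lowerTriangle → k s t = D 0 0 s t)
    (hkE : ∀ s t, (s, t) ∈ upperTriangle → k s t = E 0 0 s t) : ∃ L, KernelBounds k L := by
  obtain ⟨L₁, h1⟩ := hD.exists_partialBounds convex_lowerTriangle isCompact_lowerTriangle
    interior_lowerTriangle_nonempty hm
  obtain ⟨L₂, h2⟩ := hE.exists_partialBounds convex_upperTriangle isCompact_upperTriangle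
    interior_upperTriangle_nonempty hm
  set L := max L₁ L₂
  replace h1 := h1.mono (le_max_left L₁ L₂)
  replace h2 := h2.mono (le_max_right L₁ L₂)
  have hL0 : 0 ≤ L := h1.nonneg
  have diagD : ∀ s ∈ Icc (0 : ℝ) 1, (s, s) ∈ lowerTriangle := fun s hs => ⟨hs.1, le_rfl, hs.2⟩
  have diagE : ∀ s ∈ Icc (0 : ℝ) 1, (s, s) ∈ upperTriangle := fun s hs => ⟨hs.1, le_rfl, hs.2⟩
  have lip1 : ∀ p ∈ lowerTriangle, ∀ q ∈ lowerTriangle,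
      |k p.1 p.2 - k q.1 q.2| ≤ L * ‖p - q‖ := fun p hp q hq => by
    rw [hkD _ _ hp, hkD _ _ hq]; exact h1.lip p hp q hq
  have lip2 : ∀ p ∈ upperTriangle, ∀ q ∈ upperTriangle,
      |k p.1 p.2 - k q.1 q.2| ≤ L * ‖p - q‖ := fun p hp q hq => by
    rw [hkE _ _ hp, hkE _ _ hq]; exact h2.lip p hp q hq
  have lipfst : ∀ s ∈ Icc (0 : ℝ) 1, ∀ s' ∈ Icc (0 : ℝ) 1, ∀ t ∈ Icc (0 : ℝ) 1, s' ≤ s →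
      |k s t - k s' t| ≤ L * |s - s'| := by
    intro s hs s' hs' t ht hss
    rcases le_or_le_mem_triangle hs ht with ⟨h, hmem⟩ | ⟨h, hmem⟩ <;>
      rcases le_or_le_mem_triangle hs' ht with ⟨h', hmem'⟩ | ⟨h', hmem'⟩
    · simpa [Prod.norm_def] using lip1 _ hmem _ hmem'
    · have e1 := lip1 _ hmem _ (diagD t ht)
      have e2 := lip2 _ (diagE t ht) _ hmem'
      simp only [Prod.norm_def, Prod.fst_sub, Prod.snd_sub, sub_self, norm_zero,
        Real.norm_eq_abs, abs_nonneg, sup_of_le_left] at e1 e2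
      rw [abs_of_nonneg (by linarith : 0 ≤ s - t)] at e1
      rw [abs_of_nonneg (by linarith : 0 ≤ t - s')] at e2
      rw [abs_of_nonneg (by linarith : 0 ≤ s - s')]
      have := abs_sub_le (k s t) (k t t) (k s' t)
      linarith
    · obtain rfl : s = t := le_antisymm h (h'.trans hss)
      obtain rfl : s' = s := le_antisymm hss h'
      simp
    · simpa [Prod.norm_def] using lip2 _ hmem _ hmem'
  have lipsnd : ∀ s ∈ Icc (0 : ℝ) 1, ∀ t ∈ Icc (0 : ℝ) 1, ∀ t' ∈ Icc (0 : ℝ) 1, t' ≤ t →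
      |k s t - k s t'| ≤ L * |t - t'| := by
    intro s hs t ht t' ht' htt
    rcases le_or_le_mem_triangle hs ht with ⟨h, hmem⟩ | ⟨h, hmem⟩ <;>
      rcases le_or_le_mem_triangle hs ht' with ⟨h', hmem'⟩ | ⟨h', hmem'⟩
    · simpa [Prod.norm_def] using lip1 _ hmem _ hmem'
    · obtain rfl : s = t := le_antisymm (h'.trans htt) h
      obtain rfl : t' = s := le_antisymm htt h'
      simp
    · have e1 := lip2 _ hmem _ (diagE s hs)
      have e2 := lip1 _ (diagD s hs) _ hmem'
      simp only [Prod.norm_def, Prod.fst_sub, Prod.snd_sub, sub_self, norm_zero,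
        Real.norm_eq_abs, abs_nonneg, sup_of_le_right] at e1 e2
      rw [abs_of_nonneg (by linarith : 0 ≤ t - s)] at e1
      rw [abs_of_nonneg (by linarith : 0 ≤ s - t')] at e2
      rw [abs_of_nonneg (by linarith : 0 ≤ t - t')]
      have := abs_sub_le (k s t) (k s s) (k s t')
      linarith
    · simpa [Prod.norm_def] using lip2 _ hmem _ hmem'
  refine ⟨L, ⟨hL0, ?_, ?_, ?_, ?_, ?_, ?_, ?_⟩⟩
  · intro s hs t ht
    rcases le_or_le_mem_triangle hs ht with ⟨-, hmem⟩ | ⟨-, hmem⟩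
    · rw [hkD _ _ hmem]; exact h1.bound _ hmem
    · rw [hkE _ _ hmem]; exact h2.bound _ hmem
  · intro s hs s' hs' t ht
    rcases le_total s' s with h | h
    · exact lipfst s hs s' hs' t ht h
    · rw [abs_sub_comm, abs_sub_comm s]
      exact lipfst s' hs' s hs t ht h
  · intro s hs t ht t' ht'
    rcases le_total t' t with h | h
    · exact lipsnd s hs t ht t' ht' h
    · rw [abs_sub_comm, abs_sub_comm t]
      exact lipsnd s hs t' ht' t ht h
  · intro a b c d ha hb hc hd hor s hs s' hs' t ht t' ht'
    rcases hor with h | h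
    · have hsub := rect_subset_upperTriangle ha hd h
      rw [hkE _ _ (hsub ⟨hs, ht⟩), hkE _ _ (hsub ⟨hs', ht⟩), hkE _ _ (hsub ⟨hs, ht'⟩),
        hkE _ _ (hsub ⟨hs', ht'⟩)]
      exact h2.mixed (convex_Icc c d) hsub hs hs' ht ht'
    · have hsub := rect_subset_lowerTriangle hc hb h
      rw [hkD _ _ (hsub ⟨hs, ht⟩), hkD _ _ (hsub ⟨hs', ht⟩), hkD _ _ (hsub ⟨hs, ht'⟩),
        hkD _ _ (hsub ⟨hs', ht'⟩)]
      exact h1.mixed (convex_Icc c d) hsub hs hs' ht ht'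
  · intro m τ c d hτ ha hb hc hd hor t ht
    have i1 : m + τ ∈ Icc (m - τ) (m + τ) := ⟨by linarith, le_rfl⟩
    have i2 : m - τ ∈ Icc (m - τ) (m + τ) := ⟨le_rfl, by linarith⟩
    have i3 : m ∈ Icc (m - τ) (m + τ) := ⟨by linarith, by linarith⟩
    rcases hor with h | h
    · have hsub := rect_subset_upperTriangle ha hd h
      rw [hkE _ _ (hsub ⟨i1, ht⟩), hkE _ _ (hsub ⟨i2, ht⟩), hkE _ _ (hsub ⟨i3, ht⟩)]
      exact h2.second hτ hsub ht
    · have hsub := rect_subset_lowerTriangle hc hb h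
      rw [hkD _ _ (hsub ⟨i1, ht⟩), hkD _ _ (hsub ⟨i2, ht⟩), hkD _ _ (hsub ⟨i3, ht⟩)]
      exact h1.second hτ hsub ht
  · intro m τ c d hτ ha hb hc hd hor t ht t' ht'
    have i1 : m + τ ∈ Icc (m - τ) (m + τ) := ⟨by linarith, le_rfl⟩
    have i2 : m - τ ∈ Icc (m - τ) (m + τ) := ⟨le_rfl, by linarith⟩
    have i3 : m ∈ Icc (m - τ) (m + τ) := ⟨by linarith, by linarith⟩
    rcases hor with h | h
    · have hsub := rect_subset_upperTriangle ha hd h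
      rw [hkE _ _ (hsub ⟨i1, ht⟩), hkE _ _ (hsub ⟨i2, ht⟩), hkE _ _ (hsub ⟨i3, ht⟩),
        hkE _ _ (hsub ⟨i1, ht'⟩), hkE _ _ (hsub ⟨i2, ht'⟩), hkE _ _ (hsub ⟨i3, ht'⟩)]
      exact h2.second_mixed hτ (convex_Icc c d) hsub ht ht'
    · have hsub := rect_subset_lowerTriangle hc hb h
      rw [hkD _ _ (hsub ⟨i1, ht⟩), hkD _ _ (hsub ⟨i2, ht⟩), hkD _ _ (hsub ⟨i3, ht⟩),
        hkD _ _ (hsub ⟨i1, ht'⟩), hkD _ _ (hsub ⟨i2, ht'⟩), hkD _ _ (hsub ⟨i3, ht'⟩)]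
      exact h1.second_mixed hτ (convex_Icc c d) hsub ht ht'
  · intro x hx
    -- Both pieces agree along the diagonal, hence so do their tangential derivatives there.
    have hdiag : D 1 0 x x + D 0 1 x x = E 1 0 x x + E 0 1 x x := by
      have d1 := hD.deriv_diag convex_lowerTriangle isClosed_lowerTriangle
        interior_lowerTriangle_nonempty (j := 0) (k := 0) (by omega) (by omega) (diagD x hx) diagD
      have d2 := hE.deriv_diag convex_upperTriangle isClosed_upperTriangle
        interior_upperTriangle_nonempty (j := 0) (k := 0) (by omega) (by omega) (diagE x hx) diagE
      refine (uniqueDiffOn_Icc one_pos x hx).eq_deriv _ d1 (d2.congr (fun y hy => ?_) ?_)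
      · rw [← hkD _ _ (diagD y hy), ← hkE _ _ (diagE y hy)]
      · rw [← hkD _ _ (diagD x hx), ← hkE _ _ (diagE x hx)]
    -- By `hdiag` the two gradients at `(x, x)` differ by a multiple of `(1, -1)`, that is, by a
    -- multiple of `s - t`; the multiple is the jump of the first partial derivative.
    refine ⟨k x x, E 1 0 x x, E 0 1 x x, D 1 0 x x - E 1 0 x x, fun s hs t ht h hsx htx => ?_⟩
    have hnorm : L * ‖((s, t) : ℝ × ℝ) - (x, x)‖ ^ 2 ≤ L * h ^ 2 := by
      gcongr
      simp [Prod.norm_def, hsx, htx]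
    rcases le_or_le_mem_triangle hs ht with ⟨h', hmem⟩ | ⟨h', hmem⟩
    · have := (h1.taylor (x, x) (diagD x hx) (s, t) hmem).trans hnorm
      rw [max_eq_left (by linarith), hkD _ _ hmem, hkD _ _ (diagD x hx)]
      refine le_trans (le_of_eq ?_) this
      congr 1
      linear_combination (t - x) * hdiag
    · have := (h2.taylor (x, x) (diagE x hx) (s, t) hmem).trans hnorm
      rw [max_eq_right (by linarith), hkE _ _ hmem, hkE _ _ (diagE x hx)]
      refine le_trans (le_of_eq ?_) this
      congr 1
      ring

end KernelBounds

/-! ### The Green's kernel as an instance of the preceding bounds -/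

section GreenKernel

variable {r : ℕ}

lemma GreenKernel.exists_partials (G : GreenKernel r) : ∃ D E : ℕ → ℕ → ℝ → ℝ → ℝ,
    PartialFamily (2 * r + 2) lowerTriangle D ∧ PartialFamily (2 * r + 2) upperTriangle E ∧
    (∀ s t, (s, t) ∈ lowerTriangle → G.kernel s t = D 0 0 s t) ∧
    (∀ s t, (s, t) ∈ upperTriangle → G.kernel s t = E 0 0 s t) := by
  obtain ⟨D, d1, d2, d3, d4⟩ := G.smooth₁
  obtain ⟨E, e1, e2, e3, e4⟩ := G.smooth₂
  refine ⟨D, E, ⟨d2, d3, d4⟩, ⟨e2, e3, e4⟩, fun s t h => ?_, fun s t h => ?_⟩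
  · rw [d1 s t h, GreenKernel.kernel, if_pos h.2.1]
  · rw [e1 s t h, GreenKernel.kernel]
    split_ifs with hts
    · obtain rfl : s = t := le_antisymm h.2.1 hts
      exact G.diag s ⟨h.1, h.2.2⟩
    · rfl

lemma GreenKernel.exists_kernelBounds (G : GreenKernel r) : ∃ L, KernelBounds G.kernel L := by
  obtain ⟨D, E, hD, hE, hkD, hkE⟩ := G.exists_partials
  exact _root_.exists_kernelBounds (by omega) hD hE hkD hkE

end GreenKernel

/-! ### The Leibniz rule for integrals with a variable endpoint -/

section Volterra

variable {φ φ' : ℝ → ℝ → ℂ}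

lemma contDiffOn_succ_of_hasDerivWithinAt {n : ℕ} {f f' : ℝ → ℂ}
    (hf : ∀ x ∈ Icc (0 : ℝ) 1, HasDerivWithinAt f (f' x) (Icc 0 1) x)
    (hf' : ContDiffOn ℝ n f' (Icc 0 1)) : ContDiffOn ℝ (n + 1 : ℕ) f (Icc 0 1) := by
  have hu : UniqueDiffOn ℝ (Icc (0 : ℝ) 1) := uniqueDiffOn_Icc one_pos
  rw [Nat.cast_add, Nat.cast_one, contDiffOn_succ_iff_derivWithin hu]
  refine ⟨fun x hx => (hf x hx).differentiableWithinAt, by simp, ?_⟩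
  exact hf'.congr fun x hx => (hf x hx).derivWithin (hu x hx)

/-- A continuous retraction of the plane onto the closed lower triangle. -/
noncomputable def lowerRetraction (p : ℝ × ℝ) : ℝ × ℝ :=
  (max (max 0 (min p.2 1)) (min p.1 1), max 0 (min p.2 1))

lemma continuous_lowerRetraction : Continuous lowerRetraction := by
  unfold lowerRetraction; fun_prop

lemma lowerRetraction_mem (p : ℝ × ℝ) : lowerRetraction p ∈ lowerTriangle :=
  ⟨le_max_left _ _, le_max_left _ _, max_le (max_le zero_le_one (min_le_right _ _))
    (min_le_right _ _)⟩

lemma lowerRetraction_of_mem {p : ℝ × ℝ} (hp : p ∈ lowerTriangle) : lowerRetraction p = p := by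
  obtain ⟨h1, h2, h3⟩ := hp
  ext <;> simp [lowerRetraction, h1, h2, h3, h2.trans h3]

/-- Composition with the retraction extends the integrand continuously to the plane without changing
it on the triangle. -/
lemma continuousOn_volterra (hφ : ContinuousOn (fun p : ℝ × ℝ => φ p.1 p.2) lowerTriangle) :
    ContinuousOn (fun s => ∫ t in (0 : ℝ)..s, φ s t) (Icc 0 1) := by
  have h1 : Continuous (fun p : ℝ × ℝ => φ (lowerRetraction p).1 (lowerRetraction p).2) :=
    hφ.comp_continuous continuous_lowerRetraction lowerRetraction_mem
  have h2 := intervalIntegral.continuous_parametric_intervalIntegral_of_continuous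
    (μ := volume) (f := fun s t => φ (lowerRetraction (s, t)).1 (lowerRetraction (s, t)).2)
    (a₀ := 0) (s := id) h1 continuous_id
  refine h2.continuousOn.congr fun s hs => intervalIntegral.integral_congr fun t ht => ?_
  rw [uIcc_of_le hs.1] at ht
  simp only [lowerRetraction_of_mem (show (s, t) ∈ lowerTriangle from ⟨ht.1, ht.2, hs.2⟩)]

/-- The integrand is defined only on the triangle, so difference quotients are avoided: writing `φ x
t - φ t t` as an integral of `φ'` and exchanging the order gives `∫₀ˣ φ x t dt = ∫₀ˣ φ t t dt + ∫₀ˣ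
∫₀ʸ φ' y t dt dy`, to which the fundamental theorem of calculus applies. -/
lemma hasDerivWithinAt_volterra (hφ : ContinuousOn (fun p : ℝ × ℝ => φ p.1 p.2) lowerTriangle)
    (hφ' : ContinuousOn (fun p : ℝ × ℝ => φ' p.1 p.2) lowerTriangle)
    (hd : ∀ s t, (s, t) ∈ lowerTriangle →
      HasDerivWithinAt (fun x => φ x t) (φ' s t) (Icc t 1) s) {s : ℝ} (hs : s ∈ Icc (0 : ℝ) 1) :
    HasDerivWithinAt (fun s => ∫ t in (0 : ℝ)..s, φ s t) (φ s s + ∫ t in (0 : ℝ)..s, φ' s t)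
      (Icc 0 1) s := by
  set K : ℝ × ℝ → ℂ := lowerTriangle.indicator fun p => φ' p.1 p.2 with hK
  have hKint : Integrable K :=
    (hφ'.integrableOn_compact isCompact_lowerTriangle).integrable_indicator
      isClosed_lowerTriangle.measurableSet
  have hdiag : ContinuousOn (fun t => φ t t) (Icc 0 1) :=
    hφ.comp (f := fun t : ℝ => (t, t)) (by fun_prop) fun t ht => ⟨ht.1, le_rfl, ht.2⟩
  have hsec : ∀ x ∈ Icc (0 : ℝ) 1, ContinuousOn (φ x) (Icc 0 x) := fun x hx =>
    hφ.comp (f := fun t : ℝ => (x, t)) (by fun_prop) fun t ht => ⟨ht.1, ht.2, hx.2⟩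
  have hvert : ∀ t ∈ Icc (0 : ℝ) 1, ContinuousOn (fun x => φ' x t) (Icc t 1) := fun t ht =>
    hφ'.comp (f := fun x : ℝ => (x, t)) (by fun_prop) fun x hx => ⟨ht.1, hx.1, hx.2⟩
  have hinner : ∀ x ∈ Icc (0 : ℝ) 1, (∫ t in (0 : ℝ)..1, K (x, t)) = ∫ t in (0 : ℝ)..x, φ' x t := by
    intro x hx
    rw [← intervalIntegral.integral_indicator hx]
    refine intervalIntegral.integral_congr fun t ht => ?_
    rw [uIcc_of_le zero_le_one] at ht
    by_cases htx : t ≤ x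
    · have : (x, t) ∈ lowerTriangle := ⟨ht.1, htx, hx.2⟩
      simp [hK, this, htx]
    · have : (x, t) ∉ lowerTriangle := fun h => htx h.2.1
      simp [hK, this, htx]
  have houter : ∀ x ∈ Icc (0 : ℝ) 1, ∀ t ∈ Icc (0 : ℝ) 1, (∫ y in (0 : ℝ)..x, K (y, t)) =
      indicator {t | t ≤ x} (fun t => φ x t - φ t t) t := by
    intro x hx t ht
    by_cases htx : t ≤ x
    · have hz : EqOn (fun y => K (y, t)) 0 (Ico 0 t) := fun y hy => by
        have : (y, t) ∉ lowerTriangle := fun h => (h.2.1.trans_lt hy.2).false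
        simp [hK, this]
      have hnz : EqOn (fun y => K (y, t)) (fun y => φ' y t) (Icc t x) := fun y hy => by
        have : (y, t) ∈ lowerTriangle := ⟨ht.1, hy.1, hy.2.trans hx.2⟩
        simp [hK, this]
      have hci : ContinuousOn (fun y => φ' y t) (Icc t x) :=
        (hvert t ht).mono (Icc_subset_Icc_right hx.2)
      have h1 : (∫ y in (0 : ℝ)..t, K (y, t)) = 0 := by
        rw [intervalIntegral.integral_of_le ht.1, ← integral_Ico_eq_integral_Ioc,
          setIntegral_congr_fun measurableSet_Ico hz]
        simp
      have h2 : (∫ y in t..x, K (y, t)) = φ x t - φ t t := by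
        rw [intervalIntegral.integral_congr (g := fun y => φ' y t) (by rwa [uIcc_of_le htx])]
        refine intervalIntegral.integral_eq_sub_of_hasDerivAt_of_le (f := fun y => φ y t) htx (fun y hy => ?_)
          (fun y hy => ?_) (hci.intervalIntegrable_of_Icc htx)
        · exact ((hd y t ⟨ht.1, hy.1, hy.2.trans hx.2⟩).continuousWithinAt).mono
            (Icc_subset_Icc_right hx.2)
        · exact (hd y t ⟨ht.1, hy.1.le, hy.2.le.trans hx.2⟩).hasDerivAt
            (Icc_mem_nhds hy.1 (hy.2.trans_le hx.2))
      rw [← intervalIntegral.integral_add_adjacent_intervals (b := t), h1, h2]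
      · simp [htx]
      · rw [intervalIntegrable_iff_integrableOn_Ico_of_le ht.1]
        exact integrableOn_zero.congr_fun (fun y hy => (hz hy).symm) measurableSet_Ico
      · rw [intervalIntegrable_iff_integrableOn_Icc_of_le htx]
        exact hci.integrableOn_Icc.congr_fun (fun y hy => (hnz hy).symm) measurableSet_Icc
    · rw [indicator_of_notMem (by simpa using htx)]
      refine (intervalIntegral.integral_congr (g := fun _ => 0) fun y hy => ?_).trans (by simp)
      rw [uIcc_of_le hx.1] at hy
      have : (y, t) ∉ lowerTriangle := fun h => htx (h.2.1.trans hy.2)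
      simp [hK, this]
  have hmain : ∀ x ∈ Icc (0 : ℝ) 1, (∫ t in (0 : ℝ)..x, φ x t) =
      (∫ t in (0 : ℝ)..x, φ t t) + ∫ y in (0 : ℝ)..x, ∫ t in (0 : ℝ)..y, φ' y t := by
    intro x hx
    have hsub : Icc 0 x ⊆ Icc (0 : ℝ) 1 := Icc_subset_Icc_right hx.2
    have hswap := MeasureTheory.intervalIntegral_intervalIntegral_swap (a := 0) (b := x) (c := 0)
      (d := 1) (F := fun y t => K (y, t)) hKint.integrableOn
    rw [intervalIntegral.integral_congr (g := fun y => ∫ t in (0 : ℝ)..y, φ' y t)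
      (fun y hy => hinner y (hsub (by rwa [uIcc_of_le hx.1] at hy))),
      intervalIntegral.integral_congr (fun t ht => houter x hx t
        (by rwa [uIcc_of_le zero_le_one] at ht)), intervalIntegral.integral_indicator hx,
      intervalIntegral.integral_sub] at hswap
    · rw [hswap]; ring
    · exact (hsec x hx).intervalIntegrable_of_Icc hx.1
    · exact (hdiag.mono hsub).intervalIntegrable_of_Icc hx.1
  have hprim : ∀ g : ℝ → ℂ, ContinuousOn g (Icc 0 1) →
      HasDerivWithinAt (fun x => ∫ t in (0 : ℝ)..x, g t) (g s) (Icc 0 1) s := by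
    intro g hg
    have : Fact (s ∈ Icc (0 : ℝ) 1) := ⟨hs⟩
    exact intervalIntegral.integral_hasDerivWithinAt_right
      ((hg.mono (Icc_subset_Icc_right hs.2)).intervalIntegrable_of_Icc hs.1)
      (hg.stronglyMeasurableAtFilter_nhdsWithin measurableSet_Icc s) (hg s hs)
  exact ((hprim _ hdiag).add (hprim _ (continuousOn_volterra hφ'))).congr hmain (hmain s hs)

lemma reflect_mem_upperTriangle {p : ℝ × ℝ} (hp : p ∈ lowerTriangle) :
    ((1 - p.1, 1 - p.2) : ℝ × ℝ) ∈ upperTriangle := by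
  obtain ⟨h1, h2, h3⟩ := hp
  exact ⟨by simp only; linarith, by simp only; linarith, by simp only; linarith⟩

lemma ContinuousOn.reflect_triangle
    (hφ : ContinuousOn (fun p : ℝ × ℝ => φ p.1 p.2) upperTriangle) :
    ContinuousOn (fun p : ℝ × ℝ => φ (1 - p.1) (1 - p.2)) lowerTriangle :=
  hφ.comp (f := fun p : ℝ × ℝ => (1 - p.1, 1 - p.2)) (by fun_prop)
    fun _ hp => reflect_mem_upperTriangle hp

/-- The form `1 - (1 - s)` exhibits the right side as a function of `1 - s`, so that results on the
lower triangle transfer by composition with the reflection. -/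
lemma integral_upper_eq (φ : ℝ → ℝ → ℂ) (s : ℝ) :
    (∫ t in s..1, φ s t) = ∫ t in (0 : ℝ)..(1 - s), φ (1 - (1 - s)) (1 - t) := by
  rw [intervalIntegral.integral_comp_sub_left (fun t => φ (1 - (1 - s)) t)]
  simp

lemma continuousOn_volterra_upper
    (hφ : ContinuousOn (fun p : ℝ × ℝ => φ p.1 p.2) upperTriangle) :
    ContinuousOn (fun s => ∫ t in s..1, φ s t) (Icc 0 1) := by
  simp_rw [integral_upper_eq]
  exact (continuousOn_volterra (φ := fun s t => φ (1 - s) (1 - t)) hφ.reflect_triangle).comp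
    (s := Icc 0 1) (f := fun s : ℝ => 1 - s) (by fun_prop) fun s hs => ⟨by linarith [hs.2], by linarith [hs.1]⟩

lemma hasDerivWithinAt_volterra_upper
    (hφ : ContinuousOn (fun p : ℝ × ℝ => φ p.1 p.2) upperTriangle)
    (hφ' : ContinuousOn (fun p : ℝ × ℝ => φ' p.1 p.2) upperTriangle)
    (hd : ∀ s t, (s, t) ∈ upperTriangle →
      HasDerivWithinAt (fun x => φ x t) (φ' s t) (Icc 0 t) s) {s : ℝ} (hs : s ∈ Icc (0 : ℝ) 1) :
    HasDerivWithinAt (fun s => ∫ t in s..1, φ s t) (-φ s s + ∫ t in s..1, φ' s t)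
      (Icc 0 1) s := by
  have hrefl : MapsTo (fun s : ℝ => 1 - s) (Icc 0 1) (Icc 0 1) :=
    fun s hs => ⟨by linarith [hs.2], by linarith [hs.1]⟩
  have h1 := hasDerivWithinAt_volterra (φ := fun s t => φ (1 - s) (1 - t))
    (φ' := fun s t => -φ' (1 - s) (1 - t)) hφ.reflect_triangle hφ'.reflect_triangle.neg
    (fun s t hst => ?_) (hrefl hs)
  · have h2 := h1.scomp s (h := fun s : ℝ => 1 - s) ((hasDerivWithinAt_id s _).const_sub 1) hrefl
    simp_rw [integral_upper_eq]
    refine h2.congr_deriv ?_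
    simp only [intervalIntegral.integral_neg, neg_smul, one_smul, neg_add, neg_neg, sub_sub_cancel]
  · have h3 := (hd _ _ (reflect_mem_upperTriangle hst)).scomp s (h := fun s : ℝ => 1 - s)
      ((hasDerivWithinAt_id s (Icc t 1)).const_sub 1)
      fun x hx => ⟨by linarith [hx.2], by linarith [hx.1]⟩
    refine h3.congr_deriv ?_
    simp

end Volterra

/-! ### Smoothness of eigenfunctions -/

section Regularity

variable {m : ℕ} {Ω : Set (ℝ × ℝ)} {D E : ℕ → ℕ → ℝ → ℝ → ℝ} {u : ℝ → ℂ}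

lemma PartialFamily.contDiffOn_diag (hD : PartialFamily m Ω D) (hcv : Convex ℝ Ω)
    (hcl : IsClosed Ω) (hne : (interior Ω).Nonempty) (hdiag : ∀ x ∈ Icc (0 : ℝ) 1, (x, x) ∈ Ω)
    (q : ℕ) : ∀ {j k : ℕ}, j + q ≤ m → k + q ≤ m →
    ContDiffOn ℝ q (fun s => (D j k s s : ℂ)) (Icc 0 1) := by
  induction q with
  | zero =>
    intro j k hj hk
    rw [Nat.cast_zero, contDiffOn_zero]
    exact Complex.continuous_ofReal.comp_continuousOn
      ((hD.cont j k hj hk).comp (f := fun s : ℝ => (s, s)) (by fun_prop) hdiag)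
  | succ q ih =>
    intro j k hj hk
    refine contDiffOn_succ_of_hasDerivWithinAt
      (f' := fun s => (D (j + 1) k s s : ℂ) + (D j (k + 1) s s : ℂ)) (fun x hx => ?_)
      ((ih (by omega) (by omega)).add (ih (by omega) (by omega)))
    exact_mod_cast (hD.deriv_diag hcv hcl hne (j := j) (k := k) (by omega) (by omega)
      (hdiag x hx) hdiag).ofReal_comp

/-- Differentiation produces the jump across the diagonal times `u`, plus an integral of the same
shape with `j + 1`. The boundary term costs no derivative of `u`, so the integral is one order
smoother than `u`. -/
lemma contDiffOn_green_integral (hD : PartialFamily m lowerTriangle D)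
    (hE : PartialFamily m upperTriangle E) (q : ℕ) :
    ∀ {j p : ℕ}, j + q ≤ m → q ≤ p + 1 → ContDiffOn ℝ p u (Icc 0 1) →
    ContDiffOn ℝ q (fun s => (∫ t in (0 : ℝ)..s, (D j 0 s t : ℂ) * u t) +
      ∫ t in s..1, (E j 0 s t : ℂ) * u t) (Icc 0 1) := by
  have hcD : ∀ {j : ℕ}, j ≤ m → ContinuousOn u (Icc 0 1) →
      ContinuousOn (fun p : ℝ × ℝ => (D j 0 p.1 p.2 : ℂ) * u p.2) lowerTriangle :=
    fun {j} hj hu => (Complex.continuous_ofReal.comp_continuousOn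
      (hD.cont j 0 hj (Nat.zero_le _))).mul (hu.comp continuousOn_snd
        fun p hp => ⟨hp.1, hp.2.1.trans hp.2.2⟩)
  have hcE : ∀ {j : ℕ}, j ≤ m → ContinuousOn u (Icc 0 1) →
      ContinuousOn (fun p : ℝ × ℝ => (E j 0 p.1 p.2 : ℂ) * u p.2) upperTriangle :=
    fun {j} hj hu => (Complex.continuous_ofReal.comp_continuousOn
      (hE.cont j 0 hj (Nat.zero_le _))).mul (hu.comp continuousOn_snd
        fun p hp => ⟨hp.1.trans hp.2.1, hp.2.2⟩)
  induction q with
  | zero =>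
    intro j p hj _ hu
    rw [Nat.cast_zero, contDiffOn_zero]
    exact (continuousOn_volterra (hcD hj hu.continuousOn)).add
      (continuousOn_volterra_upper (hcE hj hu.continuousOn))
  | succ q ih =>
    intro j p hj hq hu
    have huc := hu.continuousOn
    refine contDiffOn_succ_of_hasDerivWithinAt
      (f' := fun s => ((D j 0 s s : ℂ) - (E j 0 s s : ℂ)) * u s +
        ((∫ t in (0 : ℝ)..s, (D (j + 1) 0 s t : ℂ) * u t) +
          ∫ t in s..1, (E (j + 1) 0 s t : ℂ) * u t)) (fun s hs => ?_) ?_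
    · have h1 := hasDerivWithinAt_volterra (φ := fun s t => (D j 0 s t : ℂ) * u t)
        (φ' := fun s t => (D (j + 1) 0 s t : ℂ) * u t) (hcD (by omega) huc) (hcD (by omega) huc)
        (fun s t hst => (hD.deriv_fst_section convex_lowerTriangle isClosed_lowerTriangle
          interior_lowerTriangle_nonempty (by omega) (by omega) hst
          fun x hx => ⟨hst.1, hx.1, hx.2⟩).ofReal_comp.mul_const _) hs
      have h2 := hasDerivWithinAt_volterra_upper (φ := fun s t => (E j 0 s t : ℂ) * u t)
        (φ' := fun s t => (E (j + 1) 0 s t : ℂ) * u t) (hcE (by omega) huc) (hcE (by omega) huc)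
        (fun s t hst => (hE.deriv_fst_section convex_upperTriangle isClosed_upperTriangle
          interior_upperTriangle_nonempty (by omega) (by omega) hst
          fun x hx => ⟨hx.1, hx.2, hst.2.2⟩).ofReal_comp.mul_const _) hs
      refine (h1.add h2).congr_deriv ?_
      ring
    · refine ContDiffOn.add (ContDiffOn.mul (ContDiffOn.sub ?_ ?_) ?_)
        (ih (p := p) (by omega) (by omega) hu)
      · exact hD.contDiffOn_diag convex_lowerTriangle isClosed_lowerTriangle
          interior_lowerTriangle_nonempty (fun s hs => ⟨hs.1, le_rfl, hs.2⟩) q (by omega) (by omega)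
      · exact hE.contDiffOn_diag convex_upperTriangle isClosed_upperTriangle
          interior_upperTriangle_nonempty (fun s hs => ⟨hs.1, le_rfl, hs.2⟩) q (by omega) (by omega)
      · exact hu.of_le (by exact_mod_cast (by omega : q ≤ p))

/-- A continuous eigenfunction of the integral operator with a Green's kernel is smooth. -/
lemma contDiffOn_of_green_eigen {k : ℝ → ℝ → ℝ} (hD : PartialFamily m lowerTriangle D)
    (hE : PartialFamily m upperTriangle E)
    (hkD : ∀ s t, (s, t) ∈ lowerTriangle → k s t = D 0 0 s t)
    (hkE : ∀ s t, (s, t) ∈ upperTriangle → k s t = E 0 0 s t)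
    (hk : ContinuousOn (fun p : ℝ × ℝ => k p.1 p.2) (Icc 0 1 ×ˢ Icc 0 1))
    {ν : ℂ} (hu : ContinuousOn u (Icc 0 1))
    (heig : ∀ s ∈ Icc (0 : ℝ) 1, u s = ν * ∫ t in Icc (0 : ℝ) 1, (k s t : ℂ) * u t) :
    ContDiffOn ℝ m u (Icc 0 1) := by
  have hsplit : ∀ s ∈ Icc (0 : ℝ) 1, u s = ν * ((∫ t in (0 : ℝ)..s, (D 0 0 s t : ℂ) * u t) +
      ∫ t in s..1, (E 0 0 s t : ℂ) * u t) := by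
    intro s hs
    have hc : ContinuousOn (fun t => (k s t : ℂ) * u t) (Icc 0 1) :=
      (kernel_section_continuousOn hk hs).mul hu
    rw [heig s hs, integral_Icc_eq_integral_Ioc, ← intervalIntegral.integral_of_le zero_le_one,
      ← intervalIntegral.integral_add_adjacent_intervals (b := s)]
    · congr 2
      · refine intervalIntegral.integral_congr fun t ht => ?_
        rw [uIcc_of_le hs.1] at ht
        simp only [hkD s t ⟨ht.1, ht.2, hs.2⟩]
      · refine intervalIntegral.integral_congr fun t ht => ?_
        rw [uIcc_of_le hs.2] at ht
        simp only [hkE s t ⟨hs.1, ht.1, ht.2⟩]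
    · exact (hc.mono (Icc_subset_Icc_right hs.2)).intervalIntegrable_of_Icc hs.1
    · exact (hc.mono (Icc_subset_Icc_left hs.1)).intervalIntegrable_of_Icc hs.2
  -- Bootstrap: each use of the eigenvalue equation gains one derivative, up to the smoothness of
  -- the kernel.
  have key : ∀ q : ℕ, q ≤ m → ContDiffOn ℝ q u (Icc 0 1) := by
    intro q
    induction q with
    | zero => exact fun _ => by rwa [Nat.cast_zero, contDiffOn_zero]
    | succ q ih =>
      intro hq
      exact (contDiffOn_const.mul (contDiffOn_green_integral hD hE (q + 1) (j := 0) (p := q)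
        (by omega) le_rfl (ih (by omega)))).congr hsplit
  exact key m le_rfl

end Regularity

/-! ### Lagrange interpolation on a cell and the leading term of its error -/

section Interpolation

variable {r n j : ℕ}

/-- The `j`-th closed cell of the uniform partition of `[0,1]` into `n` cells. -/
def cell (n j : ℕ) : Set ℝ := Icc ((j : ℝ) / n) (((j : ℝ) + 1) / n)

lemma cell_subset (hj : j < n) : cell n j ⊆ Icc 0 1 := by
  have hn : (0 : ℝ) < n := by exact_mod_cast (Nat.zero_le j).trans_lt hj
  refine Icc_subset_Icc (by positivity) ?_
  rw [div_le_one hn]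
  exact_mod_cast hj

lemma abs_sub_le_of_mem_cell {x y : ℝ} (hx : x ∈ cell n j) (hy : y ∈ cell n j) :
    |x - y| ≤ 1 / n := by
  have : ((j : ℝ) + 1) / n = (j : ℝ) / n + 1 / n := add_div _ _ _
  rw [abs_le]
  constructor <;> linarith [hx.1, hx.2, hy.1, hy.2]

lemma node_mem_cell (hn : 0 < n) {i : ℕ} (hi : i ∈ Finset.range (2 * r + 1)) :
    node r n j i ∈ cell n j := by
  have hn' : (0 : ℝ) < n := by exact_mod_cast hn
  rw [Finset.mem_range] at hi
  unfold node cell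
  split_ifs with h
  · constructor <;> gcongr <;> linarith
  · have hr : (0 : ℝ) < 2 * r := by have := Nat.pos_of_ne_zero h; positivity
    have hi' : (i : ℝ) / (2 * r) ≤ 1 := by
      rw [div_le_one hr]; exact_mod_cast (by omega : i ≤ 2 * r)
    constructor <;> gcongr
    have : (0 : ℝ) ≤ (i : ℝ) / (2 * r) := by positivity
    linarith

lemma inv_le_abs_node_sub_node (hn : 0 < n) {i k : ℕ} (hi : i ∈ Finset.range (2 * r + 1))
    (hk : k ∈ Finset.range (2 * r + 1)) (hik : i ≠ k) :
    1 / n ≤ 2 * r * |node r n j i - node r n j k| := by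
  have hn' : (0 : ℝ) < n := by exact_mod_cast hn
  rw [Finset.mem_range] at hi hk
  have hr : r ≠ 0 := by omega
  have hr' : (0 : ℝ) < 2 * r := by have := Nat.pos_of_ne_zero hr; positivity
  have h1 : node r n j i - node r n j k = ((i : ℝ) - k) / (2 * r * n) := by
    simp only [node, hr, if_false]; field_simp; ring
  have h2 : (1 : ℝ) ≤ |(i : ℝ) - k| := by
    have : (1 : ℤ) ≤ |(i : ℤ) - k| := Int.one_le_abs (sub_ne_zero.2 (by exact_mod_cast hik))
    exact_mod_cast this
  rw [h1, abs_div, abs_of_pos (by positivity : (0 : ℝ) < 2 * r * n)]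
  calc (1 : ℝ) / n ≤ |(i : ℝ) - k| / n := by gcongr
    _ = _ := by field_simp

lemma node_injOn (hn : 0 < n) : InjOn (node r n j) (Finset.range (2 * r + 1)) := by
  intro i hi k hk h
  by_contra hik
  have h1 := inv_le_abs_node_sub_node (j := j) hn hi hk hik
  have hn' : (0 : ℝ) < n := by exact_mod_cast hn
  rw [h, sub_self, abs_zero, mul_zero] at h1
  exact (h1.trans_lt (by positivity)).false

lemma node_reflect {i : ℕ} (hi : i ∈ Finset.range (2 * r + 1)) :
    node r n j (2 * r + 1 - 1 - i) = (j : ℝ) / n + ((j : ℝ) + 1) / n - node r n j i := by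
  rw [Finset.mem_range] at hi
  unfold node
  split_ifs with h
  · ring
  · have hr : (r : ℝ) ≠ 0 := by exact_mod_cast h
    rw [Nat.add_sub_cancel, Nat.cast_sub (by omega)]
    push_cast
    rw [← add_div, ← sub_div]
    congr 1
    field_simp
    ring

/-- The Lagrange basis polynomials of a cell. -/
noncomputable def cellBasis (r n j i : ℕ) (t : ℝ) : ℝ :=
  (Lagrange.basis (Finset.range (2 * r + 1)) (node r n j) i).eval t

/-- The nodal polynomial of a cell. -/
noncomputable def cellNodal (r n j : ℕ) (t : ℝ) : ℝ :=
  ∏ i ∈ Finset.range (2 * r + 1), (t - node r n j i)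

/-- The interpolation polynomial on a cell. -/
noncomputable def cellInterp (r n j : ℕ) (f : ℝ → ℂ) (t : ℝ) : ℂ :=
  ∑ i ∈ Finset.range (2 * r + 1), f (node r n j i) * (cellBasis r n j i t : ℂ)

/-- A bound for the Lagrange basis polynomials on their cell. -/
noncomputable def basisBound (r : ℕ) : ℝ := (2 * r) ^ (2 * r)

lemma basisBound_nonneg (r : ℕ) : 0 ≤ basisBound r := by unfold basisBound; positivity

/-- Each of the `2 * r` factors is a distance of at most `1 / n` over one of at least `1 / (2 * r *
n)`. For `r = 0` the product is empty and the bound is `0 ^ 0 = 1`. -/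
lemma abs_cellBasis_le (hn : 0 < n) {i : ℕ} (hi : i ∈ Finset.range (2 * r + 1)) {t : ℝ}
    (ht : t ∈ cell n j) : |cellBasis r n j i t| ≤ basisBound r := by
  have hn' : (0 : ℝ) < n := by exact_mod_cast hn
  have hcard : ((Finset.range (2 * r + 1)).erase i).card = 2 * r := by
    rw [Finset.card_erase_of_mem hi, Finset.card_range, Nat.add_sub_cancel]
  rw [cellBasis, Lagrange.basis, Polynomial.eval_prod, Finset.abs_prod, basisBound]
  refine (Finset.prod_le_prod (g := fun _ => 2 * (r : ℝ)) (fun _ _ => abs_nonneg _)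
    fun k hk => ?_).trans_eq (by rw [Finset.prod_const, hcard])
  obtain ⟨hki, hk⟩ := Finset.mem_erase.1 hk
  have h1 := inv_le_abs_node_sub_node (j := j) hn hi hk hki.symm
  have h2 := abs_sub_le_of_mem_cell ht (node_mem_cell hn hk)
  have hpos : 0 < |node r n j i - node r n j k| :=
    abs_pos.2 (sub_ne_zero.2 fun h => hki (node_injOn hn hi hk h).symm)
  simp only [Lagrange.basisDivisor, Polynomial.eval_mul, Polynomial.eval_C, Polynomial.eval_sub,
    Polynomial.eval_X, abs_mul, abs_inv]
  rw [inv_mul_le_iff₀ hpos]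
  linarith

lemma sum_cellBasis (hn : 0 < n) (t : ℝ) :
    ∑ i ∈ Finset.range (2 * r + 1), cellBasis r n j i t = 1 := by
  have := congrArg (Polynomial.eval t)
    (Lagrange.sum_basis (s := Finset.range (2 * r + 1)) (v := node r n j) (node_injOn hn) (by simp))
  simpa [Polynomial.eval_finsetSum, cellBasis] using this

lemma sum_eval_cellBasis (hn : 0 < n) {p : Polynomial ℝ} (hp : p.degree < (2 * r + 1 : ℕ))
    (t : ℝ) :
    ∑ i ∈ Finset.range (2 * r + 1), p.eval (node r n j i) * cellBasis r n j i t = p.eval t := by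
  have := congrArg (Polynomial.eval t) (Lagrange.eq_interpolate (s := Finset.range (2 * r + 1))
    (v := node r n j) (f := p) (node_injOn hn) (by simpa using hp))
  rw [Lagrange.interpolate_apply] at this
  simpa [Polynomial.eval_finsetSum, cellBasis] using this.symm

lemma sum_pow_cellBasis (hn : 0 < n) (a t : ℝ) {k : ℕ} (hk : k < 2 * r + 1) :
    ∑ i ∈ Finset.range (2 * r + 1), (node r n j i - a) ^ k * cellBasis r n j i t = (t - a) ^ k := by
  have := sum_eval_cellBasis (j := j) hn (p := (Polynomial.X - Polynomial.C a) ^ k) (r := r) ?_ t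
  · simpa using this
  · rw [Polynomial.degree_pow, Polynomial.degree_X_sub_C]
    simpa using (by exact_mod_cast hk : (k : WithBot ℕ) < ((2 * r + 1 : ℕ) : WithBot ℕ))

/-- Subtracting the nodal polynomial, monic of the same degree, changes no value at the nodes and
leaves a polynomial of degree at most `2 * r`, which interpolation reproduces. -/
lemma sum_pow_cellBasis_top (hn : 0 < n) (a t : ℝ) :
    ∑ i ∈ Finset.range (2 * r + 1), (node r n j i - a) ^ (2 * r + 1) * cellBasis r n j i t =
      (t - a) ^ (2 * r + 1) - cellNodal r n j t := by
  set s := Finset.range (2 * r + 1)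
  set p : Polynomial ℝ := (Polynomial.X - Polynomial.C a) ^ (2 * r + 1)
  have hp : p.degree = (2 * r + 1 : ℕ) := by
    simp only [p]
    rw [Polynomial.degree_pow, Polynomial.degree_X_sub_C]
    simp
  have hpm : p.Monic := (Polynomial.monic_X_sub_C a).pow _
  have hq : (p - Lagrange.nodal s (node r n j)).degree < (2 * r + 1 : ℕ) := by
    rw [← hp]
    refine Polynomial.degree_sub_lt_left ?_ hpm.ne_zero ?_
    · rw [hp, Lagrange.degree_nodal, Finset.card_range]
    · rw [hpm.leadingCoeff, (Lagrange.nodal_monic (s := s) (v := node r n j)).leadingCoeff]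
  have := sum_eval_cellBasis (j := j) hn hq t
  rw [Polynomial.eval_sub, Lagrange.eval_nodal] at this
  simp only [p, Polynomial.eval_pow, Polynomial.eval_sub, Polynomial.eval_X,
    Polynomial.eval_C] at this
  rw [cellNodal, ← this]
  refine Finset.sum_congr rfl fun i hi => ?_
  rw [Lagrange.eval_nodal_at_node hi, sub_zero]

lemma continuous_cellNodal : Continuous (cellNodal r n j) := by
  unfold cellNodal; fun_prop

lemma abs_cellNodal_le (hn : 0 < n) {t : ℝ} (ht : t ∈ cell n j) :
    |cellNodal r n j t| ≤ (1 / n : ℝ) ^ (2 * r + 1) := by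
  rw [cellNodal, Finset.abs_prod]
  refine (Finset.prod_le_prod (g := fun _ => (1 / n : ℝ)) (fun _ _ => abs_nonneg _)
    fun k hk => ?_).trans_eq (by rw [Finset.prod_const, Finset.card_range])
  exact abs_sub_le_of_mem_cell ht (node_mem_cell hn hk)

/-- The nodes are symmetric about the midpoint and their number `2 * r + 1` is odd. -/
lemma cellNodal_reflect (t : ℝ) :
    cellNodal r n j ((j : ℝ) / n + ((j : ℝ) + 1) / n - t) = -cellNodal r n j t := by
  unfold cellNodal
  rw [← Finset.prod_range_reflect]
  have : ∀ i ∈ Finset.range (2 * r + 1),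
      (j : ℝ) / n + ((j : ℝ) + 1) / n - t - node r n j (2 * r + 1 - 1 - i) =
        (-1) * (t - node r n j i) := fun i hi => by rw [node_reflect hi]; ring
  rw [Finset.prod_congr rfl this, Finset.prod_mul_distrib, Finset.prod_const, Finset.card_range,
    Odd.neg_one_pow ⟨r, rfl⟩]
  ring

lemma norm_cellInterp_le (hn : 0 < n) {f : ℝ → ℂ} {ε : ℝ} (hf : ∀ t ∈ cell n j, ‖f t‖ ≤ ε)
    {t : ℝ} (ht : t ∈ cell n j) : ‖cellInterp r n j f t‖ ≤ (2 * r + 1) * basisBound r * ε := by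
  rw [cellInterp]
  refine (norm_sum_le_of_le (n := fun _ => ε * basisBound r) _ fun i hi => ?_).trans_eq ?_
  · rw [norm_mul, Complex.norm_real]
    exact mul_le_mul (hf _ (node_mem_cell hn hi)) (abs_cellBasis_le hn hi ht) (norm_nonneg _)
      ((norm_nonneg _).trans (hf _ (node_mem_cell hn hi)))
  · simp; ring

lemma cellInterp_sub (f g : ℝ → ℂ) (t : ℝ) :
    cellInterp r n j (fun x => f x - g x) t = cellInterp r n j f t - cellInterp r n j g t := by
  simp [cellInterp, sub_mul]

lemma cellInterp_const (hn : 0 < n) (z : ℂ) (t : ℝ) : cellInterp r n j (fun _ => z) t = z := by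
  rw [cellInterp, ← Finset.mul_sum, ← Complex.ofReal_sum, sum_cellBasis hn, Complex.ofReal_one,
    mul_one]

/-- Constants are reproduced, so `f` may be replaced by `f - f t`. -/
lemma norm_sub_cellInterp_le_of_osc (hn : 0 < n) {f : ℝ → ℂ} {ε : ℝ}
    (hf : ∀ t ∈ cell n j, ∀ t' ∈ cell n j, ‖f t - f t'‖ ≤ ε) {t : ℝ} (ht : t ∈ cell n j) :
    ‖f t - cellInterp r n j f t‖ ≤ (2 * r + 1) * basisBound r * ε := by
  have h1 := norm_cellInterp_le (r := r) hn (f := fun x => f x - f t)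
    (fun x hx => hf x hx t ht) ht
  rwa [cellInterp_sub, cellInterp_const hn, norm_sub_rev] at h1

/-- Interpolation error of a function that is close to a polynomial of degree `2 r + 1`. -/
lemma norm_sub_cellInterp_sub_le (hn : 0 < n) {f : ℝ → ℂ} {a ε : ℝ} {c : ℕ → ℂ}
    (hf : ∀ t ∈ cell n j,
      ‖f t - ∑ k ∈ Finset.range (2 * r + 1 + 1), ((t - a) ^ k : ℝ) * c k‖ ≤ ε) {t : ℝ}
    (ht : t ∈ cell n j) :
    ‖f t - cellInterp r n j f t - c (2 * r + 1) * cellNodal r n j t‖ ≤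
      (1 + (2 * r + 1) * basisBound r) * ε := by
  set p : ℝ → ℂ := fun t => ∑ k ∈ Finset.range (2 * r + 1 + 1), ((t - a) ^ k : ℝ) * c k
  have hp : p t - cellInterp r n j p t = c (2 * r + 1) * cellNodal r n j t := by
    have h1 : cellInterp r n j p t = ∑ k ∈ Finset.range (2 * r + 1 + 1),
        ((∑ i ∈ Finset.range (2 * r + 1), (node r n j i - a) ^ k * cellBasis r n j i t : ℝ) : ℂ)
          * c k := by
      simp only [cellInterp, p, Finset.sum_mul, Complex.ofReal_sum]
      rw [Finset.sum_comm]
      refine Finset.sum_congr rfl fun k _ => Finset.sum_congr rfl fun i _ => ?_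
      push_cast; ring
    rw [h1, Finset.sum_range_succ, sum_pow_cellBasis_top hn, Finset.sum_congr rfl fun k hk => by
      rw [sum_pow_cellBasis hn a t (Finset.mem_range.1 hk)]]
    simp only [p]
    rw [Finset.sum_range_succ]
    push_cast
    ring
  have h2 := norm_cellInterp_le (r := r) hn hf ht
  change ‖cellInterp r n j (fun x => f x - p x) t‖ ≤ _ at h2
  rw [cellInterp_sub] at h2
  calc _ = ‖(f t - p t) - (cellInterp r n j f t - cellInterp r n j p t)‖ := by
        rw [← hp]; congr 1; ring
    _ ≤ ε + (2 * r + 1) * basisBound r * ε := (norm_sub_le _ _).trans (add_le_add (hf t ht) h2)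
    _ = _ := by ring

/-- Uniform Taylor expansion on the cells. -/
lemma exists_cell_taylor {f : ℝ → ℂ} {N : ℕ} (hf : ContDiffOn ℝ (N + 1 : ℕ) f (Icc 0 1)) :
    ∃ C : ℝ, 0 ≤ C ∧ ∀ n j : ℕ, j < n → ∃ c : ℕ → ℂ, ‖c N‖ ≤ C ∧ ∀ t ∈ cell n j,
      ‖f t - ∑ k ∈ Finset.range (N + 1), ((t - (j : ℝ) / n) ^ k : ℝ) * c k‖ ≤
        C * (1 / n : ℝ) ^ (N + 1) := by
  have hu : UniqueDiffOn ℝ (Icc (0 : ℝ) 1) := uniqueDiffOn_Icc one_pos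
  have hb : ∀ k ≤ N + 1, ∃ B, ∀ x ∈ Icc (0 : ℝ) 1, ‖iteratedDerivWithin k f (Icc 0 1) x‖ ≤ B :=
    fun k hk => isCompact_Icc.exists_bound_of_continuousOn
      (hf.continuousOn_iteratedDerivWithin (by exact_mod_cast hk) hu)
  obtain ⟨B, hB⟩ := hb N (by omega)
  obtain ⟨B', hB'⟩ := hb (N + 1) le_rfl
  refine ⟨max B 0 + max B' 0, by positivity, fun n j hj => ?_⟩
  have hn : (0 : ℝ) < n := by exact_mod_cast (Nat.zero_le j).trans_lt hj
  have hsub := cell_subset hj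
  have hlt : (j : ℝ) / n < ((j : ℝ) + 1) / n := by gcongr; linarith
  have hu' : UniqueDiffOn ℝ (cell n j) := uniqueDiffOn_Icc hlt
  have ha : (j : ℝ) / n ∈ cell n j := left_mem_Icc.2 hlt.le
  -- Derivatives within a cell agree with those within `[0, 1]`, which makes the constant
  -- independent of the cell.
  have heq : ∀ k ≤ N + 1, ∀ x ∈ cell n j,
      iteratedDerivWithin k f (cell n j) x = iteratedDerivWithin k f (Icc 0 1) x := by
    intro k hk x hx
    rw [iteratedDerivWithin, iteratedDerivWithin,
      iteratedFDerivWithin_subset hsub hu' hu (hf.of_le (by exact_mod_cast hk)) hx]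
  refine ⟨fun k => ((k.factorial : ℝ)⁻¹ : ℝ) * iteratedDerivWithin k f (cell n j) ((j : ℝ) / n),
    ?_, fun t ht => ?_⟩
  · simp only
    rw [heq N (by omega) _ ha, norm_mul, Complex.norm_real, norm_inv, Real.norm_natCast]
    have h1 : ((N.factorial : ℝ))⁻¹ ≤ 1 :=
      inv_le_one_of_one_le₀ (by exact_mod_cast Nat.one_le_iff_ne_zero.2 N.factorial_ne_zero)
    calc _ ≤ 1 * max B 0 := mul_le_mul h1 ((hB _ (hsub ha)).trans (le_max_left _ _))
          (norm_nonneg _) zero_le_one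
      _ ≤ _ := by linarith [le_max_right B' 0]
  · have h1 := taylor_mean_remainder_bound (C := max B' 0) (n := N) hlt.le
      (hf.mono hsub) ht
      fun y hy => by
        rw [show Icc ((j : ℝ) / n) (((j : ℝ) + 1) / n) = cell n j from rfl,
          heq (N + 1) le_rfl y hy]
        exact (hB' y (hsub hy)).trans (le_max_left _ _)
    have h2 : 0 ≤ t - (j : ℝ) / n := sub_nonneg.2 ht.1
    have h3 : t - (j : ℝ) / n ≤ 1 / n := (le_abs_self _).trans (abs_sub_le_of_mem_cell ht ha)
    have h4 : max B' 0 * (t - (j : ℝ) / n) ^ (N + 1) / N.factorial ≤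
        (max B 0 + max B' 0) * (1 / n : ℝ) ^ (N + 1) := by
      refine (div_le_self (by positivity) (by
        exact_mod_cast Nat.one_le_iff_ne_zero.2 N.factorial_ne_zero)).trans ?_
      gcongr
      linarith [le_max_right B 0]
    refine le_trans (le_of_eq ?_) (h1.trans h4)
    rw [taylor_within_apply]
    congr 2
    refine Finset.sum_congr rfl fun k _ => ?_
    rw [Complex.real_smul]
    push_cast
    rw [cell]
    ring

/-- Structure of the interpolation error of a smooth function on the cells. -/
lemma exists_interp_error {f : ℝ → ℂ} (hf : ContDiffOn ℝ (2 * r + 2 : ℕ) f (Icc 0 1)) :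
    ∃ C : ℝ, 0 ≤ C ∧ ∀ n j : ℕ, j < n → ∃ c : ℂ, ‖c‖ ≤ C ∧ ∀ t ∈ cell n j,
      ‖f t - cellInterp r n j f t - c * cellNodal r n j t‖ ≤ C * (1 / n : ℝ) ^ (2 * r + 2) := by
  obtain ⟨C, hC, h⟩ := exists_cell_taylor (N := 2 * r + 1) hf
  have hb := basisBound_nonneg r
  have h1 : 1 ≤ 1 + (2 * r + 1) * basisBound r := le_add_of_nonneg_right (by positivity)
  refine ⟨(1 + (2 * r + 1) * basisBound r) * C, by positivity, fun n j hj => ?_⟩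
  obtain ⟨c, hc, hct⟩ := h n j hj
  refine ⟨c (2 * r + 1), hc.trans (le_mul_of_one_le_left hC h1), fun t ht => ?_⟩
  refine (norm_sub_cellInterp_sub_le ((Nat.zero_le j).trans_lt hj) hct ht).trans_eq ?_
  ring

end Interpolation

/-! ### Symmetrized integrals over cells -/

section CellIntegrals

variable {r n j : ℕ}

/-- The reflection of a cell about its midpoint. -/
noncomputable def cellReflect (n j : ℕ) (t : ℝ) : ℝ := (j : ℝ) / n + ((j : ℝ) + 1) / n - t

lemma cellReflect_mem {t : ℝ} (ht : t ∈ cell n j) : cellReflect n j t ∈ cell n j :=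
  ⟨by unfold cellReflect; linarith [ht.2], by unfold cellReflect; linarith [ht.1]⟩

lemma continuous_cellReflect : Continuous (cellReflect n j) := by unfold cellReflect; fun_prop

lemma cell_left_le : (j : ℝ) / n ≤ ((j : ℝ) + 1) / n := by gcongr; linarith

lemma cell_length : ((j : ℝ) + 1) / n - (j : ℝ) / n = 1 / n := by ring

lemma integral_comp_cellReflect (F : ℝ → ℂ) :
    ∫ t in ((j : ℝ) / n)..(((j : ℝ) + 1) / n), F (cellReflect n j t) =
      ∫ t in ((j : ℝ) / n)..(((j : ℝ) + 1) / n), F t := by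
  have := intervalIntegral.integral_comp_sub_left (a := (j : ℝ) / n) (b := ((j : ℝ) + 1) / n)
    F ((j : ℝ) / n + ((j : ℝ) + 1) / n)
  simpa only [cellReflect, add_sub_cancel_left, add_sub_cancel_right] using this

/-- Symmetrization of an integral over a cell. -/
lemma norm_cell_integral_le_of_symm {F : ℝ → ℂ} {B : ℝ} (hF : ContinuousOn F (cell n j))
    (hB : ∀ t ∈ cell n j, ‖F t + F (cellReflect n j t)‖ ≤ B) :
    ‖∫ t in ((j : ℝ) / n)..(((j : ℝ) + 1) / n), F t‖ ≤ B * (1 / n) := by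
  have hle := cell_left_le (n := n) (j := j)
  have h1 : IntervalIntegrable F volume ((j : ℝ) / n) (((j : ℝ) + 1) / n) :=
    hF.intervalIntegrable_of_Icc hle
  have h2 : IntervalIntegrable (fun t => F (cellReflect n j t)) volume ((j : ℝ) / n)
      (((j : ℝ) + 1) / n) :=
    (hF.comp continuous_cellReflect.continuousOn fun t => cellReflect_mem).intervalIntegrable_of_Icc
      hle
  have h3 : (2 : ℂ) * ∫ t in ((j : ℝ) / n)..(((j : ℝ) + 1) / n), F t =
      ∫ t in ((j : ℝ) / n)..(((j : ℝ) + 1) / n), (F t + F (cellReflect n j t)) := by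
    rw [intervalIntegral.integral_add h1 h2, integral_comp_cellReflect, two_mul]
  have h4 := intervalIntegral.norm_integral_le_of_norm_le_const (a := (j : ℝ) / n)
    (b := ((j : ℝ) + 1) / n) (f := fun t => F t + F (cellReflect n j t)) (C := B) fun t ht => by
      rw [uIoc_of_le hle] at ht
      exact hB t (Ioc_subset_Icc_self ht)
  rw [← h3, norm_mul, Complex.norm_ofNat, cell_length, abs_of_nonneg (by positivity)] at h4
  linarith [norm_nonneg (∫ t in ((j : ℝ) / n)..(((j : ℝ) + 1) / n), F t)]

/-- Integral over a cell against a function that is close to a multiple of the nodal polynomial. -/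
lemma norm_cell_integral_mul_le (hn : 0 < n) {ψ v : ℝ → ℂ} {c : ℂ} {C ε B₀ B : ℝ} (hC : ‖c‖ ≤ C)
    (hB₀ : 0 ≤ B₀) (hψ : ContinuousOn ψ (cell n j))
    (hv : IntervalIntegrable v volume ((j : ℝ) / n) (((j : ℝ) + 1) / n))
    (hvc : ∀ᵐ t, t ∈ Ioc ((j : ℝ) / n) (((j : ℝ) + 1) / n) →
      ‖v t - c * cellNodal r n j t‖ ≤ ε)
    (hψ₀ : ∀ t ∈ cell n j, ‖ψ t‖ ≤ B₀)
    (hψ₁ : ∀ t ∈ cell n j, ‖ψ t - ψ (cellReflect n j t)‖ ≤ B) :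
    ‖∫ t in ((j : ℝ) / n)..(((j : ℝ) + 1) / n), ψ t * v t‖ ≤
      (B * C * (1 / n : ℝ) ^ (2 * r + 1) + B₀ * ε) * (1 / n) := by
  have hle := cell_left_le (n := n) (j := j)
  have hW : Continuous fun t => (cellNodal r n j t : ℂ) :=
    Complex.continuous_ofReal.comp continuous_cellNodal
  have hC0 : 0 ≤ C := (norm_nonneg _).trans hC
  have h1 : IntervalIntegrable (fun t => ψ t * v t) volume ((j : ℝ) / n) (((j : ℝ) + 1) / n) :=
    hv.continuousOn_mul (by rwa [uIcc_of_le hle])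
  have hψW : ContinuousOn (fun t => ψ t * (c * cellNodal r n j t)) (cell n j) :=
    hψ.mul (continuousOn_const.mul hW.continuousOn)
  have h2 : IntervalIntegrable (fun t => ψ t * (c * cellNodal r n j t)) volume ((j : ℝ) / n)
      (((j : ℝ) + 1) / n) := hψW.intervalIntegrable_of_Icc hle
  have h3 : (∫ t in ((j : ℝ) / n)..(((j : ℝ) + 1) / n), ψ t * v t) =
      (∫ t in ((j : ℝ) / n)..(((j : ℝ) + 1) / n), (ψ t * v t - ψ t * (c * cellNodal r n j t))) +
      ∫ t in ((j : ℝ) / n)..(((j : ℝ) + 1) / n), ψ t * (c * cellNodal r n j t) := by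
    rw [intervalIntegral.integral_sub h1 h2]; ring
  have h4 : ‖∫ t in ((j : ℝ) / n)..(((j : ℝ) + 1) / n),
      (ψ t * v t - ψ t * (c * cellNodal r n j t))‖ ≤ B₀ * ε * (1 / n) := by
    have := intervalIntegral.norm_integral_le_of_norm_le_const_ae (a := (j : ℝ) / n)
      (b := ((j : ℝ) + 1) / n) (f := fun t => ψ t * v t - ψ t * (c * cellNodal r n j t))
      (C := B₀ * ε) (by
        filter_upwards [hvc] with t ht ht'
        rw [uIoc_of_le hle] at ht'
        rw [← mul_sub, norm_mul]
        exact mul_le_mul (hψ₀ t (Ioc_subset_Icc_self ht')) (ht ht') (norm_nonneg _) hB₀)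
    rwa [cell_length, abs_of_nonneg (by positivity)] at this
  -- Oddness of the nodal polynomial turns the symmetrized integrand into the difference of `ψ` at
  -- reflected points.
  have h5 : ‖∫ t in ((j : ℝ) / n)..(((j : ℝ) + 1) / n), ψ t * (c * cellNodal r n j t)‖ ≤
      B * C * (1 / n : ℝ) ^ (2 * r + 1) * (1 / n) := by
    refine norm_cell_integral_le_of_symm hψW fun t ht => ?_
    have h6 : cellNodal r n j (cellReflect n j t) = -cellNodal r n j t := cellNodal_reflect t
    rw [h6, show ψ t * (c * cellNodal r n j t) +
      ψ (cellReflect n j t) * (c * ((-cellNodal r n j t : ℝ) : ℂ)) =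
      (ψ t - ψ (cellReflect n j t)) * (c * cellNodal r n j t) by push_cast; ring, norm_mul,
      norm_mul, Complex.norm_real, mul_assoc]
    have hB0 : 0 ≤ B := (norm_nonneg _).trans (hψ₁ t ht)
    exact mul_le_mul (hψ₁ t ht) (mul_le_mul hC (abs_cellNodal_le hn ht) (norm_nonneg _) hC0)
      (by positivity) hB0
  rw [h3]
  refine (norm_add_le _ _).trans ((add_le_add h4 h5).trans_eq ?_)
  ring

/-- The exceptional cell `j₀` is the one where the kernel is not smooth. -/
lemma norm_integral_le_of_cells (hn : 0 < n) {F : ℝ → ℂ} {b b₀ : ℝ} {j₀ : ℕ} (hb : 0 ≤ b)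
    (hb₀ : 0 ≤ b₀) (hF : IntegrableOn F (Icc 0 1))
    (hcell : ∀ j < n, j ≠ j₀ → ‖∫ t in ((j : ℝ) / n)..(((j : ℝ) + 1) / n), F t‖ ≤ b)
    (hcell₀ : ‖∫ t in ((j₀ : ℝ) / n)..(((j₀ : ℝ) + 1) / n), F t‖ ≤ b₀) :
    ‖∫ t in Icc (0 : ℝ) 1, F t‖ ≤ n * b + b₀ := by
  have hn' : (0 : ℝ) < n := by exact_mod_cast hn
  have hint : ∀ j < n, IntervalIntegrable F volume ((j : ℝ) / n) (((j + 1 : ℕ) : ℝ) / n) := by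
    intro j hj
    push_cast
    rw [intervalIntegrable_iff_integrableOn_Icc_of_le cell_left_le]
    exact hF.mono_set (cell_subset hj)
  have h1 := intervalIntegral.sum_integral_adjacent_intervals (a := fun j : ℕ => (j : ℝ) / n) hint
  simp only [Nat.cast_zero, zero_div, div_self hn'.ne'] at h1
  rw [integral_Icc_eq_integral_Ioc, ← intervalIntegral.integral_of_le zero_le_one, ← h1]
  have h2 : ∀ j ∈ Finset.range n,
      ‖∫ t in ((j : ℝ) / n)..(((j + 1 : ℕ) : ℝ) / n), F t‖ ≤ b + if j = j₀ then b₀ else 0 := by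
    intro j hj
    push_cast
    split_ifs with h
    · rw [h]; linarith
    · rw [add_zero]; exact hcell j (Finset.mem_range.1 hj) h
  refine (norm_sum_le_of_le _ h2).trans ?_
  rw [Finset.sum_add_distrib, Finset.sum_ite_eq']
  simp only [Finset.sum_const, Finset.card_range, nsmul_eq_mul]
  split_ifs <;> linarith

end CellIntegrals

/-! ### The integral operator applied to interpolation errors -/

section KernelIntegrals

variable {r n : ℕ} {k : ℝ → ℝ → ℝ} {L C : ℝ} {v : ℝ → ℂ} {g : ℝ → ℂ}

/-- On each cell `v` is a multiple of the nodal polynomial up to an error of higher order. -/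
def NearNodal (r n : ℕ) (v : ℝ → ℂ) (C : ℝ) : Prop :=
  ∀ j < n, ∃ c : ℂ, ‖c‖ ≤ C ∧ ∀ᵐ t, t ∈ Ioc ((j : ℝ) / n) (((j : ℝ) + 1) / n) →
    ‖v t - c * cellNodal r n j t‖ ≤ C * (1 / n : ℝ) ^ (2 * r + 2)

lemma cells_ordered {i j : ℕ} (hij : i ≠ j) :
    ((i : ℝ) + 1) / n ≤ (j : ℝ) / n ∨ ((j : ℝ) + 1) / n ≤ (i : ℝ) / n := by
  rcases lt_or_gt_of_ne hij with h | h
  · left; gcongr; exact_mod_cast h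
  · right; gcongr; exact_mod_cast h

/-- A regular cell contributes `2 * B * C * h^(2r+3)`, one power of `h` coming from the variation of
`ψ` or from the remainder and one from the length; summing `n` of them loses one power. The single
exceptional cell does not suffer this loss, so weaker bounds on `ψ` are enough there. -/
lemma norm_integral_mul_nearNodal_le (hn : 0 < n) (hC : 0 ≤ C)
    (hv : NearNodal r n v C) (hvint : IntegrableOn v (Icc 0 1)) {ψ : ℝ → ℝ}
    (hψ : ContinuousOn ψ (Icc 0 1)) {j₀ : ℕ} (hj₀ : j₀ < n) {B : ℝ} (hB : 0 ≤ B)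
    {B₀ B₁ : ℝ} (hB₀ : 0 ≤ B₀) (hB₁ : 0 ≤ B₁)
    (h1 : ∀ j < n, j ≠ j₀ → ∀ t ∈ cell n j, |ψ t| ≤ B ∧
      ∀ t' ∈ cell n j, |ψ t - ψ t'| ≤ B * (1 / n))
    (h2 : ∀ t ∈ cell n j₀, |ψ t| ≤ B₀ ∧ |ψ t - ψ (cellReflect n j₀ t)| ≤ B₁) :
    ‖∫ t in Icc (0 : ℝ) 1, (ψ t : ℂ) * v t‖ ≤
      2 * (B * C) * (1 / n : ℝ) ^ (2 * r + 2) +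
        (B₁ * C * (1 / n : ℝ) ^ (2 * r + 2) + B₀ * C * (1 / n : ℝ) ^ (2 * r + 3)) := by
  have hn' : (0 : ℝ) < n := by exact_mod_cast hn
  have hψc : ContinuousOn (fun t => (ψ t : ℂ)) (Icc 0 1) :=
    Complex.continuous_ofReal.comp_continuousOn hψ
  have hcast : ∀ x y b : ℝ, |x - y| ≤ b → ‖(x : ℂ) - y‖ ≤ b := fun x y b h => by
    rwa [← Complex.ofReal_sub, Complex.norm_real]
  have hvj : ∀ j < n, IntervalIntegrable v volume ((j : ℝ) / n) (((j : ℝ) + 1) / n) := by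
    intro j hj
    rw [intervalIntegrable_iff_integrableOn_Icc_of_le cell_left_le]
    exact hvint.mono_set (cell_subset hj)
  refine (norm_integral_le_of_cells hn (b := 2 * (B * C) * (1 / n : ℝ) ^ (2 * r + 3)) (j₀ := j₀)
    (b₀ := B₁ * C * (1 / n : ℝ) ^ (2 * r + 2) + B₀ * C * (1 / n : ℝ) ^ (2 * r + 3))
    (by positivity) (by positivity) ?_ (fun j hj hjj => ?_) ?_).trans_eq ?_
  · exact hvint.continuousOn_mul hψc isCompact_Icc
  · obtain ⟨c, hc, hvc⟩ := hv j hj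
    refine (norm_cell_integral_mul_le hn hc hB (hψc.mono (cell_subset hj)) (hvj j hj) hvc
      (fun t ht => (Complex.norm_real _).trans_le (h1 j hj hjj t ht).1)
      fun t ht => hcast _ _ _ ((h1 j hj hjj t ht).2 _ (cellReflect_mem ht))).trans_eq ?_
    ring
  · obtain ⟨c, hc, hvc⟩ := hv j₀ hj₀
    refine (norm_cell_integral_mul_le hn hc hB₀ (hψc.mono (cell_subset hj₀)) (hvj j₀ hj₀) hvc
      (fun t ht => (Complex.norm_real _).trans_le (h2 t ht).1)
      fun t ht => hcast _ _ _ (h2 t ht).2).trans_eq ?_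
    ring
  · rw [show 2 * (B * C) * (1 / n : ℝ) ^ (2 * r + 3) =
      2 * (B * C) * (1 / n : ℝ) ^ (2 * r + 2) * (1 / n) by ring]
    field_simp

lemma kernel_section_continuousOn_real
    (hk : ContinuousOn (fun p : ℝ × ℝ => k p.1 p.2) (Icc 0 1 ×ˢ Icc 0 1)) {s : ℝ}
    (hs : s ∈ Icc (0 : ℝ) 1) : ContinuousOn (k s) (Icc 0 1) :=
  hk.comp (f := fun t : ℝ => ((s, t) : ℝ × ℝ)) (by fun_prop) fun _ ht => ⟨hs, ht⟩

lemma integrableOn_kernel_mul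
    (hk : ContinuousOn (fun p : ℝ × ℝ => k p.1 p.2) (Icc 0 1 ×ˢ Icc 0 1)) (hvint : IntegrableOn v (Icc 0 1)) {s : ℝ}
    (hs : s ∈ Icc (0 : ℝ) 1) : IntegrableOn (fun t => (k s t : ℂ) * v t) (Icc 0 1) :=
  hvint.continuousOn_mul (kernel_section_continuousOn hk hs) isCompact_Icc

/-- Oscillation on the cells of the image under the integral operator of an interpolation error. -/
lemma osc_integral_nearNodal
    (hk : ContinuousOn (fun p : ℝ × ℝ => k p.1 p.2) (Icc 0 1 ×ˢ Icc 0 1))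
    (hkb : KernelBounds k L) (hn : 0 < n) (hC : 0 ≤ C) (hv : NearNodal r n v C)
    (hvint : IntegrableOn v (Icc 0 1))
    (hg : ∀ s ∈ Icc (0 : ℝ) 1, g s = ∫ t in Icc (0 : ℝ) 1, (k s t : ℂ) * v t) {j₀ : ℕ}
    (hj₀ : j₀ < n) : ∀ s ∈ cell n j₀, ∀ s' ∈ cell n j₀,
    ‖g s - g s'‖ ≤ 5 * (L * C) * (1 / n : ℝ) ^ (2 * r + 3) := by
  intro s hs s' hs'
  have hL := hkb.nonneg
  have hs1 := cell_subset hj₀ hs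
  have hs1' := cell_subset hj₀ hs'
  have hss := abs_sub_le_of_mem_cell hs hs'
  have hlip : ∀ t ∈ Icc (0 : ℝ) 1, |k s t - k s' t| ≤ L * (1 / n) := fun t ht =>
    (hkb.lip_fst s hs1 s' hs1' t ht).trans (by gcongr)
  rw [hg s hs1, hg s' hs1', ← integral_sub (integrableOn_kernel_mul hk hvint hs1)
    (integrableOn_kernel_mul hk hvint hs1')]
  simp_rw [← sub_mul, ← Complex.ofReal_sub]
  -- On the cell of `s` and `s'` no mixed difference is available: the triangle inequality gives `B₁
  -- = 2 * L * h`, sufficient for a single cell.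
  refine (norm_integral_mul_nearNodal_le hn hC hv hvint
    ((kernel_section_continuousOn_real hk hs1).sub (kernel_section_continuousOn_real hk hs1')) hj₀
    (B := L * (1 / n)) (B₀ := L * (1 / n)) (B₁ := 2 * (L * (1 / n))) (by positivity)
    (by positivity) (by positivity) (fun j hj hjj t ht => ⟨?_, fun t' ht' => ?_⟩)
    (fun t ht => ⟨?_, ?_⟩)).trans ?_
  · exact hlip t (cell_subset hj ht)
  · have := hkb.mixed (by positivity) (cell_subset hj₀ (right_mem_Icc.2 cell_left_le)).2
      (by positivity) (cell_subset hj (right_mem_Icc.2 cell_left_le)).2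
      (cells_ordered hjj.symm) s hs s' hs' t ht t' ht'
    have h2 : L * |s - s'| * |t - t'| ≤ L * (1 / n) * (1 / n) := by
      gcongr
      exact abs_sub_le_of_mem_cell ht ht'
    exact this.trans h2
  · exact hlip t (cell_subset hj₀ ht)
  · have h1 := hlip t (cell_subset hj₀ ht)
    have h2 := hlip _ (cell_subset hj₀ (cellReflect_mem ht))
    have h3 := (abs_sub (k s t - k s' t)
      (k s (cellReflect n j₀ t) - k s' (cellReflect n j₀ t))).trans (add_le_add h1 h2)
    rw [← two_mul] at h3
    exact h3
  · have h1 : (1 / n : ℝ) ≤ 1 := by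
      rw [div_le_one (by exact_mod_cast hn)]; exact_mod_cast hn
    have h2 : L * (1 / n) * C * (1 / n : ℝ) ^ (2 * r + 3) ≤ L * 1 * C * (1 / n : ℝ) ^ (2 * r + 3) := by
      gcongr
    calc _ = 4 * (L * C) * (1 / n : ℝ) ^ (2 * r + 3) +
          L * (1 / n) * C * (1 / n : ℝ) ^ (2 * r + 3) := by ring
      _ ≤ _ := by linarith

lemma node_zero_eq (n j : ℕ) : node 0 n j 0 = ((j : ℝ) + 1 / 2) / n := by simp [node]

lemma cellReflect_eq (n j : ℕ) (t : ℝ) : cellReflect n j t = 2 * node 0 n j 0 - t := by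
  rw [node_zero_eq, cellReflect]; ring

/-- The part of the second difference of a kernel across the diagonal is even about the midpoint. -/
lemma second_difference_diagonal (hkb : KernelBounds k L) {j : ℕ} (hj : j < n) {m τ : ℝ}
    (hm : m ∈ cell n j) (hm1 : m + τ ∈ cell n j) (hm2 : m - τ ∈ cell n j) {t t' : ℝ}
    (ht : t ∈ cell n j) (ht' : t' ∈ cell n j) (htt : t + t' = 2 * m) :
    |(k (m + τ) t + k (m - τ) t - 2 * k m t) - (k (m + τ) t' + k (m - τ) t' - 2 * k m t')| ≤
      8 * L * (1 / n : ℝ) ^ 2 := by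
  have hsub := cell_subset hj
  obtain ⟨α, β, γ, δ, h⟩ := hkb.taylor m (hsub hm)
  have key : ∀ s ∈ cell n j, ∀ t ∈ cell n j,
      |k s t - (α + β * (s - m) + γ * (t - m) + δ * max (s - t) 0)| ≤ L * (1 / n : ℝ) ^ 2 :=
    fun s hs t ht => h s (hsub hs) t (hsub ht) _ (abs_sub_le_of_mem_cell hs hm)
      (abs_sub_le_of_mem_cell ht hm)
  have a1 := key _ hm1 _ ht
  have a2 := key _ hm2 _ ht
  have a3 := key _ hm _ ht
  have b1 := key _ hm1 _ ht'
  have b2 := key _ hm2 _ ht'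
  have b3 := key _ hm _ ht'
  -- Since `max x 0 - max (-x) 0` is linear in `x`, reflecting `t` about `m` changes the second
  -- difference of the kink by the second difference of a linear function, which is zero.
  have hmax : ∀ x : ℝ, max x 0 - max (-x) 0 = x := fun x => by
    rcases le_total x 0 with h | h
    · rw [max_eq_right h, max_eq_left (by linarith)]; ring
    · rw [max_eq_left h, max_eq_right (by linarith)]; ring
  have c1 := hmax (m + τ - t)
  have c2 := hmax (m - τ - t)
  have c3 := hmax (m - t)
  rw [show -(m + τ - t) = m - τ - t' by linarith] at c1
  rw [show -(m - τ - t) = m + τ - t' by linarith] at c2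
  rw [show -(m - t) = m - t' by linarith] at c3
  have hδ : δ * (max (m + τ - t) 0 + max (m - τ - t) 0 - 2 * max (m - t) 0) =
      δ * (max (m + τ - t') 0 + max (m - τ - t') 0 - 2 * max (m - t') 0) := by
    congr 1; linarith
  rw [abs_le] at *
  constructor <;> linarith [a1.1, a1.2, a2.1, a2.2, a3.1, a3.2, b1.1, b1.2, b2.1, b2.2, b3.1, b3.2]

/-- Second differences about the midpoint of a cell, piecewise constant case. -/
lemma second_difference_integral_nearNodal
    (hk : ContinuousOn (fun p : ℝ × ℝ => k p.1 p.2) (Icc 0 1 ×ˢ Icc 0 1))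
    (hkb : KernelBounds k L) (hn : 0 < n) (hC : 0 ≤ C) (hv : NearNodal 0 n v C)
    (hvint : IntegrableOn v (Icc 0 1))
    (hg : ∀ s ∈ Icc (0 : ℝ) 1, g s = ∫ t in Icc (0 : ℝ) 1, (k s t : ℂ) * v t) {j₀ : ℕ}
    (hj₀ : j₀ < n) : ∀ t ∈ cell n j₀,
    ‖g t + g (cellReflect n j₀ t) - 2 * g (node 0 n j₀ 0)‖ ≤ 12 * (L * C) * (1 / n : ℝ) ^ 4 := by
  set m := node 0 n j₀ 0 with hmdef
  have hm : m ∈ cell n j₀ := node_mem_cell hn (by simp)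
  have hsub := cell_subset hj₀
  have hL := hkb.nonneg
  have main : ∀ τ, 0 ≤ τ → m + τ ∈ cell n j₀ → m - τ ∈ cell n j₀ →
      ‖g (m + τ) + g (m - τ) - 2 * g m‖ ≤ 12 * (L * C) * (1 / n : ℝ) ^ 4 := by
    intro τ hτ hm1 hm2
    have hτn : τ ≤ 1 / n := by
      have := abs_sub_le_of_mem_cell hm1 hm
      rwa [add_sub_cancel_left, abs_of_nonneg hτ] at this
    have i1 := integrableOn_kernel_mul hk hvint (hsub hm1)
    have i2 := integrableOn_kernel_mul hk hvint (hsub hm2)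
    have i3 := integrableOn_kernel_mul hk hvint (hsub hm)
    have i12 : IntegrableOn (fun t => (k (m + τ) t : ℂ) * v t + (k (m - τ) t : ℂ) * v t)
      (Icc 0 1) := i1.add i2
    have heq : g (m + τ) + g (m - τ) - 2 * g m = ∫ t in Icc (0 : ℝ) 1,
        ((k (m + τ) t + k (m - τ) t - 2 * k m t : ℝ) : ℂ) * v t := by
      rw [hg _ (hsub hm1), hg _ (hsub hm2), hg _ (hsub hm), ← integral_const_mul,
        ← integral_add i1 i2, ← integral_sub i12 (i3.const_mul 2)]
      refine integral_congr_ae (Filter.Eventually.of_forall fun t => ?_)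
      push_cast; ring
    rw [heq]
    have hτ2 : L * τ ^ 2 ≤ L * (1 / n : ℝ) ^ 2 := by gcongr
    have hsep : ∀ j ≠ j₀, m + τ ≤ (j : ℝ) / n ∨ ((j : ℝ) + 1) / n ≤ m - τ := fun j hjj => by
      rcases cells_ordered (n := n) hjj.symm with h | h
      · exact Or.inl (hm1.2.trans h)
      · exact Or.inr (h.trans hm2.1)
    -- On the exceptional cell the second difference is only `O(h)`, but its odd part is `O(h^2)` by
    -- `second_difference_diagonal`, and only the odd part meets the nodal polynomial. The total is
    -- `2 + 8 + 2 = 12`.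
    refine (norm_integral_mul_nearNodal_le hn hC hv hvint
      (((kernel_section_continuousOn_real hk (hsub hm1)).add
        (kernel_section_continuousOn_real hk (hsub hm2))).sub
        ((kernel_section_continuousOn_real hk (hsub hm)).const_mul 2)) hj₀
      (B := L * (1 / n : ℝ) ^ 2) (B₀ := 2 * (L * (1 / n))) (B₁ := 8 * L * (1 / n : ℝ) ^ 2)
      (by positivity) (by positivity) (by positivity) (fun j hj hjj t ht => ⟨?_, fun t' ht' => ?_⟩)
      (fun t ht => ⟨?_, ?_⟩)).trans_eq (by ring)
    · exact (hkb.second hτ (hsub hm2).1 (hsub hm1).2 (by positivity)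
        (cell_subset hj (right_mem_Icc.2 cell_left_le)).2 (hsep j hjj) t ht).trans hτ2
    · refine (hkb.second_mixed hτ (hsub hm2).1 (hsub hm1).2 (by positivity)
        (cell_subset hj (right_mem_Icc.2 cell_left_le)).2 (hsep j hjj) t ht t' ht').trans ?_
      gcongr
      exact abs_sub_le_of_mem_cell ht ht'
    · have h1 := hkb.lip_fst _ (hsub hm1) _ (hsub hm) t (hsub ht)
      have h2 := hkb.lip_fst _ (hsub hm2) _ (hsub hm) t (hsub ht)
      have h3 : L * |m + τ - m| ≤ L * (1 / n) := by
        gcongr; exact abs_sub_le_of_mem_cell hm1 hm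
      have h4 : L * |m - τ - m| ≤ L * (1 / n) := by
        gcongr; exact abs_sub_le_of_mem_cell hm2 hm
      replace h1 := abs_le.1 (h1.trans h3)
      replace h2 := abs_le.1 (h2.trans h4)
      simp only [Pi.add_apply, Pi.sub_apply]
      exact abs_le.2 ⟨by linarith [h1.1, h2.1], by linarith [h1.2, h2.2]⟩
    · exact second_difference_diagonal hkb hj₀ hm hm1 hm2 ht (cellReflect_mem ht)
        (by rw [cellReflect_eq]; ring)
  intro t ht
  have ht' := cellReflect_mem ht
  rcases le_total m t with h | h
  · have := main (t - m) (by linarith) (by simpa using ht) (by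
      rwa [show m - (t - m) = cellReflect n j₀ t by rw [cellReflect_eq]; ring])
    rwa [show m - (t - m) = cellReflect n j₀ t by rw [cellReflect_eq]; ring,
      add_sub_cancel] at this
  · have := main (m - t) (by linarith) (by
      rwa [show m + (m - t) = cellReflect n j₀ t by rw [cellReflect_eq]; ring]) (by simpa using ht)
    rwa [show m + (m - t) = cellReflect n j₀ t by rw [cellReflect_eq]; ring,
      sub_sub_cancel, add_comm (g (cellReflect n j₀ t))] at this

/-- Integral against the kernel of a piecewise constant interpolation error. -/
lemma norm_integral_mul_sub_midpoint_le
    (hk : ContinuousOn (fun p : ℝ × ℝ => k p.1 p.2) (Icc 0 1 ×ˢ Icc 0 1))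
    (hkb : KernelBounds k L) (hn : 0 < n) {A : ℝ → ℂ} {ω₁ ω₂ : ℝ} (hω₁ : 0 ≤ ω₁) (hω₂ : 0 ≤ ω₂)
    (hg : ContinuousOn g (Icc 0 1))
    (h1 : ∀ j < n, ∀ t ∈ cell n j, ∀ t' ∈ cell n j, ‖g t - g t'‖ ≤ ω₁)
    (h2 : ∀ j < n, ∀ t ∈ cell n j,
      ‖g t + g (cellReflect n j t) - 2 * g (node 0 n j 0)‖ ≤ ω₂)
    (hA : IntegrableOn A (Icc 0 1))
    (hAc : ∀ j < n, ∀ᵐ t, t ∈ Ioc ((j : ℝ) / n) (((j : ℝ) + 1) / n) →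
      A t = g t - g (node 0 n j 0)) {s : ℝ} (hs : s ∈ Icc (0 : ℝ) 1) :
    ‖∫ t in Icc (0 : ℝ) 1, (k s t : ℂ) * A t‖ ≤ 2 * L * (ω₂ + 1 / n * ω₁) := by
  have hL := hkb.nonneg
  have hn' : (1 : ℝ) ≤ n := by exact_mod_cast hn
  have hcell : ∀ j < n, ‖∫ t in ((j : ℝ) / n)..(((j : ℝ) + 1) / n), (k s t : ℂ) * A t‖ ≤
      L * (ω₂ + 1 / n * ω₁) * (1 / n) := by
    intro j hj
    have hsub := cell_subset hj
    have hm : node 0 n j 0 ∈ cell n j := node_mem_cell hn (by simp)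
    rw [intervalIntegral.integral_congr_ae
      (g := fun t => (k s t : ℂ) * (g t - g (node 0 n j 0)))]
    · refine norm_cell_integral_le_of_symm (((kernel_section_continuousOn hk hs).mono hsub).mul
        ((hg.mono hsub).sub continuousOn_const)) fun t ht => ?_
      have ht' := cellReflect_mem ht
      -- The symmetrized product splits into the kernel times a second difference of `g`, and a
      -- product of two first differences.
      rw [show (k s t : ℂ) * (g t - g (node 0 n j 0)) +
        (k s (cellReflect n j t) : ℂ) * (g (cellReflect n j t) - g (node 0 n j 0)) =
        (k s t : ℂ) * (g t + g (cellReflect n j t) - 2 * g (node 0 n j 0)) +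
        ((k s (cellReflect n j t) - k s t : ℝ) : ℂ) *
          (g (cellReflect n j t) - g (node 0 n j 0)) by push_cast; ring]
      refine (norm_add_le _ _).trans ?_
      rw [norm_mul, norm_mul, Complex.norm_real, Complex.norm_real, mul_add, ← mul_assoc]
      refine add_le_add (mul_le_mul (hkb.bound s hs t (hsub ht)) (h2 j hj t ht) (norm_nonneg _) hL)
        (mul_le_mul ?_ (h1 j hj _ ht' _ hm) (norm_nonneg _) (by positivity))
      refine (hkb.lip_snd s hs _ (hsub ht') t (hsub ht)).trans ?_
      gcongr
      exact abs_sub_le_of_mem_cell ht' ht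
    · filter_upwards [hAc j hj] with t ht ht'
      rw [uIoc_of_le cell_left_le] at ht'
      simp only [ht ht']
  have hb : 0 ≤ L * (ω₂ + 1 / n * ω₁) * (1 / n) := by positivity
  -- No cell is exceptional here; cell `0` fills the role and is counted twice, whence the factor
  -- `2`.
  refine (norm_integral_le_of_cells hn hb hb (integrableOn_kernel_mul hk hA hs)
    (fun j hj _ => hcell j hj) (hcell 0 hn)).trans ?_
  have h3 : (n : ℝ) * (L * (ω₂ + 1 / n * ω₁) * (1 / n)) = L * (ω₂ + 1 / n * ω₁) := by field_simp
  have h4 : L * (ω₂ + 1 / n * ω₁) * (1 / n) ≤ L * (ω₂ + 1 / n * ω₁) :=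
    mul_le_of_le_one_right (by positivity) (by rw [div_le_one (by linarith)]; exact hn')
  linarith

end KernelIntegrals

/-! ### Norm estimates in `L^∞` and consistency of the modified operator -/

section LInfEstimates

variable {r n : ℕ} {ev : Fin n → Fin (2 * r + 1) → LInf →L[ℂ] ℂ}

/-- The half-open cells miss only `t = 0`; otherwise the index is `⌈t * n⌉₊ - 1`. -/
lemma ae_exists_mem_cell (hn : 0 < n) :
    ∀ᵐ t ∂((volume : Measure ℝ).restrict (Icc (0 : ℝ) 1)),
      ∃ j < n, t ∈ Ioc ((j : ℝ) / n) (((j : ℝ) + 1) / n) := by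
  have hn' : (0 : ℝ) < n := by exact_mod_cast hn
  filter_upwards [ae_restrict_mem measurableSet_Icc,
    ae_restrict_of_ae (Measure.ae_ne volume (0 : ℝ))] with t ht ht0
  have htpos : 0 < t := lt_of_le_of_ne ht.1 (Ne.symm ht0)
  have h1 : 0 < ⌈t * n⌉₊ := Nat.ceil_pos.2 (by positivity)
  have h2 : ⌈t * n⌉₊ ≤ n := Nat.ceil_le.2 (by nlinarith [ht.2])
  have h3 := Nat.ceil_lt_add_one (a := t * n) (by positivity)
  have h4 := Nat.le_ceil (t * n)
  have h5 : ((⌈t * n⌉₊ - 1 : ℕ) : ℝ) = ⌈t * n⌉₊ - 1 := by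
    rw [Nat.cast_sub h1, Nat.cast_one]
  refine ⟨⌈t * n⌉₊ - 1, by omega, ?_, ?_⟩
  · rw [h5, div_lt_iff₀ hn']; linarith
  · rw [h5, le_div_iff₀ hn']; linarith

lemma LInf.norm_le_of_ae {y : LInf} {b : ℝ} (hb : 0 ≤ b)
    (h : ∀ᵐ t ∂((volume : Measure ℝ).restrict (Icc (0 : ℝ) 1)), ‖y t‖ ≤ b) : ‖y‖ ≤ b :=
  (Lp.norm_le_of_ae_bound (C := b) hb h).trans (by simp)

lemma LInf.norm_le_of_cells (hn : 0 < n) {y : LInf} {b : ℝ} (hb : 0 ≤ b)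
    (h : ∀ᵐ t ∂((volume : Measure ℝ).restrict (Icc (0 : ℝ) 1)), ∀ j < n,
      t ∈ Ioc ((j : ℝ) / n) (((j : ℝ) + 1) / n) → ‖y t‖ ≤ b) : ‖y‖ ≤ b := by
  refine LInf.norm_le_of_ae hb ?_
  filter_upwards [h, ae_exists_mem_cell hn] with t ht ⟨j, hj, htj⟩ using ht j hj htj

lemma basisFun_of_mem {j i : ℕ} {t : ℝ} (ht : t ∈ Ioc ((j : ℝ) / n) (((j : ℝ) + 1) / n)) :
    basisFun r n j i t = cellBasis r n j i t := indicator_of_mem ht _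

lemma basisFun_of_mem_of_ne {j j' i : ℕ} {t : ℝ}
    (ht : t ∈ Ioc ((j : ℝ) / n) (((j : ℝ) + 1) / n)) (hj : j' ≠ j) :
    basisFun r n j' i t = 0 := by
  refine indicator_of_notMem (fun ht' => ?_) _
  rcases cells_ordered (n := n) hj with h | h
  · linarith [ht.1, ht'.2]
  · linarith [ht'.1, ht.2]

lemma interpOp_ae (x : LInf) :
    ∀ᵐ t ∂((volume : Measure ℝ).restrict (Icc (0 : ℝ) 1)), ∀ j : Fin n,
      t ∈ Ioc ((j : ℝ) / n) (((j : ℝ) + 1) / n) →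
      interpOp r n ev x t = ∑ i : Fin (2 * r + 1), ev j i x * (cellBasis r n j i t : ℂ) := by
  have h1 : interpOp r n ev x = ∑ p : Fin n × Fin (2 * r + 1),
      ev p.1 p.2 x • (basisFun_memLp r n p.1 p.2).toLp (basisFun r n p.1 p.2) := by
    rw [Fintype.sum_prod_type]
    simp [interpOp]
  have h2 : ∀ᵐ t ∂((volume : Measure ℝ).restrict (Icc (0 : ℝ) 1)),
      ∀ p : Fin n × Fin (2 * r + 1),
      (ev p.1 p.2 x • (basisFun_memLp r n p.1 p.2).toLp (basisFun r n p.1 p.2) : LInf) t =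
        ev p.1 p.2 x * basisFun r n p.1 p.2 t := by
    refine ae_all_iff.2 fun p => ?_
    filter_upwards [Lp.coeFn_smul (ev p.1 p.2 x)
      ((basisFun_memLp r n p.1 p.2).toLp (basisFun r n p.1 p.2)),
      (basisFun_memLp r n p.1 p.2).coeFn_toLp] with t h3 h4
    rw [h3, Pi.smul_apply, h4, smul_eq_mul]
  rw [h1]
  filter_upwards [h2, Lp.coeFn_finsetSum Finset.univ fun p : Fin n × Fin (2 * r + 1) =>
    ev p.1 p.2 x • (basisFun_memLp r n p.1 p.2).toLp (basisFun r n p.1 p.2)] with t h3 h4 j ht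
  rw [h4, Finset.sum_apply, Finset.sum_congr rfl fun p _ => h3 p, Fintype.sum_prod_type,
    Finset.sum_eq_single j]
  · exact Finset.sum_congr rfl fun i _ => by rw [basisFun_of_mem ht]
  · intro j' _ hj'
    refine Finset.sum_eq_zero fun i _ => ?_
    rw [basisFun_of_mem_of_ne ht (fun h => hj' (Fin.ext h)), mul_zero]
  · simp

lemma sub_interpOp_ae
    (hev : ∀ (j : Fin n) (i : Fin (2 * r + 1)), ExtendsEvaluation (node r n j i) (ev j i)) {x : LInf}
    {f : ℝ → ℂ} (hf : ContinuousOn f (Icc 0 1))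
    (hx : (x : ℝ → ℂ) =ᵐ[(volume : Measure ℝ).restrict (Icc (0 : ℝ) 1)] f) :
    ∀ᵐ t ∂((volume : Measure ℝ).restrict (Icc (0 : ℝ) 1)), ∀ j < n,
      t ∈ Ioc ((j : ℝ) / n) (((j : ℝ) + 1) / n) →
      (x - interpOp r n ev x : LInf) t = f t - cellInterp r n j f t := by
  filter_upwards [interpOp_ae (ev := ev) x, hx, Lp.coeFn_sub x (interpOp r n ev x)]
    with t h1 h2 h3 j hj ht
  rw [h3, Pi.sub_apply, h2, h1 ⟨j, hj⟩ ht, cellInterp, Finset.sum_range]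
  congr 1
  exact Finset.sum_congr rfl fun i _ => by rw [(hev ⟨j, hj⟩ i).2 x f hf hx]

/-- A bound for the norm of the interpolation operator. -/
noncomputable def interpBound (r : ℕ) : ℝ := (2 * r + 1) * basisBound r

lemma interpBound_nonneg (r : ℕ) : 0 ≤ interpBound r :=
  mul_nonneg (by positivity) (basisBound_nonneg r)

/-- The bound is uniform over all choices of extension, as each functional has norm at most `1`. -/
lemma norm_interpOp_le (hn : 0 < n)
    (hev : ∀ (j : Fin n) (i : Fin (2 * r + 1)), ExtendsEvaluation (node r n j i) (ev j i))
    (x : LInf) : ‖interpOp r n ev x‖ ≤ interpBound r * ‖x‖ := by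
  refine LInf.norm_le_of_cells hn (mul_nonneg (interpBound_nonneg r) (norm_nonneg x)) ?_
  filter_upwards [interpOp_ae (ev := ev) x] with t h1 j hj ht
  rw [h1 ⟨j, hj⟩ ht]
  refine (norm_sum_le_of_le (n := fun _ => ‖x‖ * basisBound r) _ fun i _ => ?_).trans_eq ?_
  · rw [norm_mul, Complex.norm_real]
    refine mul_le_mul ?_ (abs_cellBasis_le hn (Finset.mem_range.2 i.2) (Ioc_subset_Icc_self ht))
      (norm_nonneg _) (norm_nonneg _)
    refine ((ev ⟨j, hj⟩ i).le_opNorm x).trans ?_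
    exact mul_le_of_le_one_left (norm_nonneg _) (hev ⟨j, hj⟩ i).1
  · simp [interpBound]; ring

lemma norm_sub_interpOp_le_of_osc (hn : 0 < n)
    (hev : ∀ (j : Fin n) (i : Fin (2 * r + 1)), ExtendsEvaluation (node r n j i) (ev j i))
    {y : LInf} {g : ℝ → ℂ}
    (hg : ContinuousOn g (Icc 0 1))
    (hy : (y : ℝ → ℂ) =ᵐ[(volume : Measure ℝ).restrict (Icc (0 : ℝ) 1)] g) {ω : ℝ} (hω : 0 ≤ ω)
    (hosc : ∀ j < n, ∀ t ∈ cell n j, ∀ t' ∈ cell n j, ‖g t - g t'‖ ≤ ω) :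
    ‖y - interpOp r n ev y‖ ≤ interpBound r * ω := by
  refine LInf.norm_le_of_cells hn (mul_nonneg (interpBound_nonneg r) hω) ?_
  filter_upwards [sub_interpOp_ae hev hg hy] with t h1 j hj ht
  rw [h1 j hj ht]
  exact norm_sub_cellInterp_le_of_osc hn (hosc j hj) (Ioc_subset_Icc_self ht)

lemma norm_integral_sub_le {κ : ℝ → ℝ → ℝ}
    (hκ : ContinuousOn (fun p : ℝ × ℝ => κ p.1 p.2) (Icc 0 1 ×ˢ Icc 0 1)) {L : ℝ}
    (hκb : KernelBounds κ L) (x : LInf) {s s' : ℝ}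
    (hs : s ∈ Icc (0 : ℝ) 1) (hs' : s' ∈ Icc (0 : ℝ) 1) :
    ‖(∫ t in Icc (0 : ℝ) 1, (κ s t : ℂ) * x t) - ∫ t in Icc (0 : ℝ) 1, (κ s' t : ℂ) * x t‖ ≤
      L * |s - s'| * ‖x‖ := by
  have hL := hκb.nonneg
  rw [← integral_sub (kernel_integrable hκ x hs) (kernel_integrable hκ x hs')]
  refine (norm_integral_le_of_norm_le_const (C := L * |s - s'| * ‖x‖) ?_).trans (by simp)
  filter_upwards [LInf.ae_norm_le x, ae_restrict_mem measurableSet_Icc] with t ht ht'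
  rw [← sub_mul, norm_mul, ← Complex.ofReal_sub, Complex.norm_real]
  exact mul_le_mul (hκb.lip_fst s hs s' hs' t ht') ht (norm_nonneg _) (by positivity)

variable {κ : ℝ → ℝ → ℝ} (hκ : ContinuousOn (fun p : ℝ × ℝ => κ p.1 p.2) (Icc 0 1 ×ˢ Icc 0 1))

lemma integralOp_ae (x : LInf) :
    (integralOp hκ x : ℝ → ℂ) =ᵐ[(volume : Measure ℝ).restrict (Icc (0 : ℝ) 1)]
      fun s => ∫ t in Icc (0 : ℝ) 1, (κ s t : ℂ) * x t :=
  (integral_memLp hκ x).coeFn_toLp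

lemma norm_integralOp_le {x : LInf} {b : ℝ} (hb : 0 ≤ b)
    (h : ∀ s ∈ Icc (0 : ℝ) 1, ‖∫ t in Icc (0 : ℝ) 1, (κ s t : ℂ) * x t‖ ≤ b) :
    ‖integralOp hκ x‖ ≤ b := by
  refine LInf.norm_le_of_ae hb ?_
  filter_upwards [integralOp_ae hκ x, ae_restrict_mem measurableSet_Icc] with s h1 hs
  rw [h1]; exact h s hs

lemma sub_modifiedOp_apply (K Q : LInf →L[ℂ] LInf) (x : LInf) :
    (K - modifiedOp K Q) x = K (x - Q x) - Q (K (x - Q x)) := by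
  simp only [modifiedOp, sub_apply, add_apply, ContinuousLinearMap.comp_apply, map_sub]
  abel

/-- The outer `I - Q` acts on a function in the range of `K`, whose oscillation on a cell is at most
`L * h` times the norm of its preimage. -/
lemma norm_sub_modifiedOp_le {L : ℝ} (hκb : KernelBounds κ L) (hn : 0 < n)
    (hev : ∀ (j : Fin n) (i : Fin (2 * r + 1)), ExtendsEvaluation (node r n j i) (ev j i)) :
    ‖integralOp hκ - modifiedOp (integralOp hκ) (interpOp r n ev)‖ ≤
      interpBound r * L * (1 + interpBound r) * (1 / n) := by
  have hL := hκb.nonneg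
  have hM := interpBound_nonneg r
  refine ContinuousLinearMap.opNorm_le_bound _ (by positivity) fun x => ?_
  rw [sub_modifiedOp_apply]
  set z := x - interpOp r n ev x
  have hz : ‖z‖ ≤ (1 + interpBound r) * ‖x‖ :=
    (norm_sub_le _ _).trans (by linarith [norm_interpOp_le hn hev x])
  refine (norm_sub_interpOp_le_of_osc hn hev (integral_continuousOn hκ z) (integralOp_ae hκ z)
    (ω := L * (1 / n) * ‖z‖) (by positivity) fun j hj t ht t' ht' => ?_).trans ?_
  · refine (norm_integral_sub_le hκ hκb z (cell_subset hj ht) (cell_subset hj ht')).trans ?_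
    gcongr
    exact abs_sub_le_of_mem_cell ht ht'
  · calc interpBound r * (L * (1 / n) * ‖z‖)
        ≤ interpBound r * (L * (1 / n) * ((1 + interpBound r) * ‖x‖)) := by gcongr
      _ = _ := by ring

lemma nearNodal_of_ae {f v : ℝ → ℂ} {C : ℝ}
    (hf : ∀ j < n, ∃ c : ℂ, ‖c‖ ≤ C ∧ ∀ t ∈ cell n j,
      ‖f t - cellInterp r n j f t - c * cellNodal r n j t‖ ≤ C * (1 / n : ℝ) ^ (2 * r + 2))
    (hv : ∀ᵐ t ∂((volume : Measure ℝ).restrict (Icc (0 : ℝ) 1)), ∀ j < n,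
      t ∈ Ioc ((j : ℝ) / n) (((j : ℝ) + 1) / n) → v t = f t - cellInterp r n j f t) :
    NearNodal r n v C := by
  intro j hj
  obtain ⟨c, hc, hct⟩ := hf j hj
  refine ⟨c, hc, ?_⟩
  filter_upwards [(ae_restrict_iff' measurableSet_Icc).1 hv] with t ht htj
  rw [ht (cell_subset hj (Ioc_subset_Icc_self htj)) j hj htj]
  exact hct t (Ioc_subset_Icc_self htj)

/-- Consistency of the modified operator on a smooth function. -/
lemma exists_consistency {L : ℝ} (hκb : KernelBounds κ L) {u : LInf} {f : ℝ → ℂ}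
    (hf : ContDiffOn ℝ (2 * r + 2 : ℕ) f (Icc 0 1))
    (hu : (u : ℝ → ℂ) =ᵐ[(volume : Measure ℝ).restrict (Icc (0 : ℝ) 1)] f) :
    ∃ C : ℝ, 0 ≤ C ∧ ∀ n : ℕ, 0 < n → ∀ ev : Fin n → Fin (2 * r + 1) → LInf →L[ℂ] ℂ,
      (∀ (j : Fin n) (i : Fin (2 * r + 1)), ExtendsEvaluation (node r n j i) (ev j i)) →
      ‖(integralOp hκ - modifiedOp (integralOp hκ) (interpOp r n ev)) u‖ ≤
        C * (1 / n : ℝ) ^ (2 * r + 3) ∧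
      (r = 0 → ‖integralOp hκ ((integralOp hκ -
        modifiedOp (integralOp hκ) (interpOp r n ev)) u)‖ ≤ C * (1 / n : ℝ) ^ 4) := by
  have hL := hκb.nonneg
  have hM := interpBound_nonneg r
  obtain ⟨C, hC, hcell⟩ := exists_interp_error hf
  -- The first summand bounds the outer interpolation error of a function with oscillation `5 * L *
  -- C * h^(2r+3)`; the second is `2 * L * (12 + 5) * (L * C)`, for the midpoint case.
  refine ⟨interpBound r * (5 * (L * C)) + 34 * (L * (L * C)), by positivity,
    fun n hn ev hev => ?_⟩
  have hz := sub_interpOp_ae hev hf.continuousOn hu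
  set z := u - interpOp r n ev u with hzdef
  have hnear : NearNodal r n z C := nearNodal_of_ae (fun j hj => hcell n j hj) hz
  have hzint : IntegrableOn (z : ℝ → ℂ) (Icc 0 1) := LInf.integrable z
  have hosc : ∀ j < n, ∀ s ∈ cell n j, ∀ s' ∈ cell n j,
      ‖(∫ t in Icc (0 : ℝ) 1, (κ s t : ℂ) * z t) - ∫ t in Icc (0 : ℝ) 1, (κ s' t : ℂ) * z t‖ ≤
        5 * (L * C) * (1 / n : ℝ) ^ (2 * r + 3) := fun j hj =>
    osc_integral_nearNodal hκ hκb hn hC hnear hzint (fun _ _ => rfl) hj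
  have hgc := integral_continuousOn hκ z
  rw [sub_modifiedOp_apply, ← hzdef]
  refine ⟨?_, fun hr => ?_⟩
  · refine (norm_sub_interpOp_le_of_osc hn hev hgc (integralOp_ae hκ z) (by positivity)
      hosc).trans ?_
    rw [add_mul, ← mul_assoc]
    exact le_add_of_nonneg_right (by positivity)
  · subst hr
    have hA := (ae_restrict_iff' measurableSet_Icc).1
      (sub_interpOp_ae hev hgc (integralOp_ae hκ z))
    refine norm_integralOp_le hκ (by positivity) fun s hs => ?_
    -- For `r = 0` the only basis polynomial is `1`, so interpolation takes the midpoint value.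
    have hcb : ∀ j t, cellBasis 0 n j 0 t = 1 := fun j t => by
      simpa using sum_cellBasis (r := 0) (j := j) hn t
    refine (norm_integral_mul_sub_midpoint_le hκ hκb hn (by positivity) (by positivity) hgc hosc
      (ω₂ := 12 * (L * C) * (1 / n : ℝ) ^ 4) (fun j hj =>
        second_difference_integral_nearNodal hκ hκb hn hC hnear hzint (fun _ _ => rfl) hj)
      (LInf.integrable _) (fun j hj => ?_) hs).trans ?_
    · filter_upwards [hA] with t ht htj
      rw [ht (cell_subset hj (Ioc_subset_Icc_self htj)) j hj htj]
      simp [cellInterp, hcb]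
    · calc _ = 34 * (L * (L * C)) * (1 / n : ℝ) ^ 4 := by ring
        _ ≤ _ := by
          gcongr
          exact le_add_of_nonneg_left (by positivity)

end LInfEstimates

/-! ### The eigenvector's smooth representative and the convergence rates -/

/-- An eigenvector of a Green's kernel for a nonzero eigenvalue has a smooth representative. -/
lemma GreenKernel.exists_contDiffOn_of_eigen {r : ℕ} (G : GreenKernel r) {lam : ℂ}
    (hlam : lam ≠ 0) {u : LInf} (hu : G.op u = lam • u) :
    ∃ f : ℝ → ℂ, ContDiffOn ℝ (2 * r + 2 : ℕ) f (Icc 0 1) ∧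
      (u : ℝ → ℂ) =ᵐ[(volume : Measure ℝ).restrict (Icc (0 : ℝ) 1)] f := by
  have hκ := G.continuousOn_kernel
  obtain ⟨D, E, hD, hE, hkD, hkE⟩ := G.exists_partials
  have huf : (u : ℝ → ℂ) =ᵐ[(volume : Measure ℝ).restrict (Icc (0 : ℝ) 1)]
      fun s => lam⁻¹ * ∫ t in Icc (0 : ℝ) 1, (G.kernel s t : ℂ) * u t := by
    have h1 : (G.op u : ℝ → ℂ) =ᵐ[(volume : Measure ℝ).restrict (Icc (0 : ℝ) 1)]
        fun s => ∫ t in Icc (0 : ℝ) 1, (G.kernel s t : ℂ) * u t := integralOp_ae hκ u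
    rw [hu] at h1
    filter_upwards [h1, Lp.coeFn_smul lam u] with s h2 h3
    rw [← h2, h3, Pi.smul_apply, smul_eq_mul, inv_mul_cancel_left₀ hlam]
  -- The representative is `lam⁻¹` times the integral itself; it satisfies the eigenvalue equation
  -- at every point, since the integral depends only on the class of `u`.
  refine ⟨_, contDiffOn_of_green_eigen hD hE hkD hkE hκ (ν := lam⁻¹)
    ((integral_continuousOn hκ u).const_mul lam⁻¹) fun s _ => ?_, huf⟩
  congr 1
  refine integral_congr_ae ?_
  filter_upwards [huf] with t ht
  exact congrArg _ ht

theorem mainTheorem4 (r : ℕ) (G : GreenKernel r)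
    (ev : (n : ℕ) → Fin n → Fin (2 * r + 1) → LInf →L[ℂ] ℂ)
    (hev : ∀ (n : ℕ) (j : Fin n) (i : Fin (2 * r + 1)), ExtendsEvaluation (node r n j i) (ev n j i))
    (lam : ℂ) (hlam : lam ≠ 0) (c : ℂ) (R : ℝ) (hΓ : Isolates G.op lam c R)
    (hsimple : Module.finrank ℂ (spectralProj G.op c R).range = 1) :
    ∃ lamM : ℕ → ℂ, Filter.Tendsto lamM Filter.atTop (nhds lam) ∧
    ∃ (C : ℝ) (N : ℕ), 1 ≤ N ∧ ∀ n : ℕ, N ≤ n →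
      Isolates (modifiedOp G.op (interpOp r n (ev n))) (lamM n) c R ∧
      Module.finrank ℂ (spectralProj (modifiedOp G.op (interpOp r n (ev n))) c R).range = 1 ∧
      (spectralProj (modifiedOp G.op (interpOp r n (ev n))) c R).range =
        Module.End.eigenspace
          (modifiedOp G.op (interpOp r n (ev n)) : LInf →ₗ[ℂ] LInf) (lamM n) ∧
      ‖lam - lamM n‖ ≤ C * (1 / (n : ℝ)) ^ (if r = 0 then 4 else 2 * r + 3 : ℕ) ∧
      ∀ φ ∈ (spectralProj (modifiedOp G.op (interpOp r n (ev n))) c R).range, ‖φ‖ = 1 →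
        ‖φ - spectralProj G.op c R φ‖ ≤
            C * (1 / (n : ℝ)) ^ (if r = 0 then 3 else 2 * r + 2 : ℕ) ∧
        ‖(lamM n)⁻¹ • G.op φ - spectralProj G.op c R ((lamM n)⁻¹ • G.op φ)‖ ≤
            C * (1 / (n : ℝ)) ^ (if r = 0 then 4 else 2 * r + 3 : ℕ) := by
  obtain ⟨u, hu, δ, hδ, C₀, hC₀, hpert⟩ :=
    simple_eigenvalue_perturbation hlam hΓ.1 hΓ.2 hsimple
  obtain ⟨f, hf, huf⟩ := G.exists_contDiffOn_of_eigen hlam hu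
  obtain ⟨L, hL⟩ := G.exists_kernelBounds
  obtain ⟨C₁, hC₁, hcons⟩ := exists_consistency G.continuousOn_kernel hL hf huf
  set T : ℕ → LInf →L[ℂ] LInf := fun n => modifiedOp G.op (interpOp r n (ev n)) with hT
  set A := interpBound r * L * (1 + interpBound r)
  have hA : 0 ≤ A :=
    mul_nonneg (mul_nonneg (interpBound_nonneg r) hL.nonneg) (by linarith [interpBound_nonneg r])
  have hdiff : ∀ n : ℕ, 0 < n → ‖G.op - T n‖ ≤ A * (1 / n) := fun n hn =>
    norm_sub_modifiedOp_le G.continuousOn_kernel hL hn (hev n)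
  have hh : ∀ n : ℕ, 0 < n → (0 : ℝ) ≤ 1 / n ∧ (1 : ℝ) / n ≤ 1 := fun n hn =>
    ⟨by positivity, by
      rw [div_le_one (by exact_mod_cast hn)]
      exact_mod_cast hn⟩
  have hres : ∀ n : ℕ, 0 < n → ‖(G.op - T n) u‖ ≤ C₁ * (1 / n : ℝ) ^ (2 * r + 3) := fun n hn =>
    (hcons n hn (ev n) (hev n)).1
  -- For `r ≥ 1` the residual is one order better than the stated eigenvector bound requires.
  have hres' : ∀ n : ℕ, 0 < n → ‖(G.op - T n) u‖ ≤
      C₁ * (1 / n : ℝ) ^ (if r = 0 then 3 else 2 * r + 2 : ℕ) := fun n hn => by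
    refine (hres n hn).trans (mul_le_mul_of_nonneg_left
      (pow_le_pow_of_le_one (hh n hn).1 (hh n hn).2 ?_) hC₁)
    split_ifs <;> omega
  set B := (‖G.op‖ + 1 + A) * C₁
  have hB : 0 ≤ B := by positivity
  -- Only for `r = 0` is the separate estimate of `G.op` applied to the residual used; there `‖D‖ ‖D
  -- u‖` is already `O(h * h^3)`.
  have hsup : ∀ n : ℕ, 0 < n → ‖G.op ((G.op - T n) u)‖ + ‖G.op - T n‖ * ‖(G.op - T n) u‖ ≤
      B * (1 / n : ℝ) ^ (if r = 0 then 4 else 2 * r + 3 : ℕ) := fun n hn => by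
    obtain ⟨h0, h1⟩ := hh n hn
    have hprod := mul_le_mul (hdiff n hn) (hres n hn) (norm_nonneg _) (by positivity)
    split_ifs with hr
    · have h4 := (hcons n hn (ev n) (hev n)).2 hr
      have hop : 0 ≤ ‖G.op‖ * C₁ * (1 / n : ℝ) ^ 4 := by positivity
      subst hr
      calc _ ≤ C₁ * (1 / n : ℝ) ^ 4 + A * (1 / n) * (C₁ * (1 / n) ^ (2 * 0 + 3)) :=
            add_le_add h4 hprod
        _ ≤ ‖G.op‖ * C₁ * (1 / n : ℝ) ^ 4 + (C₁ * (1 / n : ℝ) ^ 4 +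
            A * (1 / n) * (C₁ * (1 / n) ^ (2 * 0 + 3))) := le_add_of_nonneg_left hop
        _ = _ := by ring
    · have hop := (G.op.le_opNorm ((G.op - T n) u)).trans
        (mul_le_mul_of_nonneg_left (hres n hn) (norm_nonneg _))
      have hp : 0 ≤ C₁ * (1 / n : ℝ) ^ (2 * r + 3) := by positivity
      calc _ ≤ ‖G.op‖ * (C₁ * (1 / n : ℝ) ^ (2 * r + 3)) +
            A * (1 / n) * (C₁ * (1 / n) ^ (2 * r + 3)) := add_le_add hop hprod
        _ ≤ ‖G.op‖ * (C₁ * (1 / n : ℝ) ^ (2 * r + 3)) +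
            A * 1 * (C₁ * (1 / n) ^ (2 * r + 3)) := by gcongr
        _ ≤ C₁ * (1 / n : ℝ) ^ (2 * r + 3) + (‖G.op‖ * (C₁ * (1 / n : ℝ) ^ (2 * r + 3)) +
            A * 1 * (C₁ * (1 / n) ^ (2 * r + 3))) := le_add_of_nonneg_left hp
        _ = _ := by ring
  obtain ⟨N₀, hN₀⟩ := exists_nat_gt (A / δ)
  have hclose : ∀ n : ℕ, N₀ + 1 ≤ n → 0 < n ∧ ‖G.op - T n‖ ≤ δ := fun n hn => by
    have hn0 : 0 < n := by omega
    refine ⟨hn0, (hdiff n hn0).trans ?_⟩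
    have hn1 : (0 : ℝ) < n := by exact_mod_cast hn0
    have hn2 : (N₀ : ℝ) ≤ n := by exact_mod_cast (Nat.le_succ N₀).trans hn
    rw [mul_one_div, div_le_iff₀ hn1]
    rw [div_lt_iff₀ hδ] at hN₀
    nlinarith
  -- Below the threshold the value of the sequence is irrelevant and set to `0`.
  have hex : ∀ n : ℕ, ∃ μ : ℂ, N₀ + 1 ≤ n → _ := fun n =>
    if hn : N₀ + 1 ≤ n then
      (hpert (T n) (hclose n hn).2).imp fun _ hμ _ => hμ
    else ⟨0, fun h => absurd h hn⟩
  choose lamM hlamM using hex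
  have hrate : ∀ n : ℕ, N₀ + 1 ≤ n → ‖lam - lamM n‖ ≤
      C₀ * B * (1 / n : ℝ) ^ (if r = 0 then 4 else 2 * r + 3 : ℕ) := fun n hn => by
    rw [mul_assoc]
    exact (hlamM n hn).2.2.2.2.1.trans
      (mul_le_mul_of_nonneg_left (hsup n (hclose n hn).1) hC₀)
  refine ⟨lamM, ?_, max (C₀ * B) (C₀ * C₁), N₀ + 1, by omega, fun n hn => ?_⟩
  · rw [tendsto_iff_norm_sub_tendsto_zero]
    have hlim := ((tendsto_one_div_atTop_nhds_zero_nat (𝕜 := ℝ)).pow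
      (if r = 0 then 4 else 2 * r + 3 : ℕ)).const_mul (C₀ * B)
    rw [zero_pow (by split_ifs <;> omega), mul_zero] at hlim
    refine squeeze_zero' (Filter.Eventually.of_forall fun _ => norm_nonneg _) ?_ hlim
    filter_upwards [Filter.eventually_ge_atTop (N₀ + 1)] with n hn
    rw [norm_sub_rev]
    exact hrate n hn
  · obtain ⟨hn0, -⟩ := hclose n hn
    obtain ⟨h1, h2, h3, h4, -, h6⟩ := hlamM n hn
    have hpow := fun p : ℕ => pow_nonneg (hh n hn0).1 p
    have hleft := fun p : ℕ => mul_le_mul_of_nonneg_right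
      (le_max_left (C₀ * B) (C₀ * C₁)) (hpow p)
    have hright := fun p : ℕ => mul_le_mul_of_nonneg_right
      (le_max_right (C₀ * B) (C₀ * C₁)) (hpow p)
    refine ⟨⟨h1, h2⟩, h3, h4, (hrate n hn).trans (hleft _), fun φ hφ hφ1 => ?_⟩
    obtain ⟨h7, h8⟩ := h6 φ hφ hφ1
    refine ⟨h7.trans (le_trans ?_ (hright _)), h8.trans (le_trans ?_ (hleft _))⟩
    · rw [mul_assoc]; exact mul_le_mul_of_nonneg_left (hres' n hn0) hC₀
    · rw [mul_assoc]; exact mul_le_mul_of_nonneg_left (hsup n hn0) hC₀
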